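/- **Definitions.** Let $t=(t_1,t_2)$ be the standard coordinates of $(\mathbb C^2,0)$ and $\partial_i=\partial/\partial t_i$. Let $\mathbb C\{t\}$ and $\mathbb C\{t,z\}$ be the rings of convergent power series, and let $\mathbb C\{t,z]]$ be the ring of formal power series $\sum_{n\ge 0}a_n(t)z^n$ such that all $a_n$ are holomorphic on one and the same neighbourhood of $0$. For $k\ge 0$ let $\mathbb C[[z]][t_2]_{\le k}$ be the space of series $\sum_{n\ge 0}a_nz^n$ with $a_n\in\mathbb C[t_2]$ of degree at most $k$. A (holomorphic) $(T)$-structure of rank $r$ over $(\mathbb C^2,0)$ is a pair of $r\times r$ matrices $A_1,A_2$ with entries in $\mathbb C\{t,z\}$ (the connection form is $z^{-1}(A_1dt_1+A_2dt_2)$) satisfying the flatness condition $z\partial_1A_2-z\partial_2A_1+[A_1,A_2]=0$. It is a formal $(T)$-structure if the entries are only required to lie in $\mathbb C\{t,z]]$. For a vector field $X=X_1\partial_1+X_2\partial_2$ put $C_X=X_1A_1|_{z=0}+X_2A_2|_{z=0}$. For $m\ge 3$, the germ $I_2(m)$ is $(\mathbb C^2,0)$ with the commutative, associative, $\mathbb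 C\{t\}$-bilinear multiplication $\circ$ of vector fields which has unit $\partial_1$ and satisfies $\partial_2\circ\partial_2=t_2^{m-2}\partial_1$. A (holomorphic or formal) $(T)$-structure is *over $I_2(m)$* if there is a primitive section $\zeta\in\mathbb C\{t\}^r$, i.e. one for which $X\mapsto C_X\zeta$ is an isomorphism from the tangent space at $0$ to the fibre $\mathbb C^r$ at $0$ (so that $r=2$), and $C_{X\circ Y}\zeta=C_XC_Y\zeta$ for all holomorphic vector fields $X,Y$. Two $(T)$-structures $(A_1,A_2)$, $(\tilde A_1,\tilde A_2)$ are *gauge isomorphic* if there is a matrix $T$ with entries in $\mathbb C\{t,z\}$, invertible at $(t,z)=(0,0)$, such that $z\partial_iT+A_iT-T\tilde A_i=0$ for $i=1,2$; they are *formally gauge isomorphic* if the same holds with the entries of $T$ in $\mathbb C\{t,z]]$. **Theorem 4.1.** Let $m\ge 3$ and consider the form $$A_1=C_1=\begin{pmatrix}1&0\\0&1\end{pmatrix},\qquad A_2=C_2+zfE,\qquad C_2=\begin{pmatrix}0&t_2^{m-2}\\1&0\end{pmatrix},\quad E=\begin{pmatrix}0&1\\0&0\end{pmatrix}.\tag{$*$}$$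 (i) Any $(T)$-structure over $I_2(m)$ is gauge isomorphic to a $(T)$-structure over $I_2(m)$ of the form $(*)$ with $f\in\mathbb C\{t,z\}$. (ii) Any formal $(T)$-structure over $I_2(m)$ is formally gauge isomorphic to a formal $(T)$-structure over $I_2(m)$ of the form $(*)$ with $f\in\mathbb C\{t,z]]$. (iii) Any holomorphic or formal $(T)$-structure over $I_2(m)$ is formally gauge isomorphic to a formal $(T)$-structure over $I_2(m)$ of the form $(*)$ with $f=0$ if $m=3$ and $f\in\mathbb C[[z]][t_2]_{\le m-4}$ if $m\ge 4$. The function $f$ with this property is unique. -/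

import Mathlib

open scoped Matrix

noncomputable section

namespace TStr

/-! ### Rings of convergent and formal power series

Germs at the origin of holomorphic functions of `t = (t_1, …, t_d)` are represented by their
Taylor series.  A series in `(t, z)` is a power series in `z` whose coefficients are
power series in `t`.  The coordinate `t_i` of the text is the variable with index `i - 1`. -/

/-- Power series in `t = (t_1, …, t_d)`. -/
abbrev SeriesT (d : ℕ) : Type := MvPowerSeries (Fin d) ℂ

/-- Power series `∑ n, a n * z ^ n` with `a n` a power series in `t`. -/
abbrev SeriesTZ (d : ℕ) : Type := PowerSeries (SeriesT d)

/-- `a` converges absolutely on the closed polydisc `|t_i| ≤ ρ`. -/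
def ConvergesOn {d : ℕ} (ρ : ℝ) (a : SeriesT d) : Prop :=
  Summable fun e : Fin d →₀ ℕ => ‖MvPowerSeries.coeff e a‖ * ρ ^ e.degree

/-- The ring `ℂ{t}` of convergent power series (germs of holomorphic functions of `t`). -/
def convT (d : ℕ) : Set (SeriesT d) :=
  {a | ∃ ρ : ℝ, 0 < ρ ∧ ConvergesOn ρ a}

/-- The ring `ℂ{t, z}` of convergent power series in `t` and `z`. -/
def convTZ (d : ℕ) : Set (SeriesTZ d) :=
  {f | ∃ ρ : ℝ, 0 < ρ ∧ Summable fun p : ℕ × (Fin d →₀ ℕ) =>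
    ‖MvPowerSeries.coeff p.2 (PowerSeries.coeff p.1 f)‖ * ρ ^ (p.1 + p.2.degree)}

/-- The ring `ℂ{t, z]]` of formal power series in `z` all of whose coefficients are
holomorphic functions of `t` on one and the same neighbourhood of the origin. -/
def formalTZ (d : ℕ) : Set (SeriesTZ d) :=
  {f | ∃ ρ : ℝ, 0 < ρ ∧ ∀ n : ℕ, ConvergesOn ρ (PowerSeries.coeff n f)}

/-- The partial derivative `∂_i = ∂ / ∂ t_i` of a series in `(t, z)`. -/
def dT {d : ℕ} (i : Fin d) (f : SeriesTZ d) : SeriesTZ d :=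
  PowerSeries.mk fun n => MvPowerSeries.pderiv (R := ℂ) i (PowerSeries.coeff n f)

/-- The variable `z`. -/
def zVar (d : ℕ) : SeriesTZ d := PowerSeries.X

/-- Restriction to `z = 0`. -/
def atZ0 {d : ℕ} (f : SeriesTZ d) : SeriesT d := PowerSeries.coeff 0 f

/-- Value at `t = 0`. -/
def atT0 {d : ℕ} (a : SeriesT d) : ℂ := MvPowerSeries.constantCoeff a

/-! ### `(T)`-structures over the germ `(ℂ^d, 0)` -/

/-- `A = (A_1, …, A_d)` is the connection form `z⁻¹ ∑ A_i dt_i` of a `(T)`-structure of rank `r`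
on the trivial bundle over `(ℂ, 0) × (ℂ^d, 0)`, with entries in `R`: the flatness condition is
`z ∂_i A_j - z ∂_j A_i + [A_i, A_j] = 0`.
For `R = convTZ d` this is a (holomorphic) `(T)`-structure, for `R = formalTZ d` a formal one. -/
def IsTStructure {d r : ℕ} (R : Set (SeriesTZ d))
    (A : Fin d → Matrix (Fin r) (Fin r) (SeriesTZ d)) : Prop :=
  (∀ i a b, A i a b ∈ R) ∧
  ∀ i j, zVar d • (A j).map (dT i) - zVar d • (A i).map (dT j) + (A i * A j - A j * A i) = 0

/-- The Higgs field `C_X = ∑ X_i A_i(0)` on the restriction of the bundle to `z = 0`,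
for a vector field `X = ∑ X_i ∂_i`. -/
def higgs {d r : ℕ} (A : Fin d → Matrix (Fin r) (Fin r) (SeriesTZ d)) (X : Fin d → SeriesT d) :
    Matrix (Fin r) (Fin r) (SeriesT d) :=
  ∑ i, X i • (A i).map atZ0

/-- The holomorphic section `ζ` is primitive at the origin: the map `X ↦ C_X ζ` from the tangent
space at the origin to the fibre of the bundle at `z = 0`, `t = 0` is an isomorphism
(it is then an isomorphism on a neighbourhood of the origin). -/
def IsPrimitive {d r : ℕ} (A : Fin d → Matrix (Fin r) (Fin r) (SeriesTZ d))
    (ζ : Fin r → SeriesT d) : Prop :=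
  (∀ a, ζ a ∈ convT d) ∧
  Function.Bijective fun v : Fin d → ℂ =>
    (∑ i, v i • fun a : Fin r => atT0 ((((A i).map atZ0) *ᵥ ζ) a))

/-- `A` satisfies the unfolding condition and the multiplication that it induces on
the tangent bundle, by `C_{X ∘ Y} ζ = C_X (C_Y ζ)` for a primitive section `ζ`, is `mul`. -/
def Induces {d r : ℕ} (A : Fin d → Matrix (Fin r) (Fin r) (SeriesTZ d))
    (mul : (Fin d → SeriesT d) → (Fin d → SeriesT d) → (Fin d → SeriesT d)) : Prop :=
  ∃ ζ : Fin r → SeriesT d, IsPrimitive A ζ ∧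
    ∀ X Y : Fin d → SeriesT d, (∀ i, X i ∈ convT d) → (∀ i, Y i ∈ convT d) →
      higgs A (mul X Y) *ᵥ ζ = higgs A X *ᵥ (higgs A Y *ᵥ ζ)

/-- The connection forms `A` (of rank `r`) and `A'` (of rank `s`) are gauge isomorphic, by an
isomorphism with entries in `R`: there is a matrix `T`, invertible at the origin, with
`z ∂_i T + A_i T - T A'_i = 0` for all `i`.
For `R = convTZ d` these are gauge isomorphisms, for `R = formalTZ d` formal ones. -/
def GaugeIso {d r s : ℕ} (R : Set (SeriesTZ d))
    (A : Fin d → Matrix (Fin r) (Fin r) (SeriesTZ d))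
    (A' : Fin d → Matrix (Fin s) (Fin s) (SeriesTZ d)) : Prop :=
  ∃ T : Matrix (Fin r) (Fin s) (SeriesTZ d),
    (∀ a b, T a b ∈ R) ∧
    (Function.Bijective fun v : Fin s → ℂ => T.map (fun f => atT0 (atZ0 f)) *ᵥ v) ∧
    ∀ i, zVar d • T.map (dT i) + A i * T - T * A' i = 0

/-! ### The germ `I_2(m)` -/

/-- The coordinate function `t_2` on `ℂ^2`. -/
def t2 : SeriesT 2 := MvPowerSeries.X 1

/-- The multiplication of `I_2(m)`: `∂_1` is the unit field and `∂_2 ∘ ∂_2 = t_2^(m-2) ∂_1`. -/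
def mulI2 (m : ℕ) (X Y : Fin 2 → SeriesT 2) : Fin 2 → SeriesT 2 :=
  ![X 0 * Y 0 + t2 ^ (m - 2) * (X 1 * Y 1), X 0 * Y 1 + X 1 * Y 0]

/-- `A` is a `(T)`-structure (with entries in `R`) over the germ `I_2(m)`. -/
def IsTStructureOverI2 {r : ℕ} (R : Set (SeriesTZ 2)) (m : ℕ)
    (A : Fin 2 → Matrix (Fin r) (Fin r) (SeriesTZ 2)) : Prop :=
  IsTStructure R A ∧ Induces A (mulI2 m)

/-- The matrix `C_2`. -/
def C2 (m : ℕ) : Matrix (Fin 2) (Fin 2) (SeriesTZ 2) :=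
  !![0, PowerSeries.C (t2 ^ (m - 2)); 1, 0]

/-- The matrix `E`. -/
def matE : Matrix (Fin 2) (Fin 2) (SeriesTZ 2) := !![0, 1; 0, 0]

/-- The connection form `A_1 = C_1 = Id`, `A_2 = C_2 + z f E`. -/
def normalForm (m : ℕ) (f : SeriesTZ 2) : Fin 2 → Matrix (Fin 2) (Fin 2) (SeriesTZ 2) :=
  ![1, C2 m + (zVar 2 * f) • matE]

/-- `ℂ[[z]][t_2]_{≤ k}`: series `∑ a_n z^n` with `a_n` a polynomial of degree
at most `k` in `t_2`. -/
def polyT2 (k : ℕ) : Set (SeriesTZ 2) :=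
  {f | ∃ p : ℕ → Polynomial ℂ, (∀ n, (p n).natDegree ≤ k) ∧
    f = PowerSeries.mk fun n => Polynomial.aeval t2 (p n)}

/-- The functions `f` of the unique normal form: `f = 0` if `m = 3`, and
`f ∈ ℂ[[z]][t_2]_{≤ m - 4}` if `m ≥ 4`. -/
def IsReduced (m : ℕ) (f : SeriesTZ 2) : Prop :=
  (m = 3 → f = 0) ∧ (4 ≤ m → f ∈ polyT2 (m - 4))

end TStr

end

/-!
A gauge transformation `T` acts on a connection form by `A_i ↦ T⁻¹ (A_i T + z ∂_i T)`.

*Reduction to the form `(*)`.* The unfolding condition with the unit field `∂_1` gives `A_1 = 1`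
at `z = 0`, so `A_1 = 1 + z B`, and the solution of `∂_1 T = - B T` makes `A_1` equal to `1`
(`IsAdmissible.exists_gauge_one`). Flatness then says that `A_2` does not depend on `t_1`. The value
at the origin of the primitive section is a cyclic vector of `A_2` at the origin, and as a constant
vector it brings `A_2` to the companion form with columns `(0, 1)` and `(b, d)`
(`IsAdmissible.exists_gauge_companion`). As `A_2` squares to `t_2 ^ (m - 2)` at `z = 0`, one has
`b = t_2 ^ (m - 2)` and `d = 0` there. A shear and a scalar integrating factor remove `d` and keep
the rest of the shape (`IsAdmissible.exists_gauge_normalForm`).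

All this takes place in a ring of series that is closed under derivatives, inverses, division
by `z` and linear differential equations (`IsAdmissible`). To treat `ℂ{t, z}` and `ℂ{t, z]]` at the
same time, both are written as the sets of series with finite weighted `ℓ¹` norm: the monomial
`z ^ n t ^ e` has weight `w n * ρ ^ |e|`, where `w` runs through the geometric sequences for
`ℂ{t, z}` and through all positive submultiplicative sequences bounded by `1` for `ℂ{t, z]]`.
Inverses and solutions of differential equations are fixed points `x = a + L x` of operators that
raise a grading; such an `x` exists as a formal series, and its norm is finite as soon as `L` is a
contraction (`RaisesGrading.exists_fixedPoint`).

*Reduction of `f`.* A gauge transformation between two forms `(*)` given by `f` and `g` is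
determined by its first column `(P, R)`. With `δ = g - f`, `k = m - 2`, and primes for derivatives
by `t_2`, the equations are (`IsGaugeColumn`)

  `R δ = 2 P' + z R''`,  `P δ = t_2 ^ (k - 1) (k R + 2 t_2 R') + z (f' R + 2 f R' + P'')`.

At each power of `z` this is a linear system for the coefficients of `P` and `R`, solvable
if `g` compensates the part of the second equation of degree `< k - 1` in `t_2`; dividing by
`t_2 ^ (k - 1)` leaves a system with a regular singular point (`exists_singular_system`). It has the
same homogeneous part at every power of `z`, hence all coefficients converge on one disc
(`exists_reduction`), although nothing is said about convergence in `z`. For uniqueness, the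
equations for two reduced `f` and `g` show by induction that `δ`, `R` and `P'` are divisible by all
powers of `z`: `P` is invertible, so that `t_2 ^ (k - 1)` divides a polynomial in `t_2` of degree
`< k - 1` (`IsGaugeColumn.eq_of_isReduced`).
-/

open scoped Matrix ENNReal NNReal

noncomputable section

namespace TStr

/-! ### Weighted `ℓ¹` norms and a contraction principle -/

/-- The weighted `ℓ¹` norm of a family of complex numbers. It takes values in `[0, ∞]`, so that its
inequalities hold without any summability hypothesis. -/
def wnorm {P : Type*} (W : P → ℝ≥0∞) (F : P → ℂ) : ℝ≥0∞ := ∑' p, ‖F p‖ₑ * W p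

section wnorm

variable {P : Type*} (W : P → ℝ≥0∞)

lemma wnorm_add_le (F G : P → ℂ) : wnorm W (F + G) ≤ wnorm W F + wnorm W G := by
  unfold wnorm
  rw [← ENNReal.tsum_add]
  refine ENNReal.tsum_le_tsum fun p => ?_
  rw [← add_mul]
  gcongr
  exact enorm_add_le _ _

lemma wnorm_mono {W W' : P → ℝ≥0∞} {F G : P → ℂ} (h : ∀ p, ‖F p‖ₑ * W p ≤ ‖G p‖ₑ * W' p) :
    wnorm W F ≤ wnorm W' G :=
  ENNReal.tsum_le_tsum h

lemma wnorm_le_of_finset {F : P → ℂ} {C : ℝ≥0∞}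
    (h : ∀ s : Finset P, ∑ p ∈ s, ‖F p‖ₑ * W p ≤ C) : wnorm W F ≤ C := by
  unfold wnorm
  rw [ENNReal.tsum_eq_iSup_sum]
  exact iSup_le h

end wnorm

/-- An additive operator on an `E` with coordinates `c`, graded by `δ`, *raises the grading* if the
coordinates of `L x` of degree `≤ k` vanish as soon as those of `x` of degree `< k` do. -/
def RaisesGrading {P E : Type*} [AddCommGroup E] (c : E →+ (P → ℂ)) (δ : P → ℕ) (L : E →+ E) :
    Prop :=
  ∀ k x, (∀ p, δ p < k → c x p = 0) → ∀ p, δ p < k + 1 → c (L x) p = 0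

section contraction

variable {P E : Type*} [AddCommGroup E] {c : E →+ (P → ℂ)} {δ : P → ℕ} {L : E →+ E}

lemma RaisesGrading.eq_zero (hL : RaisesGrading c δ L) (hc : Function.Injective c)
    {x : E} (hx : x = L x) : x = 0 := by
  have key : ∀ k p, δ p < k → c x p = 0 := by
    intro k
    induction k with
    | zero => intro p hp; omega
    | succ k ih => rw [hx]; exact hL k x ih
  refine hc (funext fun p => ?_)
  rw [map_zero]
  exact key (δ p + 1) p (Nat.lt_succ_self _)

/-- The fixed point equation `x = a + L x` is solved one degree at a time, and the solution is
controlled in every weighted norm for which `L` is a contraction with factor `1 / 2`. -/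
theorem RaisesGrading.exists_fixedPoint (hL : RaisesGrading c δ L) (hc : Function.Bijective c)
    (a : E) :
    ∃ x, x = a + L x ∧ ∀ W : P → ℝ≥0∞, (∀ y, wnorm W (c (L y)) ≤ 2⁻¹ * wnorm W (c y)) →
      wnorm W (c x) ≤ 2 * wnorm W (c a) := by
  let u : ℕ → E := fun k => Nat.rec 0 (fun _ y => a + L y) k
  have u0 : u 0 = 0 := rfl
  have us : ∀ k, u (k + 1) = a + L (u k) := fun k => rfl
  clear_value u
  -- The coordinates of degree `< k` of the iterates are constant from the `k`-th iterate on.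
  have hdiff : ∀ k p, δ p < k → c (u (k + 1) - u k) p = 0 := by
    intro k
    induction k with
    | zero => intro p hp; omega
    | succ k ih =>
      have : u (k + 1 + 1) - u (k + 1) = L (u (k + 1) - u k) := by
        rw [us (k + 1), map_sub, us k]
        abel
      rw [this]
      exact hL k _ ih
  have hstab : ∀ p j, c (u (δ p + 1 + j)) p = c (u (δ p + 1)) p := by
    intro p j
    induction j with
    | zero => rfl
    | succ j ih =>
      rw [← ih]
      have := hdiff (δ p + 1 + j) p (by omega)
      rw [map_sub, Pi.sub_apply, sub_eq_zero] at this
      exact this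
  obtain ⟨x, hx⟩ := hc.2 fun p => c (u (δ p + 1)) p
  have hxu : ∀ k p, δ p < k → c x p = c (u k) p := by
    intro k p hp
    obtain ⟨j, rfl⟩ := Nat.exists_eq_add_of_lt hp
    have h : δ p + j + 1 = δ p + 1 + j := by omega
    rw [h, hstab p j, hx]
  refine ⟨x, hc.1 (funext fun p => ?_), fun W hW => ?_⟩
  · rw [hxu (δ p + 1 + 1) p (by omega), us (δ p + 1)]
    have h := hL (δ p + 1) (x - u (δ p + 1)) (fun q hq => by
      rw [map_sub, Pi.sub_apply, hxu _ q hq, sub_self]) p (by omega)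
    rw [map_sub, map_sub, Pi.sub_apply, sub_eq_zero] at h
    rw [map_add, map_add, Pi.add_apply, Pi.add_apply, h]
  · have hu : ∀ k, wnorm W (c (u k)) ≤ 2 * wnorm W (c a) := by
      intro k
      induction k with
      | zero => simp [u0, wnorm]
      | succ k ih =>
        calc wnorm W (c (u (k + 1))) ≤ wnorm W (c a) + wnorm W (c (L (u k))) := by
              rw [us, map_add]; exact wnorm_add_le _ _ _
          _ ≤ wnorm W (c a) + 2⁻¹ * (2 * wnorm W (c a)) := by
              gcongr
              exact (hW _).trans (by gcongr)
          _ = 2 * wnorm W (c a) := by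
              rw [← mul_assoc, ENNReal.inv_mul_cancel (by simp) (by simp), one_mul, two_mul]
    refine wnorm_le_of_finset W fun s => ?_
    -- A finite sum only involves coordinates that agree with those of some iterate.
    let K := s.sup δ + 1
    calc ∑ p ∈ s, ‖c x p‖ₑ * W p = ∑ p ∈ s, ‖c (u K) p‖ₑ * W p := by
          refine Finset.sum_congr rfl fun p hp => ?_
          rw [hxu K p (Nat.lt_succ_of_le (Finset.le_sup hp))]
      _ ≤ wnorm W (c (u K)) := ENNReal.sum_le_tsum s
      _ ≤ _ := hu K

end contraction

/-! ### Weighted norms of power series -/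

/-- The coefficients of a series in `(t, z)`, indexed by the exponents of `z` and `t`. -/
def cf (d : ℕ) : SeriesTZ d →+ (ℕ × (Fin d →₀ ℕ) → ℂ) where
  toFun f p := MvPowerSeries.coeff p.2 (PowerSeries.coeff p.1 f)
  map_zero' := by ext; simp
  map_add' f g := by ext; simp

lemma cf_apply {d : ℕ} (f : SeriesTZ d) (p : ℕ × (Fin d →₀ ℕ)) :
    cf d f p = MvPowerSeries.coeff p.2 (PowerSeries.coeff p.1 f) := rfl

/-- The series in `(t, z)` with given coefficients. -/
def ofCf {d : ℕ} (F : ℕ × (Fin d →₀ ℕ) → ℂ) : SeriesTZ d :=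
  PowerSeries.mk fun n => (show SeriesT d from fun e => F (n, e))

lemma cf_ofCf {d : ℕ} (F : ℕ × (Fin d →₀ ℕ) → ℂ) : cf d (ofCf F) = F := by
  funext p
  rw [cf_apply, ofCf, PowerSeries.coeff_mk]
  rfl

lemma cf_bijective (d : ℕ) : Function.Bijective (cf d) := by
  refine ⟨fun f g h => ?_, fun F => ⟨ofCf F, cf_ofCf F⟩⟩
  ext n e
  exact congrFun h (n, e)

lemma cf_ext {d : ℕ} {f g : SeriesTZ d} (h : ∀ p, cf d f p = cf d g p) : f = g :=
  (cf_bijective d).1 (funext h)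

lemma cf_mul {d : ℕ} (f g : SeriesTZ d) (p : ℕ × (Fin d →₀ ℕ)) :
    cf d (f * g) p = ∑ a ∈ Finset.HasAntidiagonal.antidiagonal p.1,
      ∑ b ∈ Finset.HasAntidiagonal.antidiagonal p.2,
        cf d f (a.1, b.1) * cf d g (a.2, b.2) := by
  simp only [cf_apply, PowerSeries.coeff_mul, map_sum, MvPowerSeries.coeff_mul]

/-- The weight of the monomial `z ^ p.1 * t ^ p.2`: the `n`-th power of `z` has weight `w n`, and
every variable `t_i` has weight `ρ`. -/
def wt (d : ℕ) (w : ℕ → ℝ≥0) (ρ : ℝ≥0) (p : ℕ × (Fin d →₀ ℕ)) : ℝ≥0∞ :=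
  w p.1 * (ρ : ℝ≥0∞) ^ p.2.degree

/-- The weighted norm of a series in `(t, z)`. -/
def tzNorm {d : ℕ} (w : ℕ → ℝ≥0) (ρ : ℝ≥0) (f : SeriesTZ d) : ℝ≥0∞ := wnorm (wt d w ρ) (cf d f)

section tzNorm

variable {d : ℕ} {w : ℕ → ℝ≥0} {ρ : ℝ≥0}

lemma tzNorm_add_le (f g : SeriesTZ d) : tzNorm w ρ (f + g) ≤ tzNorm w ρ f + tzNorm w ρ g := by
  unfold tzNorm
  rw [map_add]
  exact wnorm_add_le _ _ _

lemma tzNorm_neg (f : SeriesTZ d) : tzNorm w ρ (-f) = tzNorm w ρ f := by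
  simp [tzNorm, wnorm]

lemma tzNorm_mono {w' : ℕ → ℝ≥0} {ρ' : ℝ≥0} (hw : w ≤ w') (hρ : ρ ≤ ρ') (f : SeriesTZ d) :
    tzNorm w ρ f ≤ tzNorm w' ρ' f := by
  refine wnorm_mono fun p => ?_
  unfold wt
  have := hw p.1
  gcongr

lemma tzNorm_sum_le {ι : Type*} (s : Finset ι) (f : ι → SeriesTZ d) :
    tzNorm w ρ (∑ i ∈ s, f i) ≤ ∑ i ∈ s, tzNorm w ρ (f i) := by
  classical
  induction s using Finset.induction_on with
  | empty => simp [tzNorm, wnorm]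
  | insert a s ha ih =>
    rw [Finset.sum_insert ha, Finset.sum_insert ha]
    exact (tzNorm_add_le _ _).trans (by gcongr)

lemma tsum_eq_tsum_antidiagonal {A : Type*} [AddMonoid A] [Finset.HasAntidiagonal A]
    (G : A × A → ℝ≥0∞) : ∑' a, G a = ∑' n, ∑ a ∈ Finset.HasAntidiagonal.antidiagonal n, G a := by
  rw [← Finset.HasAntidiagonal.sigmaAntidiagonalEquivProd.tsum_eq G, ENNReal.tsum_sigma']
  exact tsum_congr fun n =>
    Finset.tsum_subtype (Finset.HasAntidiagonal.antidiagonal n) G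

lemma tzNorm_mul_le (hw : ∀ a b, w (a + b) ≤ w a * w b) (f g : SeriesTZ d) :
    tzNorm w ρ (f * g) ≤ tzNorm w ρ f * tzNorm w ρ g := by
  let F : (ℕ × ℕ) × ((Fin d →₀ ℕ) × (Fin d →₀ ℕ)) → ℝ≥0∞ := fun q =>
    (‖cf d f (q.1.1, q.2.1)‖ₑ * wt d w ρ (q.1.1, q.2.1)) *
      (‖cf d g (q.1.2, q.2.2)‖ₑ * wt d w ρ (q.1.2, q.2.2))
  -- The terms of the product are grouped by the total exponents.
  have hprod : tzNorm w ρ f * tzNorm w ρ g = ∑' q, F q := by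
    unfold tzNorm wnorm
    rw [← ENNReal.tsum_mul_right]
    simp_rw [← ENNReal.tsum_mul_left]
    rw [← ENNReal.tsum_prod (f := fun p q : ℕ × (Fin d →₀ ℕ) =>
      (‖cf d f p‖ₑ * wt d w ρ p) * (‖cf d g q‖ₑ * wt d w ρ q))]
    exact ((Equiv.prodProdProdComm ℕ ℕ (Fin d →₀ ℕ) (Fin d →₀ ℕ)).tsum_eq
      (fun x : (ℕ × (Fin d →₀ ℕ)) × (ℕ × (Fin d →₀ ℕ)) =>
        (‖cf d f x.1‖ₑ * wt d w ρ x.1) * (‖cf d g x.2‖ₑ * wt d w ρ x.2))).symm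
  have hsum : ∑' q, F q = ∑' p : ℕ × (Fin d →₀ ℕ), ∑ a ∈ Finset.HasAntidiagonal.antidiagonal p.1,
      ∑ b ∈ Finset.HasAntidiagonal.antidiagonal p.2, F (a, b) := by
    rw [ENNReal.tsum_prod', ENNReal.tsum_prod' (β := Fin d →₀ ℕ), tsum_eq_tsum_antidiagonal]
    refine tsum_congr fun n => ?_
    simp_rw [tsum_eq_tsum_antidiagonal (fun b : (Fin d →₀ ℕ) × (Fin d →₀ ℕ) => F (_, b))]
    exact (Summable.tsum_finsetSum fun _ _ => ENNReal.summable).symm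
  rw [hprod, hsum]
  refine ENNReal.tsum_le_tsum fun p => ?_
  rw [cf_mul]
  calc _ ≤ (∑ a ∈ Finset.HasAntidiagonal.antidiagonal p.1,
      ∑ b ∈ Finset.HasAntidiagonal.antidiagonal p.2,
        ‖cf d f (a.1, b.1)‖ₑ * ‖cf d g (a.2, b.2)‖ₑ) * wt d w ρ p := by
        gcongr
        refine (enorm_sum_le _ _).trans (Finset.sum_le_sum fun a _ => ?_)
        refine (enorm_sum_le _ _).trans (Finset.sum_le_sum fun b _ => ?_)
        rw [enorm_mul]
    _ ≤ _ := by
        rw [Finset.sum_mul]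
        refine Finset.sum_le_sum fun a ha => ?_
        rw [Finset.sum_mul]
        refine Finset.sum_le_sum fun b hb => ?_
        rw [Finset.HasAntidiagonal.mem_antidiagonal] at ha hb
        have hwt : wt d w ρ p ≤ wt d w ρ (a.1, b.1) * wt d w ρ (a.2, b.2) := by
          unfold wt
          rw [← ha, ← hb, map_add, pow_add]
          calc _ ≤ ((w a.1 : ℝ≥0∞) * w a.2) *
                ((ρ : ℝ≥0∞) ^ b.1.degree * (ρ : ℝ≥0∞) ^ b.2.degree) := by
                gcongr
                exact_mod_cast hw a.1 a.2
            _ = _ := by ring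
        calc _ ≤ ‖cf d f (a.1, b.1)‖ₑ * ‖cf d g (a.2, b.2)‖ₑ *
              (wt d w ρ (a.1, b.1) * wt d w ρ (a.2, b.2)) := by gcongr
          _ = _ := by ring

lemma cf_dT (i : Fin d) (f : SeriesTZ d) (p : ℕ × (Fin d →₀ ℕ)) :
    cf d (dT i f) p = cf d f (p.1, p.2 + Finsupp.single i 1) * (p.2 i + 1) := by
  rw [cf_apply, dT, PowerSeries.coeff_mk, MvPowerSeries.coeff_pderiv, cf_apply]

/-- Differentiation costs a shrinking of the polydisc. -/
lemma mul_tzNorm_dT_le (i : Fin d) (f : SeriesTZ d) :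
    ρ * tzNorm w (ρ / 2) (dT i f) ≤ tzNorm w ρ f := by
  unfold tzNorm wnorm
  rw [← ENNReal.tsum_mul_left]
  have hinj : Function.Injective fun p : ℕ × (Fin d →₀ ℕ) =>
      (p.1, p.2 + Finsupp.single i 1) := by
    rintro ⟨a, b⟩ ⟨a', b'⟩ h
    simpa using h
  refine le_trans (ENNReal.tsum_le_tsum fun p => ?_) (ENNReal.tsum_comp_le_tsum_of_injective hinj _)
  have hdeg : p.2 i ≤ p.2.degree := Finsupp.le_degree i p.2
  -- The factor `n + 1` from the derivative is absorbed by `2 ^ n`.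
  have h2 : ((p.2 i : ℝ≥0) + 1) * (ρ / 2) ^ p.2.degree ≤ ρ ^ p.2.degree := by
    rw [div_pow, mul_div_assoc', div_le_iff₀ (by positivity), mul_comm]
    gcongr
    exact_mod_cast (Nat.succ_le_of_lt (Nat.lt_two_pow_self)).trans
      (Nat.pow_le_pow_right (by norm_num) hdeg)
  have hn : ‖((p.2 i : ℂ) + 1)‖ₑ = ((p.2 i : ℝ≥0) + 1 : ℝ≥0) := by
    rw [← Nat.cast_succ, ← Nat.cast_succ, enorm_eq_nnnorm, Complex.nnnorm_natCast]
  have h2' : (((p.2 i : ℝ≥0) + 1 : ℝ≥0) : ℝ≥0∞) * ((ρ / 2 : ℝ≥0) : ℝ≥0∞) ^ p.2.degree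
      ≤ (ρ : ℝ≥0∞) ^ p.2.degree := by exact_mod_cast h2
  rw [cf_dT, enorm_mul, hn]
  unfold wt
  simp only [map_add, Finsupp.degree_single, pow_succ]
  calc _ = ‖cf d f (p.1, p.2 + Finsupp.single i 1)‖ₑ * (w p.1 *
        (ρ * ((((p.2 i : ℝ≥0) + 1 : ℝ≥0) : ℝ≥0∞) * ((ρ / 2 : ℝ≥0) : ℝ≥0∞) ^ p.2.degree))) := by
        ring
    _ ≤ ‖cf d f (p.1, p.2 + Finsupp.single i 1)‖ₑ * (w p.1 *
        (ρ * (ρ : ℝ≥0∞) ^ p.2.degree)) := by gcongr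
    _ = _ := by ring

/-- The primitive of a series in the variable `t_i` that vanishes on `t_i = 0`. -/
def integral (i : Fin d) : SeriesTZ d →+ SeriesTZ d where
  toFun f := ofCf fun p =>
    if p.2 i = 0 then 0 else cf d f (p.1, p.2 - Finsupp.single i 1) / p.2 i
  map_zero' := by
    refine cf_ext fun p => ?_
    rw [cf_ofCf]
    simp
  map_add' f g := by
    refine cf_ext fun p => ?_
    rw [map_add (cf d) (ofCf _), Pi.add_apply, cf_ofCf, cf_ofCf, cf_ofCf]
    split_ifs
    · simp
    · rw [map_add, Pi.add_apply, add_div]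

lemma cf_integral (i : Fin d) (f : SeriesTZ d) (p : ℕ × (Fin d →₀ ℕ)) :
    cf d (integral i f) p =
      if p.2 i = 0 then 0 else cf d f (p.1, p.2 - Finsupp.single i 1) / p.2 i := by
  simp only [integral, AddMonoidHom.coe_mk, ZeroHom.coe_mk, cf_ofCf]

lemma dT_integral (i : Fin d) (f : SeriesTZ d) : dT i (integral i f) = f := by
  refine cf_ext fun p => ?_
  rw [cf_dT, cf_integral]
  have : ((p.2 i : ℂ) + 1) ≠ 0 := Nat.cast_add_one_ne_zero _
  simp [div_mul_cancel₀ _ this]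

lemma integral_dT (i : Fin d) (f : SeriesTZ d) (hf : ∀ p, p.2 i = 0 → cf d f p = 0) :
    integral i (dT i f) = f := by
  refine cf_ext fun p => ?_
  rw [cf_integral]
  split_ifs with h
  · exact (hf p h).symm
  · have hle : Finsupp.single i 1 ≤ p.2 := by
      rw [Finsupp.single_le_iff]; omega
    have h1 : (((p.2 - Finsupp.single i 1 : Fin d →₀ ℕ) i : ℕ) : ℂ) + 1 = p.2 i := by
      rw [Finsupp.tsub_apply, Finsupp.single_eq_same]
      exact_mod_cast Nat.sub_add_cancel (Nat.pos_of_ne_zero h)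
    rw [cf_dT]
    simp only
    rw [tsub_add_cancel_of_le hle, h1, mul_div_assoc, div_self (by exact_mod_cast h), mul_one]

lemma tzNorm_integral_le (i : Fin d) (f : SeriesTZ d) :
    tzNorm w ρ (integral i f) ≤ ρ * tzNorm w ρ f := by
  unfold tzNorm wnorm
  have hinj : Function.Injective fun p : ℕ × (Fin d →₀ ℕ) =>
      (p.1, p.2 + Finsupp.single i 1) := by
    rintro ⟨a, b⟩ ⟨a', b'⟩ h
    simpa using h
  rw [← hinj.tsum_eq, ← ENNReal.tsum_mul_left]
  · refine ENNReal.tsum_le_tsum fun p => ?_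
    rw [cf_integral]
    simp only [Finsupp.add_apply, Finsupp.single_eq_same, Nat.add_eq_zero_iff, one_ne_zero,
      and_false, if_false, add_tsub_cancel_right]
    have hle : ‖cf d f (p.1, p.2) / ((p.2 i + 1 : ℕ) : ℂ)‖ₑ ≤ ‖cf d f p‖ₑ := by
      rw [enorm_le_iff_norm_le, norm_div, Complex.norm_natCast]
      exact div_le_self (norm_nonneg _) (by norm_cast; omega)
    unfold wt
    simp only [map_add, Finsupp.degree_single, pow_succ]
    calc _ ≤ ‖cf d f p‖ₑ * (w p.1 * ((ρ : ℝ≥0∞) ^ p.2.degree * ρ)) := by gcongr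
      _ = _ := by ring
  · intro p hp
    rw [Function.mem_support, cf_integral] at hp
    have h : p.2 i ≠ 0 := fun h => by simp [h] at hp
    have hle : Finsupp.single i 1 ≤ p.2 := by
      rw [Finsupp.single_le_iff]; omega
    exact ⟨(p.1, p.2 - Finsupp.single i 1), by simp [tsub_add_cancel_of_le hle]⟩

/-- Shrinking the polydisc makes a series without constant term small. -/
lemma tzNorm_shrink_le {ε : ℝ≥0} (hε : ε ≤ 1) (f : SeriesTZ d) (hf : cf d f 0 = 0) :
    tzNorm (fun n => ε ^ n * w n) (ε * ρ) f ≤ ε * tzNorm w ρ f := by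
  unfold tzNorm wnorm
  rw [← ENNReal.tsum_mul_left]
  refine ENNReal.tsum_le_tsum fun p => ?_
  by_cases hp : p = 0
  · simp [hp, hf]
  · have hpos : 1 ≤ p.1 + p.2.degree := by
      rw [Nat.one_le_iff_ne_zero]
      intro h
      apply hp
      have h1 : p.1 = 0 := by omega
      have h2 : p.2 = 0 := (Finsupp.degree_eq_zero_iff _).1 (by omega)
      exact Prod.ext h1 h2
    have hε' : (ε : ℝ≥0∞) ^ (p.1 + p.2.degree) ≤ ε := by
      have : ε ^ (p.1 + p.2.degree) ≤ ε := pow_le_of_le_one (zero_le) hε (by omega)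
      exact_mod_cast this
    unfold wt
    push_cast
    calc _ = ‖cf d f p‖ₑ * ((ε : ℝ≥0∞) ^ (p.1 + p.2.degree) *
          (w p.1 * (ρ : ℝ≥0∞) ^ p.2.degree)) := by rw [pow_add, mul_pow]; ring
      _ ≤ ‖cf d f p‖ₑ * (ε * (w p.1 * (ρ : ℝ≥0∞) ^ p.2.degree)) := by gcongr
      _ = _ := by ring

end tzNorm

/-! ### Rings of series with finite weighted norm -/

/-- A family of weights for the powers of `z` for which the series with finite weighted norm form
a ring that is closed under the operations of analysis. -/
structure IsWeightClass (𝒲 : Set (ℕ → ℝ≥0)) : Prop where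
  submul : ∀ w ∈ 𝒲, ∀ a b, w (a + b) ≤ w a * w b
  le_one : ∀ w ∈ 𝒲, ∀ a, w a ≤ 1
  mul_mem : ∀ w ∈ 𝒲, ∀ w' ∈ 𝒲, (fun n => w n * w' n) ∈ 𝒲
  geom_mem : ∀ ε : ℝ≥0, 0 < ε → ε ≤ 1 → (fun n => ε ^ n) ∈ 𝒲

/-- The series that have finite norm for some weight in `𝒲` and some radius. -/
def finiteNorm (𝒲 : Set (ℕ → ℝ≥0)) (d : ℕ) : Set (SeriesTZ d) :=
  {f | ∃ w ∈ 𝒲, ∃ ρ : ℝ≥0, 0 < ρ ∧ tzNorm w ρ f ≠ ⊤}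

lemma exists_small_mul_le {M : ℝ≥0∞} (hM : M ≠ ⊤) :
    ∃ ε : ℝ≥0, 0 < ε ∧ ε ≤ 1 ∧ (ε : ℝ≥0∞) * M ≤ 2⁻¹ := by
  lift M to ℝ≥0 using hM
  refine ⟨1 / (2 * (M + 1)), by positivity, ?_, ?_⟩
  · rw [div_le_one (by positivity)]
    have : (1 : ℝ≥0) ≤ M + 1 := le_add_of_nonneg_left (zero_le)
    calc (1 : ℝ≥0) ≤ M + 1 := this
      _ ≤ 2 * (M + 1) := le_mul_of_one_le_left (zero_le) (by norm_num)
  · have h : 1 / (2 * (M + 1)) * M ≤ 2⁻¹ := by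
      rw [div_mul_eq_mul_div, div_le_iff₀ (by positivity), one_mul, ← mul_assoc,
        inv_mul_cancel₀ (by norm_num), one_mul]
      exact le_add_of_nonneg_right (zero_le)
    have h' : ((1 / (2 * (M + 1)) * M : ℝ≥0) : ℝ≥0∞) ≤ ((2⁻¹ : ℝ≥0) : ℝ≥0∞) := by exact_mod_cast h
    rwa [ENNReal.coe_mul, ENNReal.coe_inv (by norm_num)] at h'

lemma tzNorm_ne_top_of_support {d : ℕ} {w : ℕ → ℝ≥0} {ρ : ℝ≥0} {f : SeriesTZ d}
    (s : Finset (ℕ × (Fin d →₀ ℕ))) (hs : ∀ p ∉ s, cf d f p = 0) : tzNorm w ρ f ≠ ⊤ := by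
  unfold tzNorm wnorm
  rw [tsum_eq_sum (s := s) fun p hp => by rw [hs p hp]; simp]
  refine (ENNReal.sum_lt_top.2 fun p _ => ?_).ne
  unfold wt
  exact ENNReal.mul_lt_top (by simp)
    (ENNReal.mul_lt_top (by simp) (ENNReal.pow_lt_top (by simp)))

section finiteNorm

variable {𝒲 : Set (ℕ → ℝ≥0)} {d : ℕ}

/-- Finitely many series have finite norm for one weight and one radius. -/
lemma IsWeightClass.exists_common (h𝒲 : IsWeightClass 𝒲) {ι : Type*} (s : Finset ι)
    (f : ι → SeriesTZ d) (hf : ∀ i ∈ s, f i ∈ finiteNorm 𝒲 d) :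
    ∃ w ∈ 𝒲, ∃ ρ : ℝ≥0, 0 < ρ ∧ ∀ i ∈ s, tzNorm w ρ (f i) ≠ ⊤ := by
  classical
  induction s using Finset.induction_on with
  | empty => exact ⟨_, h𝒲.geom_mem 1 one_pos le_rfl, 1, one_pos, by simp⟩
  | insert a s ha ih =>
    obtain ⟨w, hw, ρ, hρ, h⟩ := ih fun i hi => hf i (Finset.mem_insert_of_mem hi)
    obtain ⟨w', hw', ρ', hρ', h'⟩ := hf a (Finset.mem_insert_self _ _)
    refine ⟨_, h𝒲.mul_mem w hw w' hw', min ρ ρ', lt_min hρ hρ', fun i hi => ?_⟩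
    rw [Finset.mem_insert] at hi
    rcases hi with rfl | hi
    · exact ne_top_of_le_ne_top h' (tzNorm_mono
        (fun n => mul_le_of_le_one_left (zero_le) (h𝒲.le_one w hw n)) (min_le_right _ _) _)
    · exact ne_top_of_le_ne_top (h i hi) (tzNorm_mono
        (fun n => mul_le_of_le_one_right (zero_le) (h𝒲.le_one w' hw' n)) (min_le_left _ _) _)

lemma IsWeightClass.exists_common₂ (h𝒲 : IsWeightClass 𝒲) {f g : SeriesTZ d}
    (hf : f ∈ finiteNorm 𝒲 d) (hg : g ∈ finiteNorm 𝒲 d) :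
    ∃ w ∈ 𝒲, ∃ ρ : ℝ≥0, 0 < ρ ∧ tzNorm w ρ f ≠ ⊤ ∧ tzNorm w ρ g ≠ ⊤ := by
  obtain ⟨w, hw, ρ, hρ, h⟩ := h𝒲.exists_common (Finset.univ : Finset (Fin 2)) ![f, g]
    (fun i _ => by fin_cases i <;> assumption)
  exact ⟨w, hw, ρ, hρ, h 0 (Finset.mem_univ _), h 1 (Finset.mem_univ _)⟩

lemma IsWeightClass.mem_of_support (h𝒲 : IsWeightClass 𝒲) {f : SeriesTZ d}
    (s : Finset (ℕ × (Fin d →₀ ℕ))) (hs : ∀ p ∉ s, cf d f p = 0) : f ∈ finiteNorm 𝒲 d :=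
  ⟨_, h𝒲.geom_mem 1 one_pos le_rfl, 1, one_pos, tzNorm_ne_top_of_support s hs⟩

/-- Constants as series in `(t, z)`. -/
def const (d : ℕ) : ℂ →+* SeriesTZ d := (PowerSeries.C).comp MvPowerSeries.C

lemma cf_const (a : ℂ) (p : ℕ × (Fin d →₀ ℕ)) : cf d (const d a) p = if p = 0 then a else 0 := by
  classical
  rw [cf_apply, const, RingHom.comp_apply, PowerSeries.coeff_C]
  rcases p with ⟨n, e⟩
  by_cases hn : n = 0
  · simp [hn, MvPowerSeries.coeff_C, Prod.ext_iff]
  · simp [hn, Prod.ext_iff]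

lemma cf_one (p : ℕ × (Fin d →₀ ℕ)) : cf d 1 p = if p = 0 then 1 else 0 := by
  rw [← map_one (const d), cf_const]

lemma IsWeightClass.const_mem (h𝒲 : IsWeightClass 𝒲) (a : ℂ) : const d a ∈ finiteNorm 𝒲 d :=
  h𝒲.mem_of_support {0} fun p hp => by
    rw [cf_const, if_neg (by simpa using hp)]

/-- The series with finite norm form a ring. -/
def IsWeightClass.ring (h𝒲 : IsWeightClass 𝒲) (d : ℕ) : Subring (SeriesTZ d) where
  carrier := finiteNorm 𝒲 d
  mul_mem' {f g} hf hg := by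
    obtain ⟨w, hw, ρ, hρ, h, h'⟩ := h𝒲.exists_common₂ hf hg
    exact ⟨w, hw, ρ, hρ, ne_top_of_le_ne_top (ENNReal.mul_ne_top h h')
      (tzNorm_mul_le (h𝒲.submul w hw) f g)⟩
  one_mem' := by simpa using h𝒲.const_mem (d := d) 1
  add_mem' {f g} hf hg := by
    obtain ⟨w, hw, ρ, hρ, h, h'⟩ := h𝒲.exists_common₂ hf hg
    exact ⟨w, hw, ρ, hρ, ne_top_of_le_ne_top (ENNReal.add_ne_top.2 ⟨h, h'⟩) (tzNorm_add_le f g)⟩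
  zero_mem' := by simpa using h𝒲.const_mem (d := d) 0
  neg_mem' {f} hf := by
    obtain ⟨w, hw, ρ, hρ, h⟩ := hf
    exact ⟨w, hw, ρ, hρ, by rwa [tzNorm_neg]⟩

lemma dT_mem_finiteNorm (i : Fin d) {f : SeriesTZ d} (hf : f ∈ finiteNorm 𝒲 d) :
    dT i f ∈ finiteNorm 𝒲 d := by
  obtain ⟨w, hw, ρ, hρ, h⟩ := hf
  refine ⟨w, hw, ρ / 2, by positivity, fun htop => ?_⟩
  have := mul_tzNorm_dT_le (w := w) (ρ := ρ) i f
  rw [htop, ENNReal.mul_top (by simpa using hρ.ne')] at this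
  exact h (top_le_iff.1 this)

/-- Series with nonzero constant term are inverted by a geometric series. -/
theorem IsWeightClass.exists_inv (h𝒲 : IsWeightClass 𝒲) {f : SeriesTZ d}
    (hf : f ∈ h𝒲.ring d) (h0 : cf d f 0 ≠ 0) : ∃ g ∈ h𝒲.ring d, f * g = 1 := by
  set c := cf d f 0 with hc
  have hcmem : const d c⁻¹ ∈ h𝒲.ring d := h𝒲.const_mem _
  let h : SeriesTZ d := 1 - const d c⁻¹ * f
  have hh : h ∈ h𝒲.ring d := sub_mem (one_mem _) (Subring.mul_mem _ hcmem hf)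
  have hh0 : cf d h 0 = 0 := by
    have : cf d (const d c⁻¹ * f) 0 = c⁻¹ * c := by
      rw [cf_mul]
      simp only [Prod.fst_zero, Prod.snd_zero, Finset.HasAntidiagonal.antidiagonal_zero,
        Finset.sum_singleton]
      rw [show ((0, 0) : ℕ × (Fin d →₀ ℕ)) = 0 from rfl, cf_const, if_pos rfl, hc]
    rw [map_sub, Pi.sub_apply, this, inv_mul_cancel₀ h0, cf_one, if_pos rfl, sub_self]
  -- On a smaller polydisc `h` has norm `≤ 1 / 2`, and `x = 1 + h x` is solved for `x`.
  obtain ⟨w, hw, ρ, hρ, hfin⟩ := hh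
  obtain ⟨ε, hε, hε1, hεM⟩ := exists_small_mul_le hfin
  have hw' := h𝒲.mul_mem _ (h𝒲.geom_mem ε hε hε1) w hw
  have hL : RaisesGrading (cf d) (fun p => p.1 + p.2.degree) (AddMonoidHom.mulLeft h) := by
    intro k x hx p hp
    replace hp : p.1 + p.2.degree < k + 1 := hp
    rw [AddMonoidHom.coe_mulLeft, cf_mul]
    refine Finset.sum_eq_zero fun a ha => Finset.sum_eq_zero fun b hb => ?_
    rw [Finset.HasAntidiagonal.mem_antidiagonal] at ha hb
    by_cases hab : (a.1, b.1) = (0 : ℕ × (Fin d →₀ ℕ))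
    · rw [hab, hh0, zero_mul]
    · have hdeg : b.1.degree + b.2.degree = p.2.degree := by rw [← map_add, hb]
      have : 0 < a.1 + b.1.degree := by
        rw [Nat.pos_iff_ne_zero]
        intro h
        exact hab (Prod.ext (by simp only [Prod.fst_zero]; omega)
          ((Finsupp.degree_eq_zero_iff _).1 (by simp only; omega)))
      rw [hx (a.2, b.2) (by simp only; omega), mul_zero]
  obtain ⟨x, hx, hbound⟩ := hL.exists_fixedPoint (cf_bijective d) 1
  have hxmem : x ∈ h𝒲.ring d := by
    refine ⟨_, hw', ε * ρ, by positivity, ?_⟩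
    refine ne_top_of_le_ne_top ?_ (hbound _ fun y => ?_)
    · refine ENNReal.mul_ne_top (by simp) (tzNorm_ne_top_of_support {0} fun p hp => ?_)
      rw [cf_one, if_neg (by simpa using hp)]
    · refine (tzNorm_mul_le (h𝒲.submul _ hw') h y).trans ?_
      exact mul_le_mul_left ((tzNorm_shrink_le hε1 h hh0).trans hεM) _
  refine ⟨const d c⁻¹ * x, Subring.mul_mem _ hcmem hxmem, ?_⟩
  have hx' : x = 1 + h * x := hx
  linear_combination hx'

/-- The coefficients of a matrix of series. -/
def cfMat (d n : ℕ) :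
    Matrix (Fin n) (Fin n) (SeriesTZ d) →+ ((Fin n × Fin n) × (ℕ × (Fin d →₀ ℕ)) → ℂ) where
  toFun T q := cf d (T q.1.1 q.1.2) q.2
  map_zero' := by ext; simp
  map_add' f g := by ext; simp

lemma cfMat_apply {n : ℕ} (T : Matrix (Fin n) (Fin n) (SeriesTZ d)) (a b : Fin n)
    (p : ℕ × (Fin d →₀ ℕ)) : cfMat d n T ((a, b), p) = cf d (T a b) p := rfl

lemma cfMat_bijective (d n : ℕ) : Function.Bijective (cfMat d n) := by
  refine ⟨fun T T' h => ?_, fun F => ⟨Matrix.of fun a b => ofCf fun p => F ((a, b), p), ?_⟩⟩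
  · ext1 a b
    exact cf_ext fun p => congrFun h ((a, b), p)
  · funext q
    obtain ⟨⟨a, b⟩, p⟩ := q
    rw [cfMat_apply, Matrix.of_apply, cf_ofCf]

lemma wnorm_cfMat {n : ℕ} (w : ℕ → ℝ≥0) (ρ : ℝ≥0) (T : Matrix (Fin n) (Fin n) (SeriesTZ d)) :
    wnorm (fun q => wt d w ρ q.2) (cfMat d n T) = ∑ a, ∑ b, tzNorm w ρ (T a b) := by
  unfold wnorm
  rw [ENNReal.tsum_prod', tsum_fintype, Fintype.sum_prod_type]
  rfl

/-- The Picard operator of the linear differential equation `∂_i T = -B T`. -/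
def picard {n : ℕ} (i : Fin d) (B : Matrix (Fin n) (Fin n) (SeriesTZ d)) :
    Matrix (Fin n) (Fin n) (SeriesTZ d) →+ Matrix (Fin n) (Fin n) (SeriesTZ d) where
  toFun T := -(B * T).map (integral i)
  map_zero' := by ext1 a b; simp
  map_add' T T' := by
    ext1 a b
    simp only [Matrix.mul_add, Matrix.neg_apply, Matrix.map_apply, Matrix.add_apply, map_add]
    abel

lemma picard_raises {n : ℕ} (i : Fin d) (B : Matrix (Fin n) (Fin n) (SeriesTZ d)) :
    RaisesGrading (cfMat d n) (fun q => q.2.2 i) (picard i B) := by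
  rintro k T hT ⟨⟨a, b⟩, p⟩ hp
  rw [cfMat_apply]
  simp only [picard, AddMonoidHom.coe_mk, ZeroHom.coe_mk, Matrix.neg_apply, Matrix.map_apply,
    map_neg, Pi.neg_apply, neg_eq_zero, cf_integral]
  split_ifs with h0
  · rfl
  · rw [Matrix.mul_apply, map_sum, Finset.sum_apply, Finset.sum_eq_zero, zero_div]
    intro l _
    rw [cf_mul]
    refine Finset.sum_eq_zero fun u hu => Finset.sum_eq_zero fun v hv => ?_
    rw [Finset.HasAntidiagonal.mem_antidiagonal] at hv
    have hvi := DFunLike.congr_fun hv i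
    simp only [Finsupp.add_apply, Finsupp.tsub_apply, Finsupp.single_eq_same] at hvi hp
    have := hT ((l, b), (u.2, v.2)) (by simp only; omega)
    rw [cfMat_apply] at this
    rw [this, mul_zero]

/-- The equation `∂_i T = -B T` with `T = 1` on `t_i = 0` is solved by Picard iteration; the entries
of `T` have finite norm for the weight of `B` and a smaller radius. -/
theorem IsWeightClass.exists_ode (h𝒲 : IsWeightClass 𝒲) {n : ℕ} (i : Fin d)
    (B : Matrix (Fin n) (Fin n) (SeriesTZ d)) (hB : ∀ a b, B a b ∈ h𝒲.ring d) :
    ∃ T : Matrix (Fin n) (Fin n) (SeriesTZ d), (∀ a b, T a b ∈ h𝒲.ring d) ∧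
      T.map (dT i) = -(B * T) ∧
      ∀ a b p, p.2 i = 0 → cf d (T a b) p = cf d ((1 : Matrix _ _ (SeriesTZ d)) a b) p := by
  obtain ⟨w, hw, ρ₀, hρ₀, hfin⟩ := h𝒲.exists_common (Finset.univ : Finset (Fin n × Fin n))
    (fun q => B q.1 q.2) (fun q _ => hB _ _)
  have hM : ∑ a, ∑ l, tzNorm w ρ₀ (B a l) ≠ ⊤ :=
    (ENNReal.sum_lt_top.2 fun a _ => ENNReal.sum_lt_top.2 fun l _ =>
      (hfin (a, l) (Finset.mem_univ _)).lt_top).ne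
  obtain ⟨ε, hε, -, hεM⟩ := exists_small_mul_le hM
  let ρ := min ρ₀ ε
  have hρ : 0 < ρ := lt_min hρ₀ hε
  obtain ⟨T, hT, hbound⟩ := (picard_raises i B).exists_fixedPoint (cfMat_bijective d n) 1
  have hTab : ∀ a b, T a b = (1 : Matrix _ _ (SeriesTZ d)) a b - integral i ((B * T) a b) := by
    intro a b
    have := congrFun (congrFun hT a) b
    rw [this]
    simp [picard, sub_eq_add_neg]
  have h1 : ∑ a, ∑ b, tzNorm w ρ ((1 : Matrix (Fin n) (Fin n) (SeriesTZ d)) a b) ≠ ⊤ := by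
    refine (ENNReal.sum_lt_top.2 fun a _ => ENNReal.sum_lt_top.2 fun b _ => Ne.lt_top ?_).ne
    refine tzNorm_ne_top_of_support {0} fun p hp => ?_
    rw [Matrix.one_apply]
    split_ifs
    · rw [cf_one, if_neg (by simpa using hp)]
    · simp
  have hTfin : ∑ a, ∑ b, tzNorm w ρ (T a b) ≠ ⊤ := by
    rw [← wnorm_cfMat]
    refine ne_top_of_le_ne_top (ENNReal.mul_ne_top (by simp) ?_) (hbound _ fun Y => ?_)
    · rwa [wnorm_cfMat]
    · rw [wnorm_cfMat, wnorm_cfMat]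
      have hY : ∀ l, ∑ b, tzNorm w ρ (Y l b) ≤ ∑ l, ∑ b, tzNorm w ρ (Y l b) := fun l =>
        Finset.single_le_sum (f := fun l => ∑ b, tzNorm w ρ (Y l b)) (fun _ _ => zero_le)
          (Finset.mem_univ l)
      calc ∑ a, ∑ b, tzNorm w ρ (picard i B Y a b)
          ≤ ∑ a, ∑ b, ρ * ∑ l, tzNorm w ρ (B a l) * tzNorm w ρ (Y l b) := by
            gcongr with a _ b _
            simp only [picard, AddMonoidHom.coe_mk, ZeroHom.coe_mk, Matrix.neg_apply,
              Matrix.map_apply, tzNorm_neg]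
            refine (tzNorm_integral_le i _).trans ?_
            gcongr
            rw [Matrix.mul_apply]
            refine (tzNorm_sum_le _ _).trans (Finset.sum_le_sum fun l _ => ?_)
            exact tzNorm_mul_le (h𝒲.submul w hw) _ _
        _ = ρ * ∑ a, ∑ l, tzNorm w ρ (B a l) * ∑ b, tzNorm w ρ (Y l b) := by
            simp_rw [Finset.mul_sum]
            refine Finset.sum_congr rfl fun a _ => Finset.sum_comm
        _ ≤ ρ * ∑ a, ∑ l, tzNorm w ρ (B a l) * (∑ l, ∑ b, tzNorm w ρ (Y l b)) :=
            mul_le_mul_right (Finset.sum_le_sum fun a _ => Finset.sum_le_sum fun l _ =>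
              mul_le_mul_right (hY l) _) _
        _ = ρ * (∑ a, ∑ l, tzNorm w ρ (B a l)) * ∑ l, ∑ b, tzNorm w ρ (Y l b) := by
            simp_rw [← Finset.sum_mul]
            ring
        _ ≤ ε * (∑ a, ∑ l, tzNorm w ρ₀ (B a l)) * ∑ l, ∑ b, tzNorm w ρ (Y l b) := by
            gcongr
            · exact min_le_right _ _
            · exact tzNorm_mono le_rfl (min_le_left _ _) _
        _ ≤ _ := by gcongr
  refine ⟨T, fun a b => ⟨w, hw, ρ, hρ, ?_⟩, ?_, fun a b p hp => ?_⟩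
  · refine ne_top_of_le_ne_top hTfin ?_
    exact (Finset.single_le_sum (f := fun b => tzNorm w ρ (T a b)) (fun _ _ => zero_le)
      (Finset.mem_univ b)).trans (Finset.single_le_sum (f := fun a => ∑ b, tzNorm w ρ (T a b))
        (fun _ _ => zero_le) (Finset.mem_univ a))
  · ext1 a b
    rw [Matrix.map_apply, hTab]
    have hsub : ∀ x y : SeriesTZ d, dT i (x - y) = dT i x - dT i y := by
      intro x y
      refine cf_ext fun p => ?_
      simp only [map_sub, Pi.sub_apply, cf_dT]
      ring
    have hone : dT i ((1 : Matrix (Fin n) (Fin n) (SeriesTZ d)) a b) = 0 := by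
      refine cf_ext fun p => ?_
      rw [Matrix.one_apply]
      split_ifs
      · rw [cf_dT, cf_one, if_neg, zero_mul]
        · simp
        · intro h
          have := DFunLike.congr_fun (congrArg Prod.snd h) i
          simp at this
      · simp [cf_dT]
    rw [hsub, hone, dT_integral, zero_sub, Matrix.neg_apply]
  · rw [hTab, map_sub, Pi.sub_apply, cf_integral, if_pos hp, sub_zero]

end finiteNorm

/-! ### The rings `ℂ{t, z}` and `ℂ{t, z]]` -/

/-- What is needed of a ring of series for the normal form `(*)`: it contains the polynomials, and
it is closed under derivatives, inverses, division by `z` and linear differential equations. -/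
structure IsAdmissible {d : ℕ} (R : Subring (SeriesTZ d)) : Prop where
  const_mem : ∀ a, const d a ∈ R
  var_mem : ∀ i : Fin d, PowerSeries.C (MvPowerSeries.X i) ∈ R
  zVar_mem : zVar d ∈ R
  dT_mem : ∀ i, ∀ f ∈ R, dT i f ∈ R
  exists_inv : ∀ f ∈ R, cf d f 0 ≠ 0 → ∃ g ∈ R, f * g = 1
  of_zVar_mul_mem : ∀ f, zVar d * f ∈ R → f ∈ R
  exists_ode : ∀ {n : ℕ} (i : Fin d) (B : Matrix (Fin n) (Fin n) (SeriesTZ d)),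
    (∀ a b, B a b ∈ R) → ∃ T : Matrix (Fin n) (Fin n) (SeriesTZ d), (∀ a b, T a b ∈ R) ∧
      T.map (dT i) = -(B * T) ∧
      ∀ a b p, p.2 i = 0 → cf d (T a b) p = cf d ((1 : Matrix _ _ (SeriesTZ d)) a b) p

lemma cf_C {d : ℕ} (a : SeriesT d) (p : ℕ × (Fin d →₀ ℕ)) :
    cf d (PowerSeries.C a) p = if p.1 = 0 then MvPowerSeries.coeff p.2 a else 0 := by
  rw [cf_apply, PowerSeries.coeff_C]
  split_ifs <;> simp

lemma cf_zVar_mul_succ {d : ℕ} (f : SeriesTZ d) (n : ℕ) (e : Fin d →₀ ℕ) :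
    cf d (zVar d * f) (n + 1, e) = cf d f (n, e) := by
  rw [cf_apply, zVar, PowerSeries.coeff_succ_X_mul, cf_apply]

lemma IsWeightClass.isAdmissible {𝒲 : Set (ℕ → ℝ≥0)} (h𝒲 : IsWeightClass 𝒲) (d : ℕ)
    (hz : ∀ f, zVar d * f ∈ finiteNorm 𝒲 d → f ∈ finiteNorm 𝒲 d) :
    IsAdmissible (h𝒲.ring d) where
  const_mem := h𝒲.const_mem
  var_mem i := h𝒲.mem_of_support {(0, Finsupp.single i 1)} fun p hp => by
    classical
    rw [cf_C, MvPowerSeries.coeff_X]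
    split_ifs with h1 h2
    · exact absurd (Finset.mem_singleton.2 (Prod.ext h1 h2)) hp
    · rfl
    · rfl
  zVar_mem := h𝒲.mem_of_support {(1, 0)} fun p hp => by
    classical
    rw [cf_apply, zVar, PowerSeries.coeff_X]
    split_ifs with h1
    · rw [MvPowerSeries.coeff_one, if_neg]
      exact fun h2 => hp (Finset.mem_singleton.2 (Prod.ext h1 h2))
    · simp
  dT_mem i _ hf := dT_mem_finiteNorm i hf
  exists_inv _ := h𝒲.exists_inv
  of_zVar_mul_mem := hz
  exists_ode := h𝒲.exists_ode

lemma wnorm_ne_top_iff {P : Type*} (W : P → ℝ≥0) (F : P → ℂ) :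
    wnorm (fun p => (W p : ℝ≥0∞)) F ≠ ⊤ ↔ Summable fun p => ‖F p‖ * (W p : ℝ) := by
  have h1 : wnorm (fun p => (W p : ℝ≥0∞)) F = ∑' p, ((‖F p‖₊ * W p : ℝ≥0) : ℝ≥0∞) := by
    simp [wnorm, enorm_eq_nnnorm]
  rw [h1, ENNReal.tsum_coe_ne_top_iff_summable, ← NNReal.summable_coe]
  simp

lemma convergesOn_iff {d : ℕ} (ρ : ℝ≥0) (a : SeriesT d) :
    ConvergesOn ρ a ↔
      wnorm (fun e => (ρ : ℝ≥0∞) ^ e.degree) (fun e => MvPowerSeries.coeff e a) ≠ ⊤ := by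
  have := wnorm_ne_top_iff (fun e : Fin d →₀ ℕ => ρ ^ e.degree)
    (fun e => MvPowerSeries.coeff e a)
  push_cast at this
  rw [this]
  rfl

lemma tzNorm_eq_tsum {d : ℕ} (w : ℕ → ℝ≥0) (ρ : ℝ≥0) (f : SeriesTZ d) :
    tzNorm w ρ f = ∑' n, w n * wnorm (fun e => (ρ : ℝ≥0∞) ^ e.degree)
      (fun e => MvPowerSeries.coeff e (PowerSeries.coeff n f)) := by
  unfold tzNorm wnorm
  rw [ENNReal.tsum_prod']
  refine tsum_congr fun n => ?_
  rw [← ENNReal.tsum_mul_left]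
  refine tsum_congr fun e => ?_
  rw [cf_apply]
  simp only [wt]
  ring

/-- The weights `σ ^ n` with `0 < σ ≤ 1`. -/
def convWeights : Set (ℕ → ℝ≥0) := {w | ∃ σ : ℝ≥0, 0 < σ ∧ σ ≤ 1 ∧ w = fun n => σ ^ n}

lemma isWeightClass_convWeights : IsWeightClass convWeights where
  submul := by
    rintro _ ⟨σ, -, -, rfl⟩ a b
    exact (pow_add σ a b).le
  le_one := by
    rintro _ ⟨σ, -, h, rfl⟩ a
    exact pow_le_one₀ (zero_le) h
  mul_mem := by
    rintro _ ⟨σ, h, h1, rfl⟩ _ ⟨τ, h', h1', rfl⟩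
    exact ⟨σ * τ, by positivity, mul_le_one₀ h1 (zero_le) h1', by simp only [mul_pow]⟩
  geom_mem ε h h1 := ⟨ε, h, h1, rfl⟩

/-- The radii of the `t_i` and of `z` may be chosen independently, and the latter `≤ 1`. -/
lemma convTZ_eq (d : ℕ) : convTZ d = finiteNorm convWeights d := by
  have key : ∀ (ρ : ℝ≥0) (f : SeriesTZ d), tzNorm (fun n => ρ ^ n) ρ f ≠ ⊤ ↔
      Summable fun p : ℕ × (Fin d →₀ ℕ) =>
        ‖MvPowerSeries.coeff p.2 (PowerSeries.coeff p.1 f)‖ * (ρ : ℝ) ^ (p.1 + p.2.degree) := by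
    intro ρ f
    have := wnorm_ne_top_iff (fun p : ℕ × (Fin d →₀ ℕ) => ρ ^ (p.1 + p.2.degree)) (cf d f)
    push_cast at this
    simp only [cf_apply] at this
    rw [← this]
    unfold tzNorm
    have hW : wt d (fun n => ρ ^ n) ρ =
        fun p : ℕ × (Fin d →₀ ℕ) => (ρ : ℝ≥0∞) ^ (p.1 + p.2.degree) := by
      funext p
      simp [wt, pow_add]
    rw [hW]
  ext f
  constructor
  · rintro ⟨ρ, hρ, hs⟩
    lift ρ to ℝ≥0 using hρ.le
    rw [← key] at hs
    have hρ' : 0 < ρ := by exact_mod_cast hρ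
    refine ⟨_, ⟨min ρ 1, lt_min hρ' one_pos, min_le_right _ _, rfl⟩, ρ, hρ', ?_⟩
    exact ne_top_of_le_ne_top hs (tzNorm_mono
      (fun n => pow_le_pow_left₀ (zero_le) (min_le_left ρ 1) n) le_rfl f)
  · rintro ⟨_, ⟨σ, hσ, -, rfl⟩, ρ, hρ, hs⟩
    refine ⟨(min σ ρ : ℝ≥0), by exact_mod_cast lt_min hσ hρ, (key _ _).1 ?_⟩
    exact ne_top_of_le_ne_top hs (tzNorm_mono
      (fun n => pow_le_pow_left₀ (zero_le) (min_le_left σ ρ) n) (min_le_right _ _) f)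

/-- The positive submultiplicative weights that are bounded by `1`. -/
def formalWeights : Set (ℕ → ℝ≥0) :=
  {w | (∀ n, 0 < w n) ∧ (∀ a b, w (a + b) ≤ w a * w b) ∧ ∀ n, w n ≤ 1}

lemma isWeightClass_formalWeights : IsWeightClass formalWeights where
  submul w hw := hw.2.1
  le_one w hw := hw.2.2
  mul_mem w hw w' hw' := by
    refine ⟨fun n => mul_pos (hw.1 n) (hw'.1 n), fun a b => ?_, fun n =>
      mul_le_one₀ (hw.2.2 n) (zero_le) (hw'.2.2 n)⟩
    calc w (a + b) * w' (a + b) ≤ (w a * w b) * (w' a * w' b) :=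
          mul_le_mul' (hw.2.1 a b) (hw'.2.1 a b)
      _ = _ := by ring
  geom_mem ε h h1 := ⟨fun n => by positivity, fun a b => (pow_add ε a b).le,
    fun n => pow_le_one₀ (zero_le) h1⟩

/-- Every sequence becomes summable after multiplication with a submultiplicative weight. -/
lemma exists_formalWeight (M : ℕ → ℝ≥0) :
    ∃ w ∈ formalWeights, ∑' n, ((w n * M n : ℝ≥0) : ℝ≥0∞) ≠ ⊤ := by
  -- The weight is `(c n)⁻¹ ^ n` for an increasing sequence `c` with `c n ≥ 2 (M n + 1)`.
  let c : ℕ → ℝ≥0 := fun n => ∑ i ∈ Finset.range (n + 1), 2 * (M i + 1)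
  have hmono : ∀ a b, a ≤ b → c a ≤ c b := fun a b hab =>
    Finset.sum_le_sum_of_subset (Finset.range_mono (by omega))
  have hself : ∀ n, 2 * (M n + 1) ≤ c n := fun n =>
    Finset.single_le_sum (f := fun i => 2 * (M i + 1)) (fun _ _ => zero_le)
      (Finset.mem_range.2 (Nat.lt_succ_self n))
  have h2 : ∀ n, 2 ≤ c n := fun n =>
    (le_mul_of_one_le_right (zero_le) (le_add_of_nonneg_left (zero_le))).trans (hself n)
  have hpos : ∀ n, 0 < c n := fun n => lt_of_lt_of_le (by norm_num) (h2 n)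
  refine ⟨fun n => (c n)⁻¹ ^ n, ⟨fun n => pow_pos (inv_pos.2 (hpos n)) n, fun a b => ?_,
    fun n => pow_le_one₀ (zero_le) (inv_le_one_of_one_le₀ ((by norm_num : (1:ℝ≥0) ≤ 2).trans
      (h2 n)))⟩, ?_⟩
  · simp only [pow_add]
    exact mul_le_mul'
      (pow_le_pow_left₀ (zero_le) (inv_anti₀ (hpos _) (hmono a _ (by omega))) _)
      (pow_le_pow_left₀ (zero_le) (inv_anti₀ (hpos _) (hmono b _ (by omega))) _)
  · rw [ENNReal.tsum_coe_ne_top_iff_summable]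
    have hgeo : Summable fun n : ℕ => (M 0 + 1) * (2⁻¹ : ℝ≥0) ^ n :=
      (NNReal.summable_geometric (by
        rw [← NNReal.coe_lt_coe]; norm_num)).mul_left _
    refine NNReal.summable_of_le (fun n => ?_) hgeo
    cases n with
    | zero => simp
    | succ n =>
      have hM : (c (n + 1))⁻¹ * M (n + 1) ≤ 2⁻¹ := by
        rw [inv_mul_le_iff₀ (hpos _), mul_comm, ← div_eq_inv_mul, le_div_iff₀ (by norm_num)]
        calc M (n + 1) * 2 ≤ 2 * (M (n + 1) + 1) := by
              rw [mul_comm]; gcongr; exact le_add_of_nonneg_right (zero_le)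
          _ ≤ _ := hself _
      have hc : (c (n + 1))⁻¹ ≤ 2⁻¹ := inv_anti₀ (by norm_num) (h2 _)
      calc (c (n + 1))⁻¹ ^ (n + 1) * M (n + 1)
          = (c (n + 1))⁻¹ ^ n * ((c (n + 1))⁻¹ * M (n + 1)) := by ring
        _ ≤ 2⁻¹ ^ n * 2⁻¹ := mul_le_mul' (pow_le_pow_left₀ (zero_le) hc n) hM
        _ = 1 * 2⁻¹ ^ (n + 1) := by ring
        _ ≤ _ := by gcongr; exact le_add_of_nonneg_left (zero_le)

/-- If all coefficients converge on one polydisc, then a weight that decreases fast enough makes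
the series of their norms summable. -/
lemma formalTZ_eq (d : ℕ) : formalTZ d = finiteNorm formalWeights d := by
  ext f
  constructor
  · rintro ⟨ρ, hρ, hs⟩
    lift ρ to ℝ≥0 using hρ.le
    have hs' := fun n => (convergesOn_iff ρ _).1 (hs n)
    obtain ⟨w, hw, hfin⟩ := exists_formalWeight fun n => (wnorm
      (fun e => (ρ : ℝ≥0∞) ^ e.degree) (fun e => MvPowerSeries.coeff e
        (PowerSeries.coeff n f))).toNNReal
    refine ⟨w, hw, ρ, by exact_mod_cast hρ, ?_⟩
    rw [tzNorm_eq_tsum]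
    simpa only [ENNReal.coe_mul, ENNReal.coe_toNNReal (hs' _)] using hfin
  · rintro ⟨w, hw, ρ, hρ, hs⟩
    refine ⟨ρ, by exact_mod_cast hρ, fun n => (convergesOn_iff ρ _).2 fun htop => hs ?_⟩
    rw [tzNorm_eq_tsum, ← top_le_iff]
    refine le_trans ?_ (ENNReal.le_tsum n)
    rw [htop, ENNReal.mul_top (by simpa using (hw.1 n).ne')]

/-- The ring `ℂ{t, z}`. -/
def convRing (d : ℕ) : Subring (SeriesTZ d) := isWeightClass_convWeights.ring d

/-- The ring `ℂ{t, z]]`. -/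
def formalRing (d : ℕ) : Subring (SeriesTZ d) := isWeightClass_formalWeights.ring d

lemma mem_convRing {d : ℕ} {f : SeriesTZ d} : f ∈ convRing d ↔ f ∈ convTZ d := by
  rw [convTZ_eq]; rfl

lemma mem_formalRing {d : ℕ} {f : SeriesTZ d} : f ∈ formalRing d ↔ f ∈ formalTZ d := by
  rw [formalTZ_eq]; rfl

lemma isAdmissible_convRing (d : ℕ) : IsAdmissible (convRing d) := by
  refine isWeightClass_convWeights.isAdmissible d fun f hf => ?_
  rw [← convTZ_eq] at hf ⊢
  obtain ⟨ρ, hρ, hs⟩ := hf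
  refine ⟨ρ, hρ, ?_⟩
  have hinj : Function.Injective fun p : ℕ × (Fin d →₀ ℕ) => (p.1 + 1, p.2) := by
    rintro ⟨a, b⟩ ⟨a', b'⟩ h
    simpa using h
  refine ((hs.comp_injective hinj).mul_left ρ⁻¹).congr fun p => ?_
  have := cf_zVar_mul_succ f p.1 p.2
  rw [cf_apply, cf_apply] at this
  simp only [Function.comp_apply] at this ⊢
  rw [this]
  field_simp
  ring

lemma isAdmissible_formalRing (d : ℕ) : IsAdmissible (formalRing d) := by
  refine isWeightClass_formalWeights.isAdmissible d fun f hf => ?_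
  rw [← formalTZ_eq] at hf ⊢
  obtain ⟨ρ, hρ, hs⟩ := hf
  refine ⟨ρ, hρ, fun n => ?_⟩
  have := hs (n + 1)
  rwa [zVar, PowerSeries.coeff_succ_X_mul] at this

lemma convTZ_subset_formalTZ (d : ℕ) : convTZ d ⊆ formalTZ d := by
  rintro f hf
  rw [convTZ_eq] at hf
  rw [formalTZ_eq]
  obtain ⟨_, ⟨σ, hσ, hσ1, rfl⟩, ρ, hρ, hs⟩ := hf
  exact ⟨_, isWeightClass_formalWeights.geom_mem σ hσ hσ1, ρ, hρ, hs⟩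

/-! ### Derivations and gauge transformations -/

section derivation

variable {d : ℕ}

lemma dT_add (i : Fin d) (f g : SeriesTZ d) : dT i (f + g) = dT i f + dT i g := by
  ext1 n
  simp [dT]

lemma dT_zero (i : Fin d) : dT i (0 : SeriesTZ d) = 0 := by
  ext1 n
  simp [dT]

lemma dT_mul (i : Fin d) (f g : SeriesTZ d) : dT i (f * g) = dT i f * g + f * dT i g := by
  ext1 n
  simp only [dT, PowerSeries.coeff_mk, PowerSeries.coeff_mul, map_sum, Derivation.leibniz,
    smul_eq_mul, map_add, Finset.sum_add_distrib]
  rw [add_comm]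
  congr 1
  exact Finset.sum_congr rfl fun p _ => mul_comm _ _

/-- The partial derivative `∂_i` as a derivation. -/
def dTDer (i : Fin d) : Derivation ℤ (SeriesTZ d) (SeriesTZ d) :=
  Derivation.mk' ({ toFun := dT i, map_zero' := dT_zero i, map_add' := dT_add i } :
    SeriesTZ d →+ SeriesTZ d).toIntLinearMap fun f g => by
      change dT i (f * g) = f * dT i g + g * dT i f
      rw [dT_mul]
      ring

lemma dTDer_apply (i : Fin d) (f : SeriesTZ d) : dTDer i f = dT i f := rfl

lemma dT_neg (i : Fin d) (f : SeriesTZ d) : dT i (-f) = -dT i f := map_neg (dTDer i) f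

lemma dT_one (i : Fin d) : dT i (1 : SeriesTZ d) = 0 := (dTDer i).map_one_eq_zero

lemma dT_C (i : Fin d) (a : SeriesT d) :
    dT i (PowerSeries.C a) = PowerSeries.C (MvPowerSeries.pderiv (R := ℂ) i a) := by
  ext1 n
  rw [dT, PowerSeries.coeff_mk, PowerSeries.coeff_C, PowerSeries.coeff_C]
  split_ifs <;> simp

lemma dT_const (i : Fin d) (a : ℂ) : dT i (const d a) = 0 := by
  rw [const, RingHom.comp_apply, dT_C, MvPowerSeries.pderiv_C, map_zero]

lemma dT_zVar (i : Fin d) : dT i (zVar d) = 0 := by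
  ext1 n
  rw [dT, PowerSeries.coeff_mk, zVar, PowerSeries.coeff_X]
  split_ifs
  · rw [MvPowerSeries.pderiv_one, map_zero]
  · simp

lemma dT_zVar_mul (i : Fin d) (f : SeriesTZ d) : dT i (zVar d * f) = zVar d * dT i f := by
  rw [dT_mul, dT_zVar]; ring

lemma dT_comm (i j : Fin d) (f : SeriesTZ d) : dT i (dT j f) = dT j (dT i f) := by
  classical
  refine cf_ext fun p => ?_
  simp only [cf_dT, Finsupp.add_apply, Finsupp.single_apply]
  by_cases h : i = j
  · simp [h]
  · rw [if_neg (Ne.symm h), if_neg h, add_right_comm]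
    push_cast
    ring

lemma zVar_mul_cancel {f g : SeriesTZ d} (h : zVar d * f = zVar d * g) : f = g :=
  mul_left_cancel₀ (PowerSeries.X_ne_zero) h

end derivation

section matrices

variable {d : ℕ} {n m l : Type*}

lemma map_dT_mul [Fintype m] (i : Fin d) (A : Matrix n m (SeriesTZ d))
    (B : Matrix m l (SeriesTZ d)) :
    (A * B).map (dT i) = A.map (dT i) * B + A * B.map (dT i) := by
  ext1 a b
  simp only [Matrix.map_apply, Matrix.mul_apply, Matrix.add_apply, ← dTDer_apply, map_sum,
    Derivation.leibniz, smul_eq_mul, Finset.sum_add_distrib]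
  rw [add_comm]
  congr 1
  exact Finset.sum_congr rfl fun p _ => mul_comm _ _

lemma map_dT_add (i : Fin d) (A B : Matrix n m (SeriesTZ d)) :
    (A + B).map (dT i) = A.map (dT i) + B.map (dT i) := by
  ext1 a b; simp [dT_add]

lemma map_dT_zVar_smul (i : Fin d) (A : Matrix n m (SeriesTZ d)) :
    (zVar d • A).map (dT i) = zVar d • A.map (dT i) := by
  ext1 a b; simp [dT_zVar_mul]

lemma map_dT_one [DecidableEq n] (i : Fin d) :
    (1 : Matrix n n (SeriesTZ d)).map (dT i) = 0 := by
  ext1 a b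
  rw [Matrix.map_apply, Matrix.one_apply]
  split_ifs
  · simp [dT_one]
  · simp [dT_zero]

lemma map_dT_comm (i j : Fin d) (A : Matrix n m (SeriesTZ d)) :
    (A.map (dT i)).map (dT j) = (A.map (dT j)).map (dT i) := by
  ext1 a b; simp [dT_comm i j]

end matrices

section gauge

variable {d r s u : ℕ}

/-- `T` transforms the connection form `A` into `A'`. Invertibility of `T` and convergence of its
entries are not part of this. -/
def IsGauge (T : Matrix (Fin r) (Fin s) (SeriesTZ d))
    (A : Fin d → Matrix (Fin r) (Fin r) (SeriesTZ d))
    (A' : Fin d → Matrix (Fin s) (Fin s) (SeriesTZ d)) : Prop :=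
  ∀ i, zVar d • T.map (dT i) + A i * T = T * A' i

lemma IsGauge.mul {A : Fin d → Matrix (Fin r) (Fin r) (SeriesTZ d)}
    {A' : Fin d → Matrix (Fin s) (Fin s) (SeriesTZ d)}
    {A'' : Fin d → Matrix (Fin u) (Fin u) (SeriesTZ d)}
    {T : Matrix (Fin r) (Fin s) (SeriesTZ d)} {T' : Matrix (Fin s) (Fin u) (SeriesTZ d)}
    (h : IsGauge T A A') (h' : IsGauge T' A' A'') : IsGauge (T * T') A A'' := by
  intro i
  rw [map_dT_mul, smul_add, Matrix.mul_assoc, ← h' i, Matrix.mul_add, ← Matrix.mul_assoc T,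
    ← h i, Matrix.add_mul, Matrix.smul_mul, Matrix.mul_smul, Matrix.mul_assoc]
  abel

/-- The curvature of the connection form `z⁻¹ ∑ A_i dt_i`, multiplied by `z ^ 2`. -/
def curv (A : Fin d → Matrix (Fin r) (Fin r) (SeriesTZ d)) (i j : Fin d) :
    Matrix (Fin r) (Fin r) (SeriesTZ d) :=
  zVar d • (A j).map (dT i) - zVar d • (A i).map (dT j) + (A i * A j - A j * A i)

/-- The curvature is transformed by conjugation. -/
lemma IsGauge.curv {A : Fin d → Matrix (Fin r) (Fin r) (SeriesTZ d)}
    {A' : Fin d → Matrix (Fin s) (Fin s) (SeriesTZ d)} {T : Matrix (Fin r) (Fin s) (SeriesTZ d)}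
    (h : IsGauge T A A') (i j : Fin d) : T * curv A' i j = curv A i j * T := by
  -- The terms with derivatives of `T` are symmetric in `i` and `j`, so they cancel in the
  -- difference.
  have key : ∀ i j, T * (zVar d • (A' j).map (dT i)) + T * (A' i * A' j) =
      zVar d • zVar d • (T.map (dT j)).map (dT i) + (zVar d • (A j).map (dT i)) * T +
        A j * (zVar d • T.map (dT i)) + A i * (zVar d • T.map (dT j)) + A i * A j * T := by
    intro i j
    have h1 : (T * A' j).map (dT i) = _ := congrArg (fun M => M.map (dT i)) (h j).symm
    rw [map_dT_mul, map_dT_add, map_dT_zVar_smul, map_dT_mul] at h1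
    have h2 : T * (zVar d • (A' j).map (dT i)) = zVar d • (zVar d • (T.map (dT j)).map (dT i) +
        ((A j).map (dT i) * T + A j * T.map (dT i))) - (zVar d • T.map (dT i)) * A' j := by
      rw [← h1, Matrix.mul_smul, smul_add, Matrix.smul_mul]
      abel
    have h3 : T * (A' i * A' j) =
        (zVar d • T.map (dT i)) * A' j + A i * (zVar d • T.map (dT j)) + A i * A j * T := by
      rw [← Matrix.mul_assoc, ← h i, Matrix.add_mul, Matrix.mul_assoc (A i), ← h j,
        Matrix.mul_add, Matrix.mul_assoc]
      abel
    rw [h2, h3]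
    simp only [smul_add, Matrix.smul_mul, Matrix.mul_smul]
    abel
  have e : T * TStr.curv A' i j =
      (T * (zVar d • (A' j).map (dT i)) + T * (A' i * A' j)) -
        (T * (zVar d • (A' i).map (dT j)) + T * (A' j * A' i)) := by
    simp only [TStr.curv, Matrix.mul_add, Matrix.mul_sub]
    abel
  rw [e, key, key, map_dT_comm i j]
  simp only [TStr.curv, Matrix.add_mul, Matrix.sub_mul]
  abel

/-- The value of a series at the origin. -/
def ev0 (d : ℕ) : SeriesTZ d →+* ℂ := MvPowerSeries.constantCoeff.comp PowerSeries.constantCoeff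

lemma cf_zero_eq_ev0 (f : SeriesTZ d) : cf d f 0 = ev0 d f := by
  rw [cf_apply, ev0, RingHom.comp_apply]
  rw [← PowerSeries.coeff_zero_eq_constantCoeff_apply,
    ← MvPowerSeries.coeff_zero_eq_constantCoeff_apply]
  rfl

lemma ev0_const (a : ℂ) : ev0 d (const d a) = a := by
  rw [← cf_zero_eq_ev0, cf_const, if_pos rfl]

/-- A matrix over an admissible ring that is invertible at the origin is invertible. -/
lemma IsAdmissible.exists_matrix_inv {R : Subring (SeriesTZ d)} (hR : IsAdmissible R)
    {T : Matrix (Fin r) (Fin r) (SeriesTZ d)} (hT : ∀ a b, T a b ∈ R)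
    (h0 : ev0 d T.det ≠ 0) :
    ∃ T' : Matrix (Fin r) (Fin r) (SeriesTZ d), (∀ a b, T' a b ∈ R) ∧ T * T' = 1 ∧ T' * T = 1 := by
  have hlift : ∃ U : Matrix (Fin r) (Fin r) R, U.map R.subtype = T :=
    ⟨Matrix.of fun a b => ⟨T a b, hT a b⟩, by ext1 a b; rfl⟩
  obtain ⟨U, rfl⟩ := hlift
  have hdet : (U.map R.subtype).det = R.subtype U.det := (RingHom.map_det R.subtype U).symm
  rw [hdet, ← cf_zero_eq_ev0] at h0
  obtain ⟨g, hg, hfg⟩ := hR.exists_inv _ U.det.2 h0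
  refine ⟨g • (U.adjugate).map R.subtype, fun a b => R.mul_mem hg (U.adjugate a b).2, ?_, ?_⟩
  · rw [Matrix.mul_smul, ← Matrix.map_mul, Matrix.mul_adjugate]
    ext1 a b
    simp only [Matrix.smul_apply, Matrix.map_apply, Matrix.one_apply, smul_eq_mul]
    split_ifs
    · simpa [mul_comm] using hfg
    · simp
  · rw [Matrix.smul_mul, ← Matrix.map_mul, Matrix.adjugate_mul]
    ext1 a b
    simp only [Matrix.smul_apply, Matrix.map_apply, Matrix.one_apply, smul_eq_mul]
    split_ifs
    · simpa [mul_comm] using hfg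
    · simp

lemma bijective_mulVec_iff (T : Matrix (Fin r) (Fin r) (SeriesTZ d)) :
    (Function.Bijective fun v : Fin r → ℂ => T.map (fun f => atT0 (atZ0 f)) *ᵥ v) ↔
      ev0 d T.det ≠ 0 := by
  have h : T.map (fun f => atT0 (atZ0 f)) = T.map (ev0 d) := by
    ext1 a b
    simp [atT0, atZ0, ev0]
  have hdet : ev0 d T.det = (T.map (ev0 d)).det := RingHom.map_det (ev0 d) T
  rw [h, hdet, ← isUnit_iff_ne_zero, ← Matrix.isUnit_iff_isUnit_det]
  constructor
  · intro hb
    exact Matrix.mulVec_injective_iff_isUnit.1 hb.1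
  · intro hu
    exact ⟨Matrix.mulVec_injective_iff_isUnit.2 hu, Matrix.mulVec_surjective_iff_isUnit.2 hu⟩

lemma gaugeIso_iff {R : Set (SeriesTZ d)} {A A' : Fin d → Matrix (Fin r) (Fin r) (SeriesTZ d)} :
    GaugeIso R A A' ↔ ∃ T : Matrix (Fin r) (Fin r) (SeriesTZ d),
      (∀ a b, T a b ∈ R) ∧ ev0 d T.det ≠ 0 ∧ IsGauge T A A' := by
  unfold GaugeIso IsGauge
  simp only [bijective_mulVec_iff, sub_eq_zero]

lemma matrix_mul_mem {R : Subring (SeriesTZ d)} {T T' : Matrix (Fin r) (Fin r) (SeriesTZ d)}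
    (hT : ∀ a b, T a b ∈ R) (hT' : ∀ a b, T' a b ∈ R) (a b : Fin r) : (T * T') a b ∈ R := by
  rw [Matrix.mul_apply]
  exact R.sum_mem fun c _ => R.mul_mem (hT _ _) (hT' _ _)

lemma GaugeIso.trans {R : Subring (SeriesTZ d)}
    {A A' A'' : Fin d → Matrix (Fin r) (Fin r) (SeriesTZ d)}
    (h : GaugeIso (R : Set (SeriesTZ d)) A A') (h' : GaugeIso (R : Set (SeriesTZ d)) A' A'') :
    GaugeIso (R : Set (SeriesTZ d)) A A'' := by
  rw [gaugeIso_iff] at *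
  obtain ⟨T, hT, h0, hg⟩ := h
  obtain ⟨T', hT', h0', hg'⟩ := h'
  refine ⟨T * T', matrix_mul_mem hT hT', ?_, hg.mul hg'⟩
  rw [Matrix.det_mul, map_mul]
  exact mul_ne_zero h0 h0'

end gauge

/-! ### `(T)`-structures over `I_2(m)` -/

/-- Restriction to `z = 0` as a ring homomorphism. -/
def z0 (d : ℕ) : SeriesTZ d →+* SeriesT d := PowerSeries.constantCoeff

lemma map_atZ0 {d r : ℕ} (M : Matrix (Fin r) (Fin r) (SeriesTZ d)) : M.map atZ0 = M.map (z0 d) := by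
  ext1 a b
  simp [atZ0, z0]

lemma ev0_eq {d : ℕ} (f : SeriesTZ d) : ev0 d f = MvPowerSeries.constantCoeff (z0 d f) := rfl

lemma z0_C {d : ℕ} (a : SeriesT d) : z0 d (PowerSeries.C a) = a := by simp [z0]

lemma z0_zVar (d : ℕ) : z0 d (zVar d) = 0 := by simp [z0, zVar]

lemma exists_eq_zVar_mul {d : ℕ} {f : SeriesTZ d} (hf : z0 d f = 0) : ∃ g, f = zVar d * g :=
  PowerSeries.X_dvd_iff.2 hf

/-- A primitive section identifies the fibre with the tangent space, whose dimension is `2`. -/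
lemma IsPrimitive.rank_eq {r : ℕ} {A : Fin 2 → Matrix (Fin r) (Fin r) (SeriesTZ 2)}
    {ζ : Fin r → SeriesT 2} (h : IsPrimitive A ζ) : r = 2 := by
  let w : Fin 2 → Fin r → ℂ := fun i a => atT0 ((((A i).map atZ0) *ᵥ ζ) a)
  have hw : Function.Bijective (Fintype.linearCombination ℂ w) := h.2
  have := (LinearEquiv.ofBijective _ hw).finrank_eq
  simpa using this.symm

lemma isUnit_of_constantCoeff {d : ℕ} {a : SeriesT d} (h : MvPowerSeries.constantCoeff a ≠ 0) :
    IsUnit a :=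
  MvPowerSeries.isUnit_iff_constantCoeff.2 (isUnit_iff_ne_zero.2 h)

lemma C_mem_convT {d : ℕ} (a : ℂ) : (MvPowerSeries.C a : SeriesT d) ∈ convT d := by
  classical
  refine ⟨1, one_pos, summable_of_ne_finset_zero (s := {0}) fun e he => ?_⟩
  rw [MvPowerSeries.coeff_C, if_neg (by simpa using he)]
  simp

lemma one_mem_convT (d : ℕ) : (1 : SeriesT d) ∈ convT d := by
  simpa using C_mem_convT (d := d) 1

lemma zero_mem_convT (d : ℕ) : (0 : SeriesT d) ∈ convT d := by
  simpa using C_mem_convT (d := d) 0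

/-- At `z = 0`, a `(T)`-structure over `I_2(m)` is given by the identity and by a matrix with square
`t_2 ^ (m - 2)` that has a cyclic vector at the origin. -/
lemma Induces.cyclic {m : ℕ} {A : Fin 2 → Matrix (Fin 2) (Fin 2) (SeriesTZ 2)}
    (h : Induces A (mulI2 m)) :
    (A 0).map (z0 2) = 1 ∧ (A 1).map (z0 2) * (A 1).map (z0 2) = t2 ^ (m - 2) • 1 ∧
      ∃ v : Fin 2 → ℂ, v 0 * ((A 1).map (ev0 2) *ᵥ v) 1 - v 1 * ((A 1).map (ev0 2) *ᵥ v) 0 ≠ 0 := by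
  obtain ⟨ζ, ⟨-, hbij⟩, hmul⟩ := h
  simp only [map_atZ0] at hbij
  set C0 := (A 0).map (z0 2) with hC0
  set C1 := (A 1).map (z0 2) with hC1
  -- The columns of `Z` are `C_{∂_1} ζ` and `C_{∂_2} ζ`; they form a basis since `ζ` is primitive.
  let c : SeriesT 2 →+* ℂ := MvPowerSeries.constantCoeff
  let Z : Matrix (Fin 2) (Fin 2) (SeriesT 2) := Matrix.of fun a => ![(C0 *ᵥ ζ) a, (C1 *ᵥ ζ) a]
  have hZ0 : c Z.det ≠ 0 := by
    have hdet : c Z.det = (Z.map c).det := RingHom.map_det c Z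
    rw [hdet, ← isUnit_iff_ne_zero, ← Matrix.isUnit_iff_isUnit_det,
      ← Matrix.mulVec_injective_iff_isUnit]
    convert hbij.1 using 1
    funext v a
    rw [Fin.sum_univ_two]
    simp only [Matrix.mulVec, dotProduct, Fin.sum_univ_two, Matrix.map_apply, Matrix.of_apply,
      Matrix.cons_val_zero, Matrix.cons_val_one, Pi.add_apply, Pi.smul_apply, smul_eq_mul, Z]
    rw [mul_comm (v 0), mul_comm (v 1)]
    rfl
  have hZ : IsUnit Z := (Matrix.isUnit_iff_isUnit_det Z).2 (isUnit_of_constantCoeff hZ0)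
  have hone : ∀ i, (![1, 0] : Fin 2 → SeriesT 2) i ∈ convT 2 := by
    intro i; fin_cases i
    · exact one_mem_convT 2
    · exact zero_mem_convT 2
  have hone' : ∀ i, (![0, 1] : Fin 2 → SeriesT 2) i ∈ convT 2 := by
    intro i; fin_cases i
    · exact zero_mem_convT 2
    · exact one_mem_convT 2
  have h00 := hmul ![1, 0] ![1, 0] hone hone
  have h01 := hmul ![1, 0] ![0, 1] hone hone'
  have h11 := hmul ![0, 1] ![0, 1] hone' hone'
  simp only [higgs, mulI2, map_atZ0, Fin.sum_univ_two, Matrix.cons_val_zero, Matrix.cons_val_one,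
    ← hC0, ← hC1, one_smul, zero_smul, add_zero, zero_add, mul_one, mul_zero,
    Matrix.smul_mulVec] at h00 h01 h11
  have hcols : ∀ M M' : Matrix (Fin 2) (Fin 2) (SeriesT 2),
      M *ᵥ (C0 *ᵥ ζ) = M' *ᵥ (C0 *ᵥ ζ) → M *ᵥ (C1 *ᵥ ζ) = M' *ᵥ (C1 *ᵥ ζ) → M = M' := by
    intro M M' h0 h1
    refine hZ.mul_right_cancel ?_
    ext1 a b
    fin_cases b
    · exact congrFun h0 a
    · exact congrFun h1 a
  have hC0' : C0 = 1 := hcols _ _ (by rw [← h00, Matrix.one_mulVec])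
    (by rw [← h01, Matrix.one_mulVec])
  rw [hC0', Matrix.one_mulVec] at h11
  have hsq : C1 * C1 = t2 ^ (m - 2) • 1 := by
    have h11' : C1 *ᵥ C1 *ᵥ ζ = (t2 ^ (m - 2) • (1 : Matrix (Fin 2) (Fin 2) (SeriesT 2))) *ᵥ ζ := by
      rw [← h11, Matrix.smul_mulVec, Matrix.one_mulVec]
    refine hcols _ _ ?_ ?_
    · rw [hC0', Matrix.one_mulVec, ← Matrix.mulVec_mulVec, h11']
    · rw [← Matrix.mulVec_mulVec, ← h11, Matrix.mulVec_smul, Matrix.smul_mulVec, Matrix.one_mulVec]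
  refine ⟨hC0', hsq, fun a => c (ζ a), ?_⟩
  have hv : ∀ a, ((A 1).map (ev0 2) *ᵥ fun a => c (ζ a)) a = c ((C1 *ᵥ ζ) a) := by
    intro a
    rw [RingHom.map_mulVec]
    rfl
  convert hZ0 using 1
  rw [hv, hv, Matrix.det_fin_two]
  simp only [Z, Matrix.of_apply, Matrix.cons_val_zero, Matrix.cons_val_one, hC0',
    Matrix.one_mulVec, map_sub, map_mul]
  ring

/-! ### Reduction to the form `(*)` -/

section reduction

variable {R : Subring (SeriesTZ 2)}

lemma IsGauge.map_z0 {d r s : ℕ} {A : Fin d → Matrix (Fin r) (Fin r) (SeriesTZ d)}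
    {A' : Fin d → Matrix (Fin s) (Fin s) (SeriesTZ d)} {T : Matrix (Fin r) (Fin s) (SeriesTZ d)}
    (h : IsGauge T A A') (i : Fin d) :
    (A i).map (z0 d) * T.map (z0 d) = T.map (z0 d) * (A' i).map (z0 d) := by
  rw [← Matrix.map_mul, ← Matrix.map_mul, ← h i]
  ext1 a b
  simp [z0_zVar]

/-- An invertible matrix transforms every connection form into a unique other one. -/
lemma IsAdmissible.exists_gauge (hR : IsAdmissible R)
    {T : Matrix (Fin 2) (Fin 2) (SeriesTZ 2)} (hT : ∀ a b, T a b ∈ R) (h0 : ev0 2 T.det ≠ 0)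
    {A : Fin 2 → Matrix (Fin 2) (Fin 2) (SeriesTZ 2)} (hA : ∀ i a b, A i a b ∈ R) :
    ∃ A', (∀ i a b, A' i a b ∈ R) ∧ IsGauge T A A' := by
  obtain ⟨T', hT', h1, -⟩ := hR.exists_matrix_inv hT h0
  refine ⟨fun i => T' * (zVar 2 • T.map (dT i) + A i * T), fun i => matrix_mul_mem hT' ?_, ?_⟩
  · intro a b
    exact R.add_mem (R.mul_mem hR.zVar_mem (hR.dT_mem _ _ (hT _ _)))
      (matrix_mul_mem (hA i) hT a b)
  · intro i
    rw [← Matrix.mul_assoc, h1, Matrix.one_mul]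

lemma isUnit_of_ev0 {r d : ℕ} {T : Matrix (Fin r) (Fin r) (SeriesTZ d)} (h0 : ev0 d T.det ≠ 0) :
    IsUnit T := by
  rw [Matrix.isUnit_iff_isUnit_det]
  exact PowerSeries.isUnit_iff_constantCoeff.2 (isUnit_of_constantCoeff h0)

lemma IsGauge.curv_eq_zero {d r : ℕ} {A A' : Fin d → Matrix (Fin r) (Fin r) (SeriesTZ d)}
    {T : Matrix (Fin r) (Fin r) (SeriesTZ d)} (h : IsGauge T A A') (h0 : ev0 d T.det ≠ 0)
    (hA : ∀ i j, TStr.curv A i j = 0) (i j : Fin d) : TStr.curv A' i j = 0 := by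
  refine (isUnit_of_ev0 h0).mul_left_cancel ?_
  rw [h.curv, hA, Matrix.zero_mul, Matrix.mul_zero]

/-- If `A_1 = 1`, then flatness says that `A_2` does not depend on `t_1`. -/
lemma map_dT_eq_zero_of_curv {r : ℕ} {A : Fin 2 → Matrix (Fin r) (Fin r) (SeriesTZ 2)}
    (h1 : A 0 = 1) (hA : curv A 0 1 = 0) : (A 1).map (dT 0) = 0 := by
  rw [curv, h1, map_dT_one, smul_zero, sub_zero, Matrix.one_mul, Matrix.mul_one, sub_self,
    add_zero] at hA
  ext1 a b
  refine zVar_mul_cancel ?_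
  have := congrFun (congrFun hA a) b
  simpa using this

/-- A linear differential equation in the direction `t_1` brings `A_1` to the identity. -/
lemma IsAdmissible.exists_gauge_one (hR : IsAdmissible R)
    {A : Fin 2 → Matrix (Fin 2) (Fin 2) (SeriesTZ 2)} (hA : ∀ i a b, A i a b ∈ R)
    (h1 : (A 0).map (z0 2) = 1) :
    ∃ (T : Matrix (Fin 2) (Fin 2) (SeriesTZ 2))
      (A' : Fin 2 → Matrix (Fin 2) (Fin 2) (SeriesTZ 2)),
      (∀ a b, T a b ∈ R) ∧ T.map (ev0 2) = 1 ∧ (∀ i a b, A' i a b ∈ R) ∧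
      IsGauge T A A' ∧ A' 0 = 1 := by
  have hdiv : ∀ a b, ∃ g, (A 0 - 1) a b = zVar 2 * g := by
    intro a b
    refine exists_eq_zVar_mul ?_
    have h := congrFun (congrFun h1 a) b
    rw [Matrix.map_apply] at h
    rw [Matrix.sub_apply, map_sub, h, Matrix.one_apply, Matrix.one_apply]
    split_ifs <;> simp
  choose B hB using hdiv
  have hone : ∀ a b, (1 : Matrix (Fin 2) (Fin 2) (SeriesTZ 2)) a b ∈ R := by
    intro a b
    rw [Matrix.one_apply]
    split_ifs
    exacts [R.one_mem, R.zero_mem]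
  have hBR : ∀ a b, B a b ∈ R := fun a b => hR.of_zVar_mul_mem _ (by
    rw [← hB]
    exact R.sub_mem (hA _ _ _) (hone a b))
  obtain ⟨T, hT, hode, hinit⟩ := hR.exists_ode 0 (Matrix.of B) hBR
  have hTev : T.map (ev0 2) = 1 := by
    ext1 a b
    rw [Matrix.map_apply, ← cf_zero_eq_ev0, hinit a b 0 rfl, cf_zero_eq_ev0, Matrix.one_apply,
      Matrix.one_apply]
    split_ifs <;> simp
  have hdet : ev0 2 T.det ≠ 0 := by
    have : ev0 2 T.det = (T.map (ev0 2)).det := RingHom.map_det (ev0 2) T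
    rw [this, hTev, Matrix.det_one]
    exact one_ne_zero
  obtain ⟨A', hA', hg⟩ := hR.exists_gauge hT hdet hA
  refine ⟨T, A', hT, hTev, hA', hg, (isUnit_of_ev0 hdet).mul_left_cancel ?_⟩
  have hA0 : A 0 = 1 + zVar 2 • Matrix.of B := by
    ext1 a b
    have := hB a b
    rw [Matrix.sub_apply, sub_eq_iff_eq_add'] at this
    rw [this]
    rfl
  rw [← hg 0, hode, hA0, Matrix.add_mul, Matrix.smul_mul, Matrix.one_mul, Matrix.mul_one, smul_neg]
  abel

/-- A constant cyclic vector brings `A_2` to companion form. -/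
lemma IsAdmissible.exists_gauge_companion (hR : IsAdmissible R)
    {A : Fin 2 → Matrix (Fin 2) (Fin 2) (SeriesTZ 2)} (hA : ∀ i a b, A i a b ∈ R)
    (h1 : A 0 = 1) (hA0 : (A 1).map (dT 0) = 0) (v : Fin 2 → ℂ)
    (hv : v 0 * ((A 1).map (ev0 2) *ᵥ v) 1 - v 1 * ((A 1).map (ev0 2) *ᵥ v) 0 ≠ 0) :
    ∃ T A', (∀ a b, T a b ∈ R) ∧ ev0 2 T.det ≠ 0 ∧ (∀ i a b, A' i a b ∈ R) ∧
      IsGauge T A A' ∧ A' 0 = 1 ∧ A' 1 0 0 = 0 ∧ A' 1 1 0 = 1 := by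
  -- As `v` is constant, the first column of `A_2 T + z ∂_2 T` is `A_2 v`, the second column of `T`.
  let V : Fin 2 → SeriesTZ 2 := fun a => const 2 (v a)
  let T : Matrix (Fin 2) (Fin 2) (SeriesTZ 2) := Matrix.of fun a => ![V a, (A 1 *ᵥ V) a]
  have hVR : ∀ a, V a ∈ R := fun a => hR.const_mem _
  have hWR : ∀ a, (A 1 *ᵥ V) a ∈ R := fun a => by
    rw [Matrix.mulVec, dotProduct]
    exact R.sum_mem fun b _ => R.mul_mem (hA 1 a b) (hVR b)
  have hT : ∀ a b, T a b ∈ R := by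
    intro a b
    fin_cases b
    exacts [hVR a, hWR a]
  have hW0 : ∀ a, ev0 2 ((A 1 *ᵥ V) a) = ((A 1).map (ev0 2) *ᵥ v) a := by
    intro a
    rw [RingHom.map_mulVec]
    have : ev0 2 ∘ V = v := funext fun b => ev0_const _
    rw [this]
  have hdet : ev0 2 T.det ≠ 0 := by
    convert hv using 1
    rw [Matrix.det_fin_two, ← hW0, ← hW0]
    simp only [T, V, Matrix.of_apply, Matrix.cons_val_zero, Matrix.cons_val_one, map_sub, map_mul,
      ev0_const]
    ring
  obtain ⟨A', hA', hg⟩ := hR.exists_gauge hT hdet hA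
  have hT0 : T.map (dT 0) = 0 := by
    have hW : (A 1 * Matrix.of fun b (_ : Fin 1) => V b).map (dT 0) = 0 := by
      rw [map_dT_mul, hA0, Matrix.zero_mul, zero_add]
      convert Matrix.mul_zero _
      ext1 a b
      exact dT_const 0 _
    ext1 a b
    fin_cases b
    · exact dT_const 0 _
    · exact congrFun (congrFun hW a) 0
  have hcol : ∀ a, (T * A' 1) a 0 = T a 1 := by
    intro a
    rw [← hg 1, Matrix.add_apply, Matrix.smul_apply, Matrix.map_apply]
    have : dT 1 (T a 0) = 0 := dT_const 1 _
    rw [this, smul_zero, zero_add]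
    rfl
  have hunit := isUnit_of_ev0 hdet
  have hcomp : A' 1 = !![0, A' 1 0 1; 1, A' 1 1 1] := by
    refine hunit.mul_left_cancel ?_
    ext1 a b
    fin_cases b
    · refine (hcol a).trans ?_
      simp [Matrix.mul_apply]
    · simp [Matrix.mul_apply]
  refine ⟨T, A', hT, hdet, hA', hg, hunit.mul_left_cancel ?_, ?_, ?_⟩
  · rw [← hg 0, hT0, h1]
    simp
  · rw [hcomp]; rfl
  · rw [hcomp]; rfl

/-- Solutions of a homogeneous linear differential equation with zero initial value vanish. -/
lemma eq_zero_of_ode {d : ℕ} (i : Fin d) {y σ : SeriesTZ d} (hy : dT i y = -(σ * y))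
    (h0 : ∀ p, p.2 i = 0 → cf d y p = 0) : y = 0 := by
  have h : (!![y] : Matrix (Fin 1) (Fin 1) (SeriesTZ d)) = picard i !![σ] !![y] := by
    ext1 a b
    fin_cases a; fin_cases b
    change y = -(integral i ((!![σ] * !![y] : Matrix (Fin 1) (Fin 1) (SeriesTZ d)) 0 0))
    rw [← map_neg, Matrix.mul_apply, Fin.sum_univ_one]
    change y = integral i (-(σ * y))
    rw [← hy, integral_dT i y h0]
  have := (picard_raises i !![σ]).eq_zero (cfMat_bijective d 1).1 h
  exact congrFun (congrFun this 0) 0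

/-- A scalar integrating factor for the direction `t_2`, independent of `t_1`. -/
lemma IsAdmissible.exists_integratingFactor (hR : IsAdmissible R) {σ : SeriesTZ 2} (hσ : σ ∈ R)
    (hσ0 : dT 0 σ = 0) :
    ∃ τ ∈ R, ev0 2 τ = 1 ∧ dT 0 τ = 0 ∧ dT 1 τ = -(σ * τ) := by
  obtain ⟨T, hT, hode, hinit⟩ := hR.exists_ode (n := 1) 1 (Matrix.of fun _ _ => σ)
    (fun _ _ => hσ)
  have hτ : dT 1 (T 0 0) = -(σ * T 0 0) := by
    have := congrFun (congrFun hode 0) 0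
    simpa [Matrix.mul_apply] using this
  refine ⟨T 0 0, hT 0 0, ?_, ?_, hτ⟩
  · rw [← cf_zero_eq_ev0, hinit 0 0 0 rfl, cf_zero_eq_ev0, Matrix.one_apply_eq, map_one]
  -- The derivative of `τ` by `t_1` satisfies the same homogeneous equation as `τ`.
  · refine eq_zero_of_ode 1 (σ := σ) ?_ fun p hp => ?_
    · rw [dT_comm, hτ, dT_neg, dT_mul, hσ0, zero_mul, zero_add]
    · rw [cf_dT, hinit, Matrix.one_apply_eq, cf_one, if_neg, zero_mul]
      · intro h
        have := DFunLike.congr_fun (congrArg Prod.snd h) 0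
        simp at this
      · simpa using hp

lemma normalForm_one (m : ℕ) (f : SeriesTZ 2) :
    normalForm m f 1 = !![0, PowerSeries.C (t2 ^ (m - 2)) + zVar 2 * f; 1, 0] := by
  ext1 a b
  fin_cases a <;> fin_cases b <;> simp [normalForm, C2, matE]

lemma normalForm_zero (m : ℕ) (f : SeriesTZ 2) : normalForm m f 0 = 1 := rfl

/-- A shear and an integrating factor bring a companion matrix to the form `(*)`. -/
lemma IsAdmissible.exists_gauge_normalForm (hR : IsAdmissible R) (m : ℕ)
    {A : Fin 2 → Matrix (Fin 2) (Fin 2) (SeriesTZ 2)} {b d : SeriesTZ 2}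
    (h1 : A 0 = 1) (hA1 : A 1 = !![0, b; 1, d]) (hbR : b ∈ R) (hdR : d ∈ R) (hd : dT 0 d = 0)
    (hbz : z0 2 b = t2 ^ (m - 2)) (hdz : z0 2 d = 0) :
    ∃ T, ∃ f ∈ R, (∀ a b, T a b ∈ R) ∧ ev0 2 T.det ≠ 0 ∧ IsGauge T A (normalForm m f) := by
  -- The matrix is `τ` times the shear with entry `-s`. The choice `s = d / 2` makes both diagonal
  -- entries of the sheared matrix equal to `s`, and `z ∂_2 τ = -s τ` removes them.
  let s := const 2 (1 / 2) * d
  have hsd : s + s = d := by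
    rw [← add_mul, ← map_add]
    norm_num
  have hs0 : dT 0 s = 0 := by rw [dT_mul, dT_const, hd]; ring
  have hsz : z0 2 s = 0 := by rw [map_mul, hdz, mul_zero]
  have hsR : s ∈ R := R.mul_mem (hR.const_mem _) hdR
  clear_value s
  obtain ⟨σ, hσ⟩ := exists_eq_zVar_mul hsz
  have hσR : σ ∈ R := hR.of_zVar_mul_mem _ (by rwa [← hσ])
  have hσ0 : dT 0 σ = 0 := by
    rw [hσ, dT_zVar_mul] at hs0
    exact zVar_mul_cancel (by rw [hs0, mul_zero])
  obtain ⟨τ, hτR, hτev, hτ0, hτ1⟩ := hR.exists_integratingFactor hσR hσ0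
  let g := b + s * s - zVar 2 * dT 1 s
  have hgz : z0 2 (g - PowerSeries.C (t2 ^ (m - 2))) = 0 := by
    rw [map_sub, map_sub, map_add, map_mul, map_mul, hbz, hsz, z0_zVar, z0_C]
    ring
  obtain ⟨f, hf⟩ := exists_eq_zVar_mul hgz
  have hfR : f ∈ R := by
    refine hR.of_zVar_mul_mem _ ?_
    rw [← hf, map_pow]
    exact R.sub_mem (R.sub_mem (R.add_mem hbR (R.mul_mem hsR hsR))
      (R.mul_mem hR.zVar_mem (hR.dT_mem _ _ hsR))) (R.pow_mem (hR.var_mem 1) _)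
  have hg : PowerSeries.C (t2 ^ (m - 2)) + zVar 2 * f = g := by rw [← hf]; ring
  refine ⟨!![τ, -(τ * s); 0, τ], f, hfR, ?_, ?_, ?_⟩
  · intro a b
    fin_cases a <;> fin_cases b
    exacts [hτR, R.neg_mem (R.mul_mem hτR hsR), R.zero_mem, hτR]
  · rw [Matrix.det_fin_two_of, map_sub, map_mul, map_mul, hτev, map_zero]
    norm_num
  · have hsτ : zVar 2 * dT 1 τ = -(s * τ) := by rw [hτ1, hσ]; ring
    intro i
    fin_cases i
    · ext1 a b
      fin_cases a <;> fin_cases b <;>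
        simp [h1, normalForm_zero, hτ0, dT_neg, dT_mul, hs0, dT_zero]
    · simp only [Fin.mk_one]
      rw [hA1, normalForm_one, hg]
      ext1 i j
      fin_cases i <;> fin_cases j
      · simp [Matrix.mul_apply, Fin.sum_univ_two]
        linear_combination hsτ
      · simp [Matrix.mul_apply, Fin.sum_univ_two, dT_neg, dT_mul, g]
        linear_combination -s * hsτ
      · simp [Matrix.mul_apply, Fin.sum_univ_two, dT_zero]
      · simp [Matrix.mul_apply, Fin.sum_univ_two]
        linear_combination hsτ - τ * hsd

/-- Every `(T)`-structure over `I_2(m)` with entries in an admissible ring is gauge isomorphic to a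
form `(*)` with `f` independent of `t_1`. -/
theorem IsAdmissible.exists_normalForm (hR : IsAdmissible R) {m r : ℕ}
    {A : Fin 2 → Matrix (Fin r) (Fin r) (SeriesTZ 2)}
    (hA : IsTStructureOverI2 (R : Set (SeriesTZ 2)) m A) :
    ∃ f ∈ R, dT 0 f = 0 ∧ GaugeIso (R : Set (SeriesTZ 2)) A (normalForm m f) := by
  obtain ⟨⟨hAR, hflat⟩, hind⟩ := hA
  obtain ⟨ζ, hζ, -⟩ := id hind
  obtain rfl := hζ.rank_eq
  obtain ⟨h1, hsq, v, hv⟩ := hind.cyclic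
  obtain ⟨T, A', hT, hTev, hA'R, hg, hA'1⟩ := hR.exists_gauge_one hAR h1
  have hTdet : ev0 2 T.det ≠ 0 := by
    have : ev0 2 T.det = (T.map (ev0 2)).det := RingHom.map_det (ev0 2) T
    rw [this, hTev, Matrix.det_one]
    exact one_ne_zero
  have hflat' := hg.curv_eq_zero hTdet hflat
  have hA'0 := map_dT_eq_zero_of_curv hA'1 (hflat' 0 1)
  -- `T` is the identity at the origin, hence the cyclic vector is not affected.
  have hev : (A' 1).map (ev0 2) = (A 1).map (ev0 2) := by
    have h := congrArg (fun M => M.map (MvPowerSeries.constantCoeff (σ := Fin 2) (R := ℂ)))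
      (hg.map_z0 1)
    simp only [Matrix.map_mul, Matrix.map_map] at h
    change (A 1).map (ev0 2) * T.map (ev0 2) = T.map (ev0 2) * (A' 1).map (ev0 2) at h
    rw [hTev, Matrix.mul_one, Matrix.one_mul] at h
    exact h.symm
  rw [← hev] at hv
  obtain ⟨T', A'', hT', hT'det, hA''R, hg', hA''1, hA''c, hA''d⟩ :=
    hR.exists_gauge_companion hA'R hA'1 hA'0 v hv
  have hflat'' := hg'.curv_eq_zero hT'det hflat'
  have hA''0 := map_dT_eq_zero_of_curv hA''1 (hflat'' 0 1)
  have hTT := hg.mul hg'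
  have hTTdet : ev0 2 (T * T').det ≠ 0 := by
    rw [Matrix.det_mul, map_mul]
    exact mul_ne_zero hTdet hT'det
  -- The relation `C_2 ^ 2 = t_2 ^ (m - 2)` at `z = 0` is invariant under gauge transformations.
  have hsq' : (A'' 1).map (z0 2) * (A'' 1).map (z0 2) = t2 ^ (m - 2) • 1 := by
    have hu : IsUnit ((T * T').map (z0 2)) := (isUnit_of_ev0 hTTdet).map (z0 2).mapMatrix
    refine hu.mul_left_cancel ?_
    rw [← Matrix.mul_assoc, ← hTT.map_z0 1, Matrix.mul_assoc, ← hTT.map_z0 1, ← Matrix.mul_assoc,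
      hsq]
    simp
  have hA''eq : A'' 1 = !![0, A'' 1 0 1; 1, A'' 1 1 1] := by
    ext1 a b
    fin_cases a <;> fin_cases b
    exacts [hA''c, rfl, hA''d, rfl]
  have hbz := congrFun (congrFun hsq' 0) 0
  have hdz := congrFun (congrFun hsq' 1) 0
  rw [hA''eq] at hbz hdz
  simp [Matrix.mul_apply, Fin.sum_univ_two] at hbz hdz
  obtain ⟨T'', f, hfR, hT'', hT''det, hg''⟩ := hR.exists_gauge_normalForm m hA''1 hA''eq
    (hA''R _ _ _) (hA''R _ _ _) (congrFun (congrFun hA''0 1) 1) hbz hdz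
  refine ⟨f, hfR, ?_, ?_⟩
  · have h := map_dT_eq_zero_of_curv (normalForm_zero m f)
      (hg''.curv_eq_zero hT''det hflat'' 0 1)
    have h01 := congrFun (congrFun h 0) 1
    rw [normalForm_one] at h01
    refine zVar_mul_cancel ?_
    simpa [-map_pow, dT_add, dT_C, dT_zVar_mul, t2, Derivation.leibniz_pow,
      MvPowerSeries.pderiv_X_of_ne] using h01
  · exact gaugeIso_iff.2 ⟨_, matrix_mul_mem (matrix_mul_mem hT hT') hT'', by
      rw [Matrix.det_mul, map_mul]
      exact mul_ne_zero hTTdet hT''det, hTT.mul hg''⟩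

/-- The form `(*)` is flat if `f` does not depend on `t_1`, and `(1, 0)` is a primitive section. -/
lemma isTStructureOverI2_normalForm (hR : IsAdmissible R) (m : ℕ) {f : SeriesTZ 2}
    (hf : f ∈ R) (hf0 : dT 0 f = 0) :
    IsTStructureOverI2 (R : Set (SeriesTZ 2)) m (normalForm m f) := by
  refine ⟨⟨?_, ?_⟩, ![1, 0], ⟨?_, ?_⟩, ?_⟩
  · intro i a b
    fin_cases i
    · simp only [Fin.zero_eta, normalForm_zero, Matrix.one_apply]
      split_ifs
      exacts [R.one_mem, R.zero_mem]
    · simp only [Fin.mk_one, normalForm_one]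
      fin_cases a <;> fin_cases b
      · exact R.zero_mem
      · refine R.add_mem ?_ (R.mul_mem hR.zVar_mem hf)
        rw [map_pow]
        exact R.pow_mem (hR.var_mem 1) _
      · exact R.one_mem
      · exact R.zero_mem
  · have hC : dT 0 (PowerSeries.C (t2 ^ (m - 2)) : SeriesTZ 2) = 0 := by
      simp [-map_pow, dT_C, t2, Derivation.leibniz_pow, MvPowerSeries.pderiv_X_of_ne]
    have h01 : (normalForm m f 1).map (dT 0) = 0 := by
      rw [normalForm_one]
      ext1 a b
      fin_cases a <;> fin_cases b <;>
        simp [-map_pow, dT_add, hC, dT_zVar_mul, dT_zero, dT_one, hf0]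
    intro i j
    fin_cases i <;> fin_cases j
    · simp
    · simp [normalForm_zero, map_dT_one, h01]
    · simp [normalForm_zero, map_dT_one, h01]
    · simp
  · intro a
    fin_cases a
    exacts [one_mem_convT 2, zero_mem_convT 2]
  · convert Function.bijective_id using 1
    funext v a
    rw [Fin.sum_univ_two, map_atZ0, map_atZ0, normalForm_zero, normalForm_one]
    fin_cases a <;> simp [Matrix.mulVec, dotProduct, Fin.sum_univ_two, atT0]
  · intro X Y _ _
    simp only [higgs, map_atZ0, Fin.sum_univ_two, normalForm_zero, normalForm_one, mulI2]
    funext a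
    fin_cases a <;> simp [Matrix.mulVec, dotProduct, Fin.sum_univ_two, z0_zVar, z0_C] <;> ring

end reduction

open scoped PowerSeries

/-! ### Power series in one variable on a disc -/

/-- The coefficients of a power series in one variable. -/
def cf1 : ℂ⟦X⟧ →+ (ℕ → ℂ) where
  toFun a n := PowerSeries.coeff n a
  map_zero' := by ext; simp
  map_add' f g := by ext; simp

lemma cf1_apply (a : ℂ⟦X⟧) (n : ℕ) : cf1 a n = PowerSeries.coeff n a := rfl

lemma cf1_bijective : Function.Bijective cf1 :=
  ⟨fun _ _ h => PowerSeries.ext fun n => congrFun h n,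
    fun F => ⟨PowerSeries.mk F, funext fun n => PowerSeries.coeff_mk n F⟩⟩

/-- The norm `∑ |a_n| ρ ^ n`. -/
def rNorm (ρ : ℝ≥0) (a : ℂ⟦X⟧) : ℝ≥0∞ := wnorm (fun n => (ρ : ℝ≥0∞) ^ n) (cf1 a)

section rNorm

variable {ρ : ℝ≥0}

lemma rNorm_add_le (a b : ℂ⟦X⟧) : rNorm ρ (a + b) ≤ rNorm ρ a + rNorm ρ b := by
  unfold rNorm
  rw [map_add]
  exact wnorm_add_le _ _ _

lemma rNorm_neg (a : ℂ⟦X⟧) : rNorm ρ (-a) = rNorm ρ a := by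
  simp [rNorm, wnorm]

lemma rNorm_mono {ρ' : ℝ≥0} (h : ρ ≤ ρ') (a : ℂ⟦X⟧) : rNorm ρ a ≤ rNorm ρ' a :=
  wnorm_mono fun n => by gcongr

lemma rNorm_mul_le (a b : ℂ⟦X⟧) : rNorm ρ (a * b) ≤ rNorm ρ a * rNorm ρ b := by
  let G : ℕ × ℕ → ℝ≥0∞ := fun q =>
    (‖cf1 a q.1‖ₑ * (ρ : ℝ≥0∞) ^ q.1) * (‖cf1 b q.2‖ₑ * (ρ : ℝ≥0∞) ^ q.2)
  have hprod : rNorm ρ a * rNorm ρ b = ∑' q, G q := by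
    unfold rNorm wnorm
    rw [← ENNReal.tsum_mul_right, ENNReal.tsum_prod']
    simp_rw [← ENNReal.tsum_mul_left]
    rfl
  rw [hprod, tsum_eq_tsum_antidiagonal]
  refine ENNReal.tsum_le_tsum fun n => ?_
  rw [cf1_apply, PowerSeries.coeff_mul]
  calc _ ≤ (∑ q ∈ Finset.HasAntidiagonal.antidiagonal n, ‖cf1 a q.1‖ₑ * ‖cf1 b q.2‖ₑ) *
        (ρ : ℝ≥0∞) ^ n := by
        gcongr
        refine (enorm_sum_le _ _).trans (Finset.sum_le_sum fun q _ => ?_)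
        rw [enorm_mul]
        rfl
    _ = _ := by
        rw [Finset.sum_mul]
        refine Finset.sum_congr rfl fun q hq => ?_
        rw [Finset.HasAntidiagonal.mem_antidiagonal] at hq
        rw [← hq, pow_add]
        ring

lemma rNorm_X_pow_mul (j : ℕ) (a : ℂ⟦X⟧) :
    rNorm ρ (PowerSeries.X ^ j * a) = (ρ : ℝ≥0∞) ^ j * rNorm ρ a := by
  unfold rNorm wnorm
  rw [← ENNReal.tsum_mul_left, ← (add_left_injective j).tsum_eq]
  · refine tsum_congr fun n => ?_
    rw [cf1_apply, PowerSeries.coeff_X_pow_mul, cf1_apply]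
    simp only [pow_add]
    ring
  · intro n hn
    rw [Function.mem_support, cf1_apply, PowerSeries.coeff_X_pow_mul'] at hn
    have : j ≤ n := by
      by_contra h
      simp [h] at hn
    exact ⟨n - j, Nat.sub_add_cancel this⟩

lemma add_mul_pow_le_pow (η : ℝ≥0) (n : ℕ) :
    ρ ^ (n + 1) + η * ((n + 1 : ℕ) * ρ ^ n) ≤ (ρ + η) ^ (n + 1) := by
  induction n with
  | zero => simp
  | succ n ih =>
    calc ρ ^ (n + 1 + 1) + η * ((n + 1 + 1 : ℕ) * ρ ^ (n + 1))
        ≤ ρ ^ (n + 1 + 1) + η * ((n + 1 + 1 : ℕ) * ρ ^ (n + 1)) +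
          η * (η * ((n + 1 : ℕ) * ρ ^ n)) := le_add_of_nonneg_right (zero_le)
      _ = (ρ + η) * (ρ ^ (n + 1) + η * ((n + 1 : ℕ) * ρ ^ n)) := by
          push_cast
          ring
      _ ≤ (ρ + η) * (ρ + η) ^ (n + 1) := by gcongr
      _ = _ := by ring

lemma mul_rNorm_derivative_le (η : ℝ≥0) (a : ℂ⟦X⟧) :
    η * rNorm ρ (PowerSeries.derivative ℂ a) ≤ rNorm (ρ + η) a := by
  unfold rNorm wnorm
  rw [← ENNReal.tsum_mul_left]
  refine le_trans (ENNReal.tsum_le_tsum fun n => ?_)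
    (ENNReal.tsum_comp_le_tsum_of_injective (add_left_injective 1) _)
  have h : (η : ℝ≥0∞) * ((n + 1 : ℕ) * (ρ : ℝ≥0∞) ^ n) ≤ ((ρ + η : ℝ≥0) : ℝ≥0∞) ^ (n + 1) := by
    have := (le_add_of_nonneg_left (zero_le)).trans (add_mul_pow_le_pow (ρ := ρ) η n)
    exact_mod_cast this
  have hn : ‖((n : ℂ) + 1)‖ₑ = ((n + 1 : ℕ) : ℝ≥0∞) := by
    rw [← Nat.cast_succ, enorm_eq_nnnorm, Complex.nnnorm_natCast]
    simp
  rw [cf1_apply, PowerSeries.coeff_derivative, enorm_mul, hn]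
  calc _ = ‖cf1 a (n + 1)‖ₑ * (η * ((n + 1 : ℕ) * (ρ : ℝ≥0∞) ^ n)) := by
        rw [cf1_apply]; ring
    _ ≤ _ := by gcongr

lemma rNorm_ne_top_of_support {a : ℂ⟦X⟧} (N : ℕ) (h : ∀ n, N ≤ n → PowerSeries.coeff n a = 0) :
    rNorm ρ a ≠ ⊤ := by
  unfold rNorm wnorm
  rw [tsum_eq_sum (s := Finset.range N) fun n hn => by
    rw [cf1_apply, h n (by simpa using hn)]; simp]
  exact (ENNReal.sum_lt_top.2 fun n _ => ENNReal.mul_lt_top (by simp)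
    (ENNReal.pow_lt_top (by simp))).ne

end rNorm

/-- The power series that converge on the open disc of radius `ρ₀`. In contrast to the norm on a
closed disc, convergence on an open disc survives differentiation, so that the disc need not shrink
from one power of `z` to the next. -/
def onDisc (ρ₀ : ℝ≥0) : Subring ℂ⟦X⟧ where
  carrier := {a | ∀ ρ, 0 < ρ → ρ < ρ₀ → rNorm ρ a ≠ ⊤}
  mul_mem' ha hb ρ h h' :=
    ne_top_of_le_ne_top (ENNReal.mul_ne_top (ha ρ h h') (hb ρ h h')) (rNorm_mul_le _ _)
  one_mem' ρ _ _ := rNorm_ne_top_of_support 1 fun n hn => by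
    rw [PowerSeries.coeff_one, if_neg (by omega)]
  add_mem' ha hb ρ h h' :=
    ne_top_of_le_ne_top (ENNReal.add_ne_top.2 ⟨ha ρ h h', hb ρ h h'⟩) (rNorm_add_le _ _)
  zero_mem' ρ _ _ := rNorm_ne_top_of_support 0 fun n hn => by simp
  neg_mem' ha ρ h h' := by rw [rNorm_neg]; exact ha ρ h h'

section onDisc

variable {ρ₀ : ℝ≥0}

lemma coe_mem_onDisc (p : Polynomial ℂ) : (p : ℂ⟦X⟧) ∈ onDisc ρ₀ := fun _ _ _ =>
  rNorm_ne_top_of_support (p.natDegree + 1) fun n hn => by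
    rw [Polynomial.coeff_coe, Polynomial.coeff_eq_zero_of_natDegree_lt (by omega)]

lemma C_mem_onDisc (c : ℂ) : PowerSeries.C c ∈ onDisc ρ₀ := by
  simpa using coe_mem_onDisc (Polynomial.C c)

lemma X_mem_onDisc : (PowerSeries.X : ℂ⟦X⟧) ∈ onDisc ρ₀ := by
  simpa using coe_mem_onDisc (ρ₀ := ρ₀) Polynomial.X

lemma derivative_mem_onDisc {a : ℂ⟦X⟧} (ha : a ∈ onDisc ρ₀) :
    PowerSeries.derivative ℂ a ∈ onDisc ρ₀ := by
  intro ρ h0 h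
  obtain ⟨ρ', h1, h2⟩ := exists_between h
  obtain ⟨η, rfl⟩ := exists_add_of_le h1.le
  intro htop
  have := mul_rNorm_derivative_le (ρ := ρ) η a
  have hη : η ≠ 0 := by
    rintro rfl
    simp at h1
  rw [htop, ENNReal.mul_top (by simpa using hη)] at this
  exact ha _ (h0.trans h1) h2 (top_le_iff.1 this)

lemma of_X_pow_mul_mem_onDisc {j : ℕ} {a : ℂ⟦X⟧} (ha : PowerSeries.X ^ j * a ∈ onDisc ρ₀) :
    a ∈ onDisc ρ₀ := by
  intro ρ h0 h htop
  apply ha ρ h0 h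
  rw [rNorm_X_pow_mul, htop, ENNReal.mul_top]
  exact pow_ne_zero _ (by simpa using h0.ne')

/-- The primitive that vanishes at the origin. -/
def primitive1 : ℂ⟦X⟧ →+ ℂ⟦X⟧ where
  toFun a := PowerSeries.mk fun n => if n = 0 then 0 else PowerSeries.coeff (n - 1) a / n
  map_zero' := by ext; simp
  map_add' a b := by
    ext n
    simp only [PowerSeries.coeff_mk, map_add]
    split_ifs <;> ring

lemma coeff_primitive1 (a : ℂ⟦X⟧) (n : ℕ) : PowerSeries.coeff n (primitive1 a) =
    if n = 0 then 0 else PowerSeries.coeff (n - 1) a / n := by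
  simp only [primitive1, AddMonoidHom.coe_mk, ZeroHom.coe_mk, PowerSeries.coeff_mk]

lemma derivative_primitive1 (a : ℂ⟦X⟧) : PowerSeries.derivative ℂ (primitive1 a) = a := by
  ext n
  have : (n : ℂ) + 1 ≠ 0 := Nat.cast_add_one_ne_zero n
  rw [PowerSeries.coeff_derivative, coeff_primitive1]
  simp [div_mul_cancel₀ _ this]

lemma rNorm_primitive1_le (ρ : ℝ≥0) (a : ℂ⟦X⟧) : rNorm ρ (primitive1 a) ≤ ρ * rNorm ρ a := by
  rw [← pow_one (ρ : ℝ≥0∞), ← rNorm_X_pow_mul]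
  refine wnorm_mono fun n => ?_
  gcongr
  rw [cf1_apply, cf1_apply, coeff_primitive1, pow_one]
  cases n with
  | zero => simp
  | succ n =>
    rw [if_neg (Nat.succ_ne_zero n), PowerSeries.coeff_succ_X_mul, enorm_le_iff_norm_le, norm_div,
      Complex.norm_natCast]
    exact div_le_self (norm_nonneg _) (by norm_cast; omega)

/-- The inverse of the operator `a ↦ k a + 2 t a'`, for `k ≥ 1`. -/
def eulerInv (k : ℕ) : ℂ⟦X⟧ →+ ℂ⟦X⟧ where
  toFun a := PowerSeries.mk fun n => PowerSeries.coeff n a / (k + 2 * n : ℕ)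
  map_zero' := by ext; simp
  map_add' a b := by
    ext n
    simp only [PowerSeries.coeff_mk, map_add]
    ring

lemma coeff_eulerInv (k : ℕ) (a : ℂ⟦X⟧) (n : ℕ) : PowerSeries.coeff n (eulerInv k a) =
    PowerSeries.coeff n a / (k + 2 * n : ℕ) := by
  simp only [eulerInv, AddMonoidHom.coe_mk, ZeroHom.coe_mk, PowerSeries.coeff_mk]

lemma coeff_euler (a : ℂ⟦X⟧) (n : ℕ) :
    PowerSeries.coeff n (PowerSeries.X * PowerSeries.derivative ℂ a) =
      n * PowerSeries.coeff n a := by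
  cases n with
  | zero => simp
  | succ n =>
    rw [PowerSeries.coeff_succ_X_mul, PowerSeries.coeff_derivative]
    push_cast
    ring

lemma euler_eulerInv {k : ℕ} (hk : 1 ≤ k) (a : ℂ⟦X⟧) :
    (k : ℂ⟦X⟧) * eulerInv k a +
      2 * (PowerSeries.X * PowerSeries.derivative ℂ (eulerInv k a)) = a := by
  ext n
  have h2 : (2 : ℂ⟦X⟧) = PowerSeries.C 2 := (map_ofNat PowerSeries.C 2).symm
  have hk' : (k : ℂ⟦X⟧) = PowerSeries.C (k : ℂ) := by simp
  have : ((k + 2 * n : ℕ) : ℂ) ≠ 0 := by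
    rw [Nat.cast_ne_zero]; omega
  rw [map_add, h2, hk', PowerSeries.coeff_C_mul, PowerSeries.coeff_C_mul, coeff_euler,
    coeff_eulerInv]
  field_simp
  push_cast
  ring

lemma rNorm_eulerInv_le {k : ℕ} (hk : 1 ≤ k) (ρ : ℝ≥0) (a : ℂ⟦X⟧) :
    rNorm ρ (eulerInv k a) ≤ rNorm ρ a := by
  refine wnorm_mono fun n => ?_
  gcongr
  rw [cf1_apply, cf1_apply, coeff_eulerInv, enorm_le_iff_norm_le, norm_div, Complex.norm_natCast]
  exact div_le_self (norm_nonneg _) (by norm_cast; omega)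

lemma coeff_mul_eq_zero {a b : ℂ⟦X⟧} {j : ℕ} (hb : ∀ n < j, PowerSeries.coeff n b = 0) :
    ∀ n < j, PowerSeries.coeff n (a * b) = 0 := by
  intro n hn
  rw [PowerSeries.coeff_mul]
  refine Finset.sum_eq_zero fun q hq => ?_
  rw [Finset.HasAntidiagonal.mem_antidiagonal] at hq
  rw [hb q.2 (by omega), mul_zero]

/-- The linear system `2 p' = t ^ (k - 1) h r + H`, `k r + 2 t r' = h p + G` with a regular
singular point at the origin. Its residue has no eigenvalue in the natural numbers other than `0`,
hence there is a solution for every value `p(0)`. It converges where the data do, if that disc is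
small compared with `h`; the condition `hsmall` does not involve `G` and `H`. -/
theorem exists_singular_system {k : ℕ} (hk : 1 ≤ k) {h G H : ℂ⟦X⟧} (hh : h ∈ onDisc ρ₀)
    (hG : G ∈ onDisc ρ₀) (hH : H ∈ onDisc ρ₀) (c : ℂ)
    (hsmall : ∀ ρ, 0 < ρ → ρ < ρ₀ → (ρ : ℝ≥0∞) ^ k * (rNorm ρ h * rNorm ρ h) ≤ 1) :
    ∃ p ∈ onDisc ρ₀, ∃ r ∈ onDisc ρ₀, PowerSeries.constantCoeff p = c ∧
      2 * PowerSeries.derivative ℂ p = PowerSeries.X ^ (k - 1) * h * r + H ∧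
      (k : ℂ⟦X⟧) * r + 2 * (PowerSeries.X * PowerSeries.derivative ℂ r) = h * p + G := by
  have eulerInv_mem : ∀ {a : ℂ⟦X⟧}, a ∈ onDisc ρ₀ → eulerInv k a ∈ onDisc ρ₀ := fun ha ρ h h' =>
    ne_top_of_le_ne_top (ha ρ h h') (rNorm_eulerInv_le hk ρ _)
  have prim_mem : ∀ {a : ℂ⟦X⟧}, a ∈ onDisc ρ₀ → primitive1 a ∈ onDisc ρ₀ := fun ha ρ h h' =>
    ne_top_of_le_ne_top (ENNReal.mul_ne_top (by simp) (ha ρ h h')) (rNorm_primitive1_le ρ _)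
  -- The second equation is solved for `r`, and the result is inserted into the first.
  let L : ℂ⟦X⟧ →+ ℂ⟦X⟧ := (AddMonoidHom.mulLeft (PowerSeries.C (2⁻¹ : ℂ))).comp
    (primitive1.comp ((AddMonoidHom.mulLeft (PowerSeries.X ^ (k - 1) * h)).comp
      ((eulerInv k).comp (AddMonoidHom.mulLeft h))))
  have hLdef : ∀ p, L p = PowerSeries.C (2⁻¹ : ℂ) *
      primitive1 (PowerSeries.X ^ (k - 1) * h * eulerInv k (h * p)) := fun p => rfl
  have hL : RaisesGrading cf1 id L := by
    intro j x hx n hn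
    replace hx : ∀ n < j, PowerSeries.coeff n x = 0 := hx
    replace hn : n < j + 1 := hn
    have h1 : ∀ n < j, PowerSeries.coeff n (eulerInv k (h * x)) = 0 := fun n hn => by
      rw [coeff_eulerInv, coeff_mul_eq_zero hx n hn, zero_div]
    rw [cf1_apply, hLdef, PowerSeries.coeff_C_mul, coeff_primitive1]
    split_ifs with h0
    · rw [mul_zero]
    · rw [coeff_mul_eq_zero h1 _ (by omega), zero_div, mul_zero]
  have hhalf : ‖(2⁻¹ : ℂ)‖ₑ = 2⁻¹ := by
    rw [enorm_inv (by norm_num)]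
    congr 1
    rw [enorm_eq_nnnorm]
    simp
  have hC : ∀ (c : ℂ) (ρ : ℝ≥0) (a : ℂ⟦X⟧), rNorm ρ (PowerSeries.C c * a) = ‖c‖ₑ * rNorm ρ a := by
    intro c ρ a
    unfold rNorm wnorm
    rw [← ENNReal.tsum_mul_left]
    refine tsum_congr fun n => ?_
    rw [cf1_apply, PowerSeries.coeff_C_mul, enorm_mul, cf1_apply, mul_assoc]
  let a : ℂ⟦X⟧ := PowerSeries.C c + PowerSeries.C (2⁻¹ : ℂ) *
    primitive1 (PowerSeries.X ^ (k - 1) * h * eulerInv k G + H)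
  have ha : a ∈ onDisc ρ₀ := add_mem (C_mem_onDisc c) (Subring.mul_mem _ (C_mem_onDisc _) (prim_mem
    (add_mem (Subring.mul_mem _ (Subring.mul_mem _ (Subring.pow_mem _ X_mem_onDisc _) hh)
      (eulerInv_mem hG)) hH)))
  obtain ⟨p, hp, hbound⟩ := hL.exists_fixedPoint cf1_bijective a
  have hpmem : p ∈ onDisc ρ₀ := by
    intro ρ h0 h1
    refine ne_top_of_le_ne_top (ENNReal.mul_ne_top (by simp) (ha ρ h0 h1)) (hbound _ fun y => ?_)
    change rNorm ρ (L y) ≤ 2⁻¹ * rNorm ρ y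
    rw [hLdef, hC, hhalf]
    gcongr
    calc _ ≤ ρ * rNorm ρ (PowerSeries.X ^ (k - 1) * (h * eulerInv k (h * y))) := by
          rw [← mul_assoc]
          exact rNorm_primitive1_le ρ _
      _ ≤ ρ * ((ρ : ℝ≥0∞) ^ (k - 1) * (rNorm ρ h * (rNorm ρ h * rNorm ρ y))) := by
          rw [rNorm_X_pow_mul]
          gcongr
          refine (rNorm_mul_le _ _).trans ?_
          gcongr
          exact (rNorm_eulerInv_le hk ρ _).trans (rNorm_mul_le _ _)
      _ = ((ρ : ℝ≥0∞) ^ k * (rNorm ρ h * rNorm ρ h)) * rNorm ρ y := by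
          obtain ⟨j, rfl⟩ := Nat.exists_eq_add_of_le' hk
          rw [Nat.add_sub_cancel, pow_succ]
          ring
      _ ≤ 1 * rNorm ρ y := by gcongr; exact hsmall ρ h0 h1
      _ = _ := one_mul _
  have hp' : p = PowerSeries.C c + PowerSeries.C (2⁻¹ : ℂ) *
      primitive1 (PowerSeries.X ^ (k - 1) * h * eulerInv k (h * p + G) + H) := by
    conv_lhs => rw [hp, hLdef]
    simp only [a, map_add, mul_add]
    ring
  refine ⟨p, hpmem, eulerInv k (h * p + G), eulerInv_mem (add_mem (Subring.mul_mem _ hh hpmem) hG),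
    ?_, ?_, euler_eulerInv hk _⟩
  · rw [hp', map_add, map_mul, PowerSeries.constantCoeff_C,
      ← PowerSeries.coeff_zero_eq_constantCoeff_apply,
      ← PowerSeries.coeff_zero_eq_constantCoeff_apply,
      coeff_primitive1, if_pos rfl, mul_zero, add_zero]
  · conv_lhs => rw [hp']
    have h2 : (2 : ℂ⟦X⟧) * PowerSeries.C (2⁻¹ : ℂ) = 1 := by
      have : (2 : ℂ⟦X⟧) = PowerSeries.C 2 := (map_ofNat PowerSeries.C 2).symm
      rw [this, ← map_mul]
      simp
    rw [map_add, PowerSeries.derivative_C, zero_add, Derivation.leibniz, PowerSeries.derivative_C,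
      derivative_primitive1, smul_zero, add_zero, smul_eq_mul, ← mul_assoc, h2, one_mul]

end onDisc

/-! ### Recursive solution of the gauge equations -/

/-- A sequence can be built from one choice per step, if every choice only depends on the
preceding terms. -/
lemma exists_seq {E : Type*} [Zero E] (Q : ℕ → (ℕ → E) → E → Prop)
    (hcongr : ∀ n x x' y, (∀ i < n, x i = x' i) → Q n x y → Q n x' y)
    (hex : ∀ n x, (∀ i < n, Q i x (x i)) → ∃ y, Q n x y) : ∃ x, ∀ n, Q n x (x n) := by
  classical
  -- Well-founded recursion on initial segments, which are extended by zero.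
  let ext : (n : ℕ) → ((i : ℕ) → i < n → E) → ℕ → E := fun n u i => if h : i < n then u i h else 0
  let F : (n : ℕ) → ((i : ℕ) → i < n → E) → E := fun n u =>
    if h : ∃ y, Q n (ext n u) y then h.choose else 0
  let x : ℕ → E := Nat.lt_wfRel.wf.fix F
  have hx : ∀ n, x n = F n fun i _ => x i := fun n => Nat.lt_wfRel.wf.fix_eq F n
  refine ⟨x, fun n => ?_⟩
  induction n using Nat.strong_induction_on with
  | _ n ih =>
    have hagree : ∀ i < n, x i = ext n (fun i _ => x i) i := fun i hi => by simp [ext, hi]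
    obtain ⟨y, hy⟩ := hex n x ih
    have h : ∃ y, Q n (ext n fun i _ => x i) y := ⟨y, hcongr n x _ y hagree hy⟩
    have hxn : x n = h.choose := by rw [hx n]; simp only [F]; rw [dif_pos h]
    refine hcongr n _ x _ (fun i hi => (hagree i hi).symm) ?_
    rw [hxn]
    exact h.choose_spec

/-- The coefficient of `z ^ n` in the product of two series in `z`. -/
def cauchy {S : Type*} [Semiring S] (u v : ℕ → S) (n : ℕ) : S :=
  ∑ q ∈ Finset.HasAntidiagonal.antidiagonal n, u q.1 * v q.2

/-- The coefficient of `z ^ n` in the product of a series with `z`. -/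
def prev {S : Type*} [Zero S] (u : ℕ → S) : ℕ → S
  | 0 => 0
  | n + 1 => u n

lemma prev_congr {S : Type*} [Zero S] {u v : ℕ → S} {n : ℕ} (h : ∀ i < n, u i = v i) :
    prev u n = prev v n := by
  cases n with
  | zero => rfl
  | succ n => exact h n n.lt_succ_self

lemma cauchy_zero {S : Type*} [Semiring S] (u v : ℕ → S) : cauchy u v 0 = u 0 * v 0 := by
  simp [cauchy]

lemma cauchy_congr {S : Type*} [Semiring S] {u v u' v' : ℕ → S} {n : ℕ}
    (hu : ∀ i ≤ n, u i = u' i) (hv : ∀ i ≤ n, v i = v' i) : cauchy u v n = cauchy u' v' n := by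
  refine Finset.sum_congr rfl fun q hq => ?_
  rw [Finset.HasAntidiagonal.mem_antidiagonal] at hq
  rw [hu _ (by omega), hv _ (by omega)]

/-- The two extreme terms of a Cauchy product are split off. -/
lemma cauchy_succ_eq {S : Type*} [CommRing S] (u v : ℕ → S) (n : ℕ) :
    cauchy u v (n + 1) = cauchy (fun i => if i < n + 1 then u i else 0)
      (fun i => if i < n + 1 then v i else 0) (n + 1) + u 0 * v (n + 1) + u (n + 1) * v 0 := by
  have h1 : ∑ q ∈ Finset.HasAntidiagonal.antidiagonal (n + 1),
      (if q.1 < n + 1 then u q.1 else 0) * (v q.2 - if q.2 < n + 1 then v q.2 else 0) =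
      u 0 * v (n + 1) := by
    rw [Finset.sum_eq_single (0, n + 1)]
    · simp
    · intro q hq hne
      rw [Finset.HasAntidiagonal.mem_antidiagonal] at hq
      have : q.2 < n + 1 := by
        by_contra h
        exact hne (Prod.ext (by simp only; omega) (by simp only; omega))
      simp [this]
    · intro h
      exact absurd (Finset.HasAntidiagonal.mem_antidiagonal.2 (zero_add _)) h
  have h2 : ∑ q ∈ Finset.HasAntidiagonal.antidiagonal (n + 1),
      (u q.1 - if q.1 < n + 1 then u q.1 else 0) * v q.2 = u (n + 1) * v 0 := by
    rw [Finset.sum_eq_single (n + 1, 0)]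
    · simp
    · intro q hq hne
      rw [Finset.HasAntidiagonal.mem_antidiagonal] at hq
      have : q.1 < n + 1 := by
        by_contra h
        exact hne (Prod.ext (by simp only; omega) (by simp only; omega))
      simp [this]
    · intro h
      exact absurd (Finset.HasAntidiagonal.mem_antidiagonal.2 (add_zero _)) h
  rw [← h1, ← h2, cauchy, cauchy, ← Finset.sum_add_distrib, ← Finset.sum_add_distrib]
  exact Finset.sum_congr rfl fun q _ => by ring

lemma X_pow_dvd_trunc_sub (n : ℕ) (w : ℂ⟦X⟧) :
    PowerSeries.X ^ n ∣ ((PowerSeries.trunc n w : Polynomial ℂ) : ℂ⟦X⟧) - w := by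
  rw [PowerSeries.X_pow_dvd_iff]
  intro j hj
  rw [map_sub, Polynomial.coeff_coe, PowerSeries.coeff_trunc, if_pos hj, sub_self]

/-- The equations for the coefficients of `z ^ n` in
`R δ = 2 P' + z R''` and `P δ = a (κ R + 2 t R') + z (φ' R + 2 φ R' + P'')`, where
`P = ∑ u n z ^ n`, `R = ∑ v n z ^ n`, `δ = ∑ (w n - φ n) z ^ n`, and `d` is the derivative. -/
def CoeffEq {S : Type*} [CommRing S] (d : S → S) (a κ t : S) (φ u v w : ℕ → S) (n : ℕ) : Prop :=
  cauchy v (fun i => w i - φ i) n = 2 * d (u n) + prev (fun i => d (d (v i))) n ∧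
  cauchy u (fun i => w i - φ i) n = a * (κ * v n + 2 * (t * d (v n))) +
    prev (fun i => cauchy (fun j => d (φ j)) v i + 2 * cauchy φ (fun j => d (v j)) i +
      d (d (u i))) n

/-- `CoeffEq` only involves the terms of index at most `n`. -/
lemma CoeffEq.congr {S : Type*} [CommRing S] {d : S → S} {a κ t : S} {φ u v w u' v' w' : ℕ → S}
    {n : ℕ} (hu : ∀ i ≤ n, u i = u' i) (hv : ∀ i ≤ n, v i = v' i) (hw : ∀ i ≤ n, w i = w' i)
    (h : CoeffEq d a κ t φ u v w n) : CoeffEq d a κ t φ u' v' w' n := by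
  have hδ : ∀ i ≤ n, w i - φ i = w' i - φ i := fun i hi => by rw [hw i hi]
  obtain ⟨h1, h2⟩ := h
  rw [cauchy_congr hv hδ, hu n le_rfl, prev_congr (v := fun i => d (d (v' i)))
    fun i hi => by rw [hv i hi.le]] at h1
  rw [cauchy_congr hu hδ, hv n le_rfl, prev_congr (v := fun i => cauchy (fun j => d (φ j)) v' i +
    2 * cauchy φ (fun j => d (v' j)) i + d (d (u' i))) fun i hi => ?_] at h2
  · exact ⟨h1, h2⟩
  · have e1 := cauchy_congr (u := fun j => d (φ j)) (fun _ _ => rfl)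
      fun j hj => hv j (hj.trans hi.le)
    have e2 := cauchy_congr (u := φ) (v' := fun j => d (v' j)) (fun _ _ => rfl)
      fun j hj => congrArg d (hv j (hj.trans hi.le))
    rw [hu i hi.le, e1, e2]

section recursion

variable {ρ₀ : ℝ≥0} {k : ℕ}

local notation "D" => PowerSeries.derivative ℂ

/-- The equations for one coefficient in `z`, given the preceding ones: the polynomial `l` is chosen
such that the inhomogeneous part of the second equation is divisible by `t ^ (k - 1)`. -/
lemma exists_recursion_step (hk : 1 ≤ k) {h p₀ r₀ φ U V : ℂ⟦X⟧} (hh : h ∈ onDisc ρ₀)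
    (hp₀ : p₀ ∈ onDisc ρ₀) (hr₀ : r₀ ∈ onDisc ρ₀) (hφ : φ ∈ onDisc ρ₀) (hU : U ∈ onDisc ρ₀)
    (hV : V ∈ onDisc ρ₀) (h1 : PowerSeries.constantCoeff p₀ = 1)
    (hsmall : ∀ ρ, 0 < ρ → ρ < ρ₀ → (ρ : ℝ≥0∞) ^ k * (rNorm ρ h * rNorm ρ h) ≤ 1) :
    ∃ p ∈ onDisc ρ₀, ∃ r ∈ onDisc ρ₀, ∃ l : Polynomial ℂ, (∀ j, k - 1 ≤ j → l.coeff j = 0) ∧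
      U + r₀ * ((l : ℂ⟦X⟧) - φ) + r * (PowerSeries.X ^ (k - 1) * h) = 2 * D p ∧
      V + p₀ * ((l : ℂ⟦X⟧) - φ) + p * (PowerSeries.X ^ (k - 1) * h) =
        PowerSeries.X ^ (k - 1) * ((k : ℂ⟦X⟧) * r + 2 * (PowerSeries.X * D r)) := by
  have hinv : p₀ * p₀⁻¹ = 1 := PowerSeries.mul_inv_cancel _ (by rw [h1]; exact one_ne_zero)
  obtain ⟨e, he⟩ := X_pow_dvd_trunc_sub (k - 1) (φ - p₀⁻¹ * V)
  set l := PowerSeries.trunc (k - 1) (φ - p₀⁻¹ * V) with hl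
  have hG : V + p₀ * ((l : ℂ⟦X⟧) - φ) = PowerSeries.X ^ (k - 1) * (p₀ * e) := by
    linear_combination p₀ * he - V * hinv
  have hl_mem : (l : ℂ⟦X⟧) - φ ∈ onDisc ρ₀ := sub_mem (coe_mem_onDisc l) hφ
  have hGmem : p₀ * e ∈ onDisc ρ₀ := of_X_pow_mul_mem_onDisc (j := k - 1) (by
    rw [← hG]
    exact add_mem hV (Subring.mul_mem _ hp₀ hl_mem))
  obtain ⟨p, hp, r, hr, -, e1, e2⟩ := exists_singular_system hk hh hGmem
    (add_mem hU (Subring.mul_mem _ hr₀ hl_mem)) 0 hsmall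
  refine ⟨p, hp, r, hr, l, fun j hj => ?_, ?_, ?_⟩
  · rw [hl, PowerSeries.coeff_trunc, if_neg (by omega)]
  · rw [e1]; ring
  · rw [e2, hG]; ring

/-- `CoeffEq` for power series in one variable `t`, with `a = t ^ (k - 1)` and `κ = k`. The term
`x n` consists of the coefficients of `z ^ n` in `P`, `R` and the new `f`. -/
def GaugeEq (k : ℕ) (φ : ℕ → ℂ⟦X⟧) (x : ℕ → ℂ⟦X⟧ × ℂ⟦X⟧ × Polynomial ℂ) (n : ℕ) : Prop :=
  CoeffEq (fun p => D p) (PowerSeries.X ^ (k - 1)) (k : ℂ⟦X⟧) PowerSeries.X φ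
    (fun i => (x i).1) (fun i => (x i).2.1) (fun i => ((x i).2.2 : ℂ⟦X⟧)) n

lemma GaugeEq.congr {φ : ℕ → ℂ⟦X⟧} {x x' : ℕ → ℂ⟦X⟧ × ℂ⟦X⟧ × Polynomial ℂ} {n : ℕ}
    (hx : ∀ i ≤ n, x i = x' i) (h : GaugeEq k φ x n) : GaugeEq k φ x' n :=
  CoeffEq.congr (fun i hi => by rw [hx i hi]) (fun i hi => by rw [hx i hi])
    (fun i hi => by rw [hx i hi]) h

lemma two_mem_onDisc : (2 : ℂ⟦X⟧) ∈ onDisc ρ₀ := by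
  rw [← one_add_one_eq_two]
  exact add_mem (one_mem _) (one_mem _)

lemma cauchy_mem {u v : ℕ → ℂ⟦X⟧} {n : ℕ} (hu : ∀ i ≤ n, u i ∈ onDisc ρ₀)
    (hv : ∀ i ≤ n, v i ∈ onDisc ρ₀) : cauchy u v n ∈ onDisc ρ₀ :=
  Subring.sum_mem _ fun q hq => by
    rw [Finset.HasAntidiagonal.mem_antidiagonal] at hq
    exact Subring.mul_mem _ (hu _ (by omega)) (hv _ (by omega))

/-- Every `f = ∑ φ n z ^ n` is gauge equivalent to one whose coefficients are polynomials of degree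
`< k - 1`, and the coefficients of the gauge transformation converge on a common disc. -/
theorem exists_reduction (hk : 1 ≤ k) {ρ₁ : ℝ≥0} (hρ₁ : 0 < ρ₁) (φ : ℕ → ℂ⟦X⟧)
    (hφ₁ : ∀ n, φ n ∈ onDisc ρ₁) :
    ∃ ρ₀ : ℝ≥0, 0 < ρ₀ ∧ ρ₀ ≤ ρ₁ ∧ ∃ x : ℕ → ℂ⟦X⟧ × ℂ⟦X⟧ × Polynomial ℂ,
      PowerSeries.constantCoeff (x 0).1 = 1 ∧ ∀ n, (x n).1 ∈ onDisc ρ₀ ∧ (x n).2.1 ∈ onDisc ρ₀ ∧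
        (∀ j, k - 1 ≤ j → (x n).2.2.coeff j = 0) ∧ GaugeEq k φ x n := by
  obtain ⟨h, hh⟩ := X_pow_dvd_trunc_sub (k - 1) (φ 0)
  set l₀ := PowerSeries.trunc (k - 1) (φ 0) with hl₀
  have hh₁ : h ∈ onDisc ρ₁ := of_X_pow_mul_mem_onDisc (j := k - 1) (by
    rw [← hh]
    exact sub_mem (coe_mem_onDisc _) (hφ₁ 0))
  have hfin : rNorm (ρ₁ / 2) h * rNorm (ρ₁ / 2) h ≠ ⊤ := by
    have := hh₁ (ρ₁ / 2) (by positivity) (NNReal.half_lt_self hρ₁.ne')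
    exact ENNReal.mul_ne_top this this
  obtain ⟨ε, hε, hε1, hεh⟩ := exists_small_mul_le hfin
  -- The radius only depends on `h`, that is, on `φ 0`, and serves for all coefficients.
  let ρ₀ := min ε (ρ₁ / 2)
  have hρ₀ : ρ₀ ≤ ρ₁ := (min_le_right _ _).trans (NNReal.half_le_self ρ₁)
  have hmem : ∀ {a : ℂ⟦X⟧}, a ∈ onDisc ρ₁ → a ∈ onDisc ρ₀ := fun ha ρ h h' =>
    ha ρ h (h'.trans_le hρ₀)
  have hsmall : ∀ ρ, 0 < ρ → ρ < ρ₀ → (ρ : ℝ≥0∞) ^ k * (rNorm ρ h * rNorm ρ h) ≤ 1 := by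
    intro ρ _ hlt
    have h1 : ρ ≤ ε := hlt.le.trans (min_le_left _ _)
    have h2 : ρ ≤ ρ₁ / 2 := hlt.le.trans (min_le_right _ _)
    have h3 : (ρ : ℝ≥0∞) ^ k ≤ ε := by
      have : ρ ^ k ≤ ε := (pow_le_of_le_one (zero_le) (h1.trans hε1) (by omega)).trans h1
      exact_mod_cast this
    calc _ ≤ (ε : ℝ≥0∞) * (rNorm (ρ₁ / 2) h * rNorm (ρ₁ / 2) h) := by
          gcongr <;> exact rNorm_mono h2 h
      _ ≤ 2⁻¹ := hεh
      _ ≤ 1 := by rw [ENNReal.inv_le_one]; norm_num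
  -- `upd n x y` is the sequence `x` with the `n`-th term (and all later ones) replaced by `y`.
  let upd : ℕ → (ℕ → ℂ⟦X⟧ × ℂ⟦X⟧ × Polynomial ℂ) → (ℂ⟦X⟧ × ℂ⟦X⟧ × Polynomial ℂ) →
      ℕ → ℂ⟦X⟧ × ℂ⟦X⟧ × Polynomial ℂ := fun n x y i => if i < n then x i else y
  obtain ⟨x, hx⟩ := exists_seq (E := ℂ⟦X⟧ × ℂ⟦X⟧ × Polynomial ℂ)
    (fun n x y => y.1 ∈ onDisc ρ₀ ∧ y.2.1 ∈ onDisc ρ₀ ∧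
      (∀ j, k - 1 ≤ j → y.2.2.coeff j = 0) ∧
      (n = 0 → PowerSeries.constantCoeff y.1 = 1 ∧ y.2.2 = l₀) ∧ GaugeEq k φ (upd n x y) n)
    (fun n x x' y hxx' => by
      have : upd n x y = upd n x' y := funext fun i => by
        simp only [upd]
        split_ifs with hi
        exacts [hxx' i hi, rfl]
      rw [this]
      exact id)
    (fun n x hx => by
      cases n with
      | zero =>
        obtain ⟨p, hp, r, hr, h1, e1, e2⟩ := exists_singular_system hk (hmem hh₁)
          (zero_mem (onDisc ρ₀)) (zero_mem (onDisc ρ₀)) 1 hsmall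
        refine ⟨(p, r, l₀), hp, hr, fun j hj => ?_, fun _ => ⟨h1, rfl⟩, ?_, ?_⟩
        · simp only [hl₀]
          rw [PowerSeries.coeff_trunc, if_neg (by omega)]
        · rw [cauchy_zero]
          simp only [upd, lt_irrefl, if_false, prev]
          rw [hh, e1]
          ring
        · rw [cauchy_zero]
          simp only [upd, lt_irrefl, if_false, prev]
          rw [hh, e2]
          ring
      | succ n =>
        obtain ⟨hp₀, hr₀, -, h0, -⟩ := hx 0 (by omega)
        obtain ⟨h1, hl⟩ := h0 rfl
        have hpO : ∀ i ≤ n + 1, (if i < n + 1 then (x i).1 else 0) ∈ onDisc ρ₀ := fun i _ => by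
          split_ifs with hi
          exacts [(hx i hi).1, zero_mem _]
        have hrO : ∀ i ≤ n + 1, (if i < n + 1 then (x i).2.1 else 0) ∈ onDisc ρ₀ := fun i _ => by
          split_ifs with hi
          exacts [(hx i hi).2.1, zero_mem _]
        have hdO : ∀ i ≤ n + 1,
            (if i < n + 1 then ((x i).2.2 : ℂ⟦X⟧) - φ i else 0) ∈ onDisc ρ₀ := fun i _ => by
          split_ifs with hi
          exacts [sub_mem (coe_mem_onDisc _) (hmem (hφ₁ i)), zero_mem _]
        have hU := sub_mem (cauchy_mem hrO hdO)
          (derivative_mem_onDisc (derivative_mem_onDisc (hx n (by omega)).2.1))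
        have hV := sub_mem (cauchy_mem hpO hdO) (add_mem (add_mem
          (cauchy_mem (n := n) (u := fun j => D (φ j)) (v := fun j => (x j).2.1)
            (fun i _ => derivative_mem_onDisc (hmem (hφ₁ i))) (fun i hi => (hx i (by omega)).2.1))
          (Subring.mul_mem _ two_mem_onDisc
            (cauchy_mem (n := n) (u := φ) (v := fun j => D (x j).2.1)
            (fun i _ => (hmem (hφ₁ i))) (fun i hi => derivative_mem_onDisc (hx i (by omega)).2.1))))
          (derivative_mem_onDisc (derivative_mem_onDisc (hx n (by omega)).1)))
        obtain ⟨p, hp, r, hr, l, hl', e1, e2⟩ := exists_recursion_step hk (hmem hh₁) hp₀ hr₀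
          (hmem (hφ₁ (n + 1))) hU hV h1 hsmall
        refine ⟨(p, r, l), hp, hr, hl', fun h => absurd h (Nat.succ_ne_zero n), ?_, ?_⟩
        · have c1 : cauchy (fun i => if i < n + 1 then (upd (n + 1) x (p, r, l) i).2.1 else 0)
              (fun i => if i < n + 1 then ((upd (n + 1) x (p, r, l) i).2.2 : ℂ⟦X⟧) - φ i else 0)
              (n + 1) = cauchy (fun i => if i < n + 1 then (x i).2.1 else 0)
              (fun i => if i < n + 1 then ((x i).2.2 : ℂ⟦X⟧) - φ i else 0) (n + 1) :=
            cauchy_congr (fun i _ => by simp only [upd]; split_ifs <;> rfl)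
              (fun i _ => by simp only [upd]; split_ifs <;> rfl)
          rw [cauchy_succ_eq, c1]
          simp only [upd, lt_irrefl, if_false, prev, Nat.succ_pos, if_true, Nat.lt_succ_self]
          rw [hl, hh]
          linear_combination e1
        · have c1 : cauchy (fun i => if i < n + 1 then (upd (n + 1) x (p, r, l) i).1 else 0)
              (fun i => if i < n + 1 then ((upd (n + 1) x (p, r, l) i).2.2 : ℂ⟦X⟧) - φ i else 0)
              (n + 1) = cauchy (fun i => if i < n + 1 then (x i).1 else 0)
              (fun i => if i < n + 1 then ((x i).2.2 : ℂ⟦X⟧) - φ i else 0) (n + 1) :=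
            cauchy_congr (fun i _ => by simp only [upd]; split_ifs <;> rfl)
              (fun i _ => by simp only [upd]; split_ifs <;> rfl)
          have c3 : cauchy (fun j => D (φ j)) (fun j => (upd (n + 1) x (p, r, l) j).2.1) n =
              cauchy (fun j => D (φ j)) (fun j => (x j).2.1) n :=
            cauchy_congr (fun i _ => rfl)
              (fun i hi => by simp only [upd]; rw [if_pos (Nat.lt_succ_of_le hi)])
          have c4 : cauchy φ (fun j => D (upd (n + 1) x (p, r, l) j).2.1) n =
              cauchy φ (fun j => D (x j).2.1) n :=
            cauchy_congr (fun i _ => rfl)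
              (fun i hi => by simp only [upd]; rw [if_pos (Nat.lt_succ_of_le hi)])
          simp only [prev]
          rw [cauchy_succ_eq, c1, c3, c4]
          simp only [upd, lt_irrefl, if_false, Nat.succ_pos, if_true, Nat.lt_succ_self]
          rw [hl, hh]
          linear_combination e2)
  refine ⟨ρ₀, lt_min hε (by positivity), hρ₀, x, ((hx 0).2.2.2.1 rfl).1, fun n =>
    ⟨(hx n).1, (hx n).2.1, (hx n).2.2.1, ?_⟩⟩
  refine GaugeEq.congr (fun i hi => ?_) (hx n).2.2.2.2
  simp only [upd]
  split_ifs with h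
  · rfl
  · rw [show i = n by omega]

end recursion

/-! ### Series that do not depend on `t_1` -/

/-- The inclusion of the power series in one variable as series in `t_2`. -/
def inT2 : ℂ⟦X⟧ →ₐ[ℂ] SeriesT 2 := PowerSeries.substAlgHom (PowerSeries.HasSubst.X (1 : Fin 2))

lemma eq_single_iff (e : Fin 2 →₀ ℕ) : e = Finsupp.single 1 (e 1) ↔ e 0 = 0 := by
  constructor
  · intro h
    rw [h]
    simp
  · intro h
    ext i
    fin_cases i
    · simpa using h
    · simp

lemma coeff_inT2 (a : ℂ⟦X⟧) (e : Fin 2 →₀ ℕ) : MvPowerSeries.coeff e (inT2 a) =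
    if e 0 = 0 then PowerSeries.coeff (e 1) a else 0 := by
  rw [inT2, PowerSeries.coe_substAlgHom, PowerSeries.coeff_subst_single]
  simp only [eq_single_iff]

lemma inT2_X : inT2 PowerSeries.X = t2 := PowerSeries.substAlgHom_X _

lemma inT2_coe (p : Polynomial ℂ) : inT2 (p : ℂ⟦X⟧) = Polynomial.aeval t2 p :=
  PowerSeries.substAlgHom_coe _ p

lemma pderiv_zero_inT2 (a : ℂ⟦X⟧) : MvPowerSeries.pderiv (R := ℂ) 0 (inT2 a) = 0 := by
  ext e
  rw [MvPowerSeries.coeff_pderiv, coeff_inT2, if_neg (by simp), zero_mul, map_zero]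

lemma pderiv_one_inT2 (a : ℂ⟦X⟧) :
    MvPowerSeries.pderiv (R := ℂ) 1 (inT2 a) = inT2 (PowerSeries.derivative ℂ a) := by
  ext e
  rw [MvPowerSeries.coeff_pderiv, coeff_inT2, coeff_inT2]
  simp only [Finsupp.add_apply, Finsupp.single_eq_same,
    PowerSeries.coeff_derivative]
  by_cases h : e 0 = 0 <;> simp [h]

lemma exists_eq_inT2 {a : SeriesT 2} (ha : MvPowerSeries.pderiv (R := ℂ) 0 a = 0) :
    ∃ b, a = inT2 b := by
  refine ⟨PowerSeries.mk fun n => MvPowerSeries.coeff (Finsupp.single 1 n) a, ?_⟩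
  ext e
  rw [coeff_inT2]
  split_ifs with h
  · rw [PowerSeries.coeff_mk, ← (eq_single_iff e).2 h]
  · have hle : Finsupp.single 0 1 ≤ e := by
      rw [Finsupp.single_le_iff]; omega
    have := MvPowerSeries.ext_iff.1 ha (e - Finsupp.single 0 1)
    rw [MvPowerSeries.coeff_pderiv, tsub_add_cancel_of_le hle,
      map_zero (MvPowerSeries.coeff (R := ℂ) _), mul_eq_zero] at this
    exact this.resolve_right (Nat.cast_add_one_ne_zero _)

lemma convergesOn_inT2 (ρ : ℝ≥0) (a : ℂ⟦X⟧) : ConvergesOn ρ (inT2 a) ↔ rNorm ρ a ≠ ⊤ := by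
  rw [convergesOn_iff]
  have h : wnorm (fun e : Fin 2 →₀ ℕ => (ρ : ℝ≥0∞) ^ e.degree)
      (fun e => MvPowerSeries.coeff e (inT2 a)) = rNorm ρ a := by
    unfold rNorm wnorm
    rw [← (Finsupp.single_injective (1 : Fin 2)).tsum_eq]
    · refine tsum_congr fun n => ?_
      simp [cf1_apply, coeff_inT2]
    · intro e he
      simp only [Function.mem_support, coeff_inT2] at he
      by_contra hne
      rw [if_neg fun h => hne ⟨e 1, ((eq_single_iff e).2 h).symm⟩] at he
      simp at he
  rw [h]

/-- The series in `(t_2, z)` with given coefficients of the powers of `z`. -/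
def zSeries (u : ℕ → ℂ⟦X⟧) : SeriesTZ 2 := PowerSeries.mk fun n => inT2 (u n)

lemma zSeries_cauchy (u v : ℕ → ℂ⟦X⟧) : zSeries (cauchy u v) = zSeries u * zSeries v := by
  ext1 n
  simp only [zSeries, PowerSeries.coeff_mul, PowerSeries.coeff_mk, cauchy, map_sum, map_mul]

lemma zSeries_prev (u : ℕ → ℂ⟦X⟧) : zSeries (prev u) = zVar 2 * zSeries u := by
  ext1 n
  cases n with
  | zero => simp [zSeries, prev, zVar]
  | succ n => rw [zVar, PowerSeries.coeff_succ_X_mul]; simp [zSeries, prev]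

lemma zSeries_add (u v : ℕ → ℂ⟦X⟧) : zSeries (fun n => u n + v n) = zSeries u + zSeries v := by
  ext1 n; simp [zSeries]

lemma zSeries_sub (u v : ℕ → ℂ⟦X⟧) : zSeries (fun n => u n - v n) = zSeries u - zSeries v := by
  ext1 n; simp [zSeries]

lemma zSeries_mul_left (a : ℂ⟦X⟧) (u : ℕ → ℂ⟦X⟧) :
    zSeries (fun n => a * u n) = PowerSeries.C (inT2 a) * zSeries u := by
  ext1 n; simp [zSeries]

lemma dT_one_zSeries (u : ℕ → ℂ⟦X⟧) :
    dT 1 (zSeries u) = zSeries fun n => PowerSeries.derivative ℂ (u n) := by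
  ext1 n; simp [zSeries, dT, pderiv_one_inT2]

lemma dT_zero_zSeries (u : ℕ → ℂ⟦X⟧) : dT 0 (zSeries u) = 0 := by
  ext1 n; simp [zSeries, dT, pderiv_zero_inT2]

lemma exists_eq_zSeries {f : SeriesTZ 2} (hf : dT 0 f = 0) : ∃ u, f = zSeries u := by
  have h : ∀ n, ∃ b, PowerSeries.coeff n f = inT2 b := fun n => exists_eq_inT2 (by
    have := congrArg (PowerSeries.coeff n) hf
    rwa [dT, PowerSeries.coeff_mk, map_zero] at this)
  choose u hu using h
  exact ⟨u, PowerSeries.ext fun n => by rw [hu, zSeries, PowerSeries.coeff_mk]⟩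

lemma zSeries_mem_formalTZ {ρ₀ : ℝ≥0} (h0 : 0 < ρ₀) {u : ℕ → ℂ⟦X⟧} (hu : ∀ n, u n ∈ onDisc ρ₀) :
    zSeries u ∈ formalTZ 2 := by
  refine ⟨(ρ₀ / 2 : ℝ≥0), by positivity, fun n => ?_⟩
  rw [zSeries, PowerSeries.coeff_mk, convergesOn_inT2]
  exact hu n _ (by positivity) (NNReal.half_lt_self h0.ne')

/-! ### Gauge transformations between normal forms -/

/-- The equations for a gauge transformation between the forms `(*)` given by `f` and `f'` in terms
of its first column `(P, R)`. They are the equations in the second column of the matrix identity,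
divided by `z`, after its first column has been used to eliminate the second column of the
transformation. -/
structure IsGaugeColumn (m : ℕ) (f f' P R : SeriesTZ 2) : Prop where
  eq₁ : R * (f' - f) = 2 * dT 1 P + zVar 2 * dT 1 (dT 1 R)
  eq₂ : P * (f' - f) = PowerSeries.C (t2 ^ (m - 3)) *
      (((m - 2 : ℕ) : SeriesTZ 2) * R + 2 * (PowerSeries.C t2 * dT 1 R)) +
    zVar 2 * (dT 1 f * R + 2 * (f * dT 1 R) + dT 1 (dT 1 P))

lemma dT_one_C_t2_pow {m : ℕ} (hm : 3 ≤ m) : dT 1 (PowerSeries.C (t2 ^ (m - 2)) : SeriesTZ 2) =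
    ((m - 2 : ℕ) : SeriesTZ 2) * PowerSeries.C (t2 ^ (m - 3)) := by
  obtain ⟨j, rfl⟩ := Nat.exists_eq_add_of_le' hm
  rw [dT_C, show j + 3 - 2 = j + 1 by omega, show j + 3 - 3 = j by omega, t2,
    Derivation.leibniz_pow, MvPowerSeries.pderiv_X_self]
  simp

lemma C_t2_pow {m : ℕ} (hm : 3 ≤ m) : (PowerSeries.C (t2 ^ (m - 2)) : SeriesTZ 2) =
    PowerSeries.C (t2 ^ (m - 3)) * PowerSeries.C t2 := by
  obtain ⟨j, rfl⟩ := Nat.exists_eq_add_of_le' hm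
  rw [show j + 3 - 2 = j + 1 by omega, show j + 3 - 3 = j by omega, pow_succ, map_mul]

lemma IsGaugeColumn.isGauge {m : ℕ} (hm : 3 ≤ m) {f f' P R : SeriesTZ 2}
    (h : IsGaugeColumn m f f' P R) (hf : dT 0 f = 0) (hP : dT 0 P = 0) (hR : dT 0 R = 0) :
    IsGauge !![P, (PowerSeries.C (t2 ^ (m - 2)) + zVar 2 * f) * R + zVar 2 * dT 1 P;
      R, P + zVar 2 * dT 1 R] (normalForm m f) (normalForm m f') := by
  have h0 := dT_one_C_t2_pow hm
  have h1 := C_t2_pow hm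
  have hC : dT 0 (PowerSeries.C (t2 ^ (m - 2)) : SeriesTZ 2) = 0 := by
    simp [-map_pow, dT_C, t2, Derivation.leibniz_pow, MvPowerSeries.pderiv_X_of_ne]
  have hP' : dT 0 (dT 1 P) = 0 := by rw [dT_comm, hP, dT_zero]
  have hR' : dT 0 (dT 1 R) = 0 := by rw [dT_comm, hR, dT_zero]
  obtain ⟨e1, e2⟩ := h
  intro i
  fin_cases i
  · ext1 a b
    fin_cases a <;> fin_cases b <;>
      simp [-map_pow, normalForm_zero, dT_add, dT_mul, dT_zVar, hC, hf, hP, hR, hP', hR']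
  · simp only [Fin.mk_one, normalForm_one]
    ext1 a b
    fin_cases a <;> fin_cases b
    · simp [-map_pow, Matrix.mul_apply, Fin.sum_univ_two]
      ring
    · simp [-map_pow, Matrix.mul_apply, Fin.sum_univ_two, dT_add, dT_mul, dT_zVar]
      rw [h0]
      linear_combination (-zVar 2) * e2 + 2 * zVar 2 * dT 1 R * h1
    · simp [-map_pow, Matrix.mul_apply, Fin.sum_univ_two]
      ring
    · simp [-map_pow, Matrix.mul_apply, Fin.sum_univ_two, dT_add, dT_mul, dT_zVar]
      linear_combination (-zVar 2) * e1

lemma IsGauge.isGaugeColumn {m : ℕ} (hm : 3 ≤ m) {f f' : SeriesTZ 2}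
    {T : Matrix (Fin 2) (Fin 2) (SeriesTZ 2)} (h : IsGauge T (normalForm m f) (normalForm m f')) :
    IsGaugeColumn m f f' (T 0 0) (T 1 0) ∧
      T 0 1 = (PowerSeries.C (t2 ^ (m - 2)) + zVar 2 * f) * T 1 0 + zVar 2 * dT 1 (T 0 0) ∧
      T 1 1 = T 0 0 + zVar 2 * dT 1 (T 1 0) := by
  have h0 := dT_one_C_t2_pow hm
  have h1 := C_t2_pow hm
  have h := h 1
  rw [normalForm_one, normalForm_one] at h
  have e00 := congrFun (congrFun h 0) 0
  have e01 := congrFun (congrFun h 0) 1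
  have e10 := congrFun (congrFun h 1) 0
  have e11 := congrFun (congrFun h 1) 1
  simp [-map_pow, Matrix.mul_apply, Fin.sum_univ_two, Matrix.vecMul, dotProduct] at e00 e01 e10 e11
  have hq : T 0 1 = (PowerSeries.C (t2 ^ (m - 2)) + zVar 2 * f) * T 1 0 +
      zVar 2 * dT 1 (T 0 0) := by rw [← e00]; ring
  have hs : T 1 1 = T 0 0 + zVar 2 * dT 1 (T 1 0) := by rw [← e10]; ring
  refine ⟨⟨zVar_mul_cancel ?_, zVar_mul_cancel ?_⟩, hq, hs⟩
  · rw [hq, hs, dT_add, dT_zVar_mul] at e11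
    linear_combination -e11
  · rw [hq, hs, dT_add, dT_mul, dT_add, dT_zVar_mul, dT_zVar_mul, h0] at e01
    linear_combination -e01 + 2 * zVar 2 * dT 1 (T 1 0) * h1

/-- A gauge transformation between forms `(*)` is invertible if and only if its first entry is. -/
lemma ev0_det_column {m : ℕ} (hm : 3 ≤ m) (f P R P' R' : SeriesTZ 2) :
    ev0 2 (!![P, (PowerSeries.C (t2 ^ (m - 2)) + zVar 2 * f) * R + zVar 2 * P';
      R, P + zVar 2 * R']).det = ev0 2 P * ev0 2 P := by
  have hz : ev0 2 (zVar 2) = 0 := by rw [ev0_eq, z0_zVar, map_zero]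
  have ht : ev0 2 (PowerSeries.C (t2 ^ (m - 2))) = 0 := by
    rw [ev0_eq, z0_C, map_pow, t2, MvPowerSeries.constantCoeff_X, zero_pow (by omega)]
  rw [Matrix.det_fin_two_of]
  simp only [map_sub, map_mul, map_add, hz, ht]
  ring

lemma IsGauge.inv {d r : ℕ} {A A' : Fin d → Matrix (Fin r) (Fin r) (SeriesTZ d)}
    {T T' : Matrix (Fin r) (Fin r) (SeriesTZ d)} (h : IsGauge T A A') (hT : T * T' = 1) :
    IsGauge T' A' A := by
  intro i
  have hT' : T' * T = 1 := mul_eq_one_comm.1 hT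
  have hd : T.map (dT i) * T' + T * T'.map (dT i) = 0 := by
    rw [← map_dT_mul, hT, map_dT_one]
  have key : T * (zVar d • T'.map (dT i) + A' i * T') = A i := by
    rw [Matrix.mul_add, Matrix.mul_smul, ← Matrix.mul_assoc, ← h i, Matrix.add_mul,
      Matrix.mul_assoc, hT, Matrix.mul_one, Matrix.smul_mul, ← add_assoc, ← smul_add,
      add_comm (T * _), hd, smul_zero, zero_add]
  rw [← key, ← Matrix.mul_assoc, hT', Matrix.one_mul]

/-- A polynomial in `t_2` of degree `≤ k` that is divisible by `t_2 ^ (k + 1)` is zero. -/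
lemma aeval_t2_eq_zero {k : ℕ} {p : Polynomial ℂ} (hp : p.natDegree ≤ k)
    (h : t2 ^ (k + 1) ∣ Polynomial.aeval t2 p) : Polynomial.aeval t2 p = 0 := by
  ext e
  rw [map_zero]
  by_cases he : e 1 < k + 1
  · exact MvPowerSeries.X_pow_dvd_iff.1 h e he
  · rw [← inT2_coe, coeff_inT2, Polynomial.coeff_coe,
      Polynomial.coeff_eq_zero_of_natDegree_lt (by omega), ite_self]

lemma coeff_t2_mul_pderiv (a : SeriesT 2) (e : Fin 2 →₀ ℕ) :
    MvPowerSeries.coeff e (t2 * MvPowerSeries.pderiv (R := ℂ) 1 a) =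
      e 1 * MvPowerSeries.coeff e a := by
  by_cases h : e 1 = 0
  · rw [h, Nat.cast_zero, zero_mul]
    exact MvPowerSeries.X_dvd_iff.1 (Dvd.intro _ rfl) e h
  · have hle : Finsupp.single 1 1 ≤ e := by
      rw [Finsupp.single_le_iff]; omega
    obtain ⟨e', rfl⟩ := exists_add_of_le hle
    rw [t2, MvPowerSeries.X, MvPowerSeries.coeff_add_monomial_mul, one_mul,
      MvPowerSeries.coeff_pderiv, add_comm]
    simp
    ring

/-- The operator `a ↦ k a + 2 t_2 ∂_2 a` multiplies the monomials by positive integers. -/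
lemma euler_injective {k : ℕ} (hk : 1 ≤ k) {a : SeriesT 2}
    (ha : (k : SeriesT 2) * a + 2 * (t2 * MvPowerSeries.pderiv (R := ℂ) 1 a) = 0) : a = 0 := by
  ext e
  have h := MvPowerSeries.ext_iff.1 ha e
  have hk' : (k : SeriesT 2) = MvPowerSeries.C (k : ℂ) := by simp
  have h2 : (2 : SeriesT 2) = MvPowerSeries.C 2 := (map_ofNat MvPowerSeries.C 2).symm
  rw [map_add, hk', h2, MvPowerSeries.coeff_C_mul, MvPowerSeries.coeff_C_mul,
    coeff_t2_mul_pderiv, map_zero] at h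
  have hne : ((k + 2 * e 1 : ℕ) : ℂ) ≠ 0 := by
    rw [Nat.cast_ne_zero]; omega
  rw [map_zero]
  refine (mul_eq_zero.1 ?_).resolve_left hne
  push_cast
  linear_combination h

lemma dT_zVar_pow_mul {d : ℕ} (i : Fin d) (n : ℕ) (f : SeriesTZ d) :
    dT i (zVar d ^ n * f) = zVar d ^ n * dT i f := by
  induction n with
  | zero => simp
  | succ n ih => rw [pow_succ', mul_assoc, dT_zVar_mul, ih, mul_assoc]

lemma z0_dT {d : ℕ} (i : Fin d) (f : SeriesTZ d) :
    z0 d (dT i f) = MvPowerSeries.pderiv (R := ℂ) i (z0 d f) := by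
  rw [z0, ← PowerSeries.coeff_zero_eq_constantCoeff_apply,
    ← PowerSeries.coeff_zero_eq_constantCoeff_apply, dT, PowerSeries.coeff_mk]

/-- Two gauge equivalent reduced forms coincide: the difference `f' - f`, the entry `R` and the
derivative of `P` are divisible by all powers of `z`. -/
theorem IsGaugeColumn.eq_of_isReduced {m : ℕ} (hm : 3 ≤ m) {f f' P R : SeriesTZ 2}
    (h : IsGaugeColumn m f f' P R) (hP : ev0 2 P ≠ 0) (hf : IsReduced m f)
    (hf' : IsReduced m f') : f' = f := by
  rcases hm.eq_or_lt with rfl | hm4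
  · rw [hf.1 rfl, hf'.1 rfl]
  obtain ⟨p, hp, hfp⟩ := hf.2 hm4
  obtain ⟨p', hp', hfp'⟩ := hf'.2 hm4
  have hcoeff : ∀ n, PowerSeries.coeff n (f' - f) = Polynomial.aeval t2 (p' n - p n) := by
    intro n
    rw [hfp, hfp', map_sub, PowerSeries.coeff_mk, PowerSeries.coeff_mk, map_sub]
  obtain ⟨e1, e2⟩ := h
  have hPunit : IsUnit (z0 2 P) := isUnit_of_constantCoeff hP
  have hcancel : ∀ (n : ℕ) {a b : SeriesTZ 2}, zVar 2 ^ n * a = zVar 2 ^ n * b → a = b :=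
    fun n a b h => mul_left_cancel₀ (pow_ne_zero n PowerSeries.X_ne_zero) h
  have key : ∀ n, zVar 2 ^ n ∣ f' - f ∧ zVar 2 ^ n ∣ R ∧ zVar 2 ^ n ∣ dT 1 P := by
    intro n
    induction n with
    | zero => simp
    | succ n ih =>
      obtain ⟨⟨δ, hδ⟩, ⟨r, hr⟩, ⟨q, hq⟩⟩ := ih
      have e2' : P * δ = PowerSeries.C (t2 ^ (m - 3)) *
            (((m - 2 : ℕ) : SeriesTZ 2) * r + 2 * (PowerSeries.C t2 * dT 1 r)) +
          zVar 2 * (dT 1 f * r + 2 * (f * dT 1 r) + dT 1 q) := by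
        refine hcancel n ?_
        rw [hδ, hq, hr, dT_zVar_pow_mul, dT_zVar_pow_mul] at e2
        linear_combination e2
      have e1' : r * (f' - f) = 2 * q + zVar 2 * dT 1 (dT 1 r) := by
        refine hcancel n ?_
        rw [hq, hr, dT_zVar_pow_mul, dT_zVar_pow_mul] at e1
        linear_combination e1
      -- At `z = 0` the second equation shows `t_2 ^ (m - 3) ∣ δ`, and `δ` has degree `≤ m - 4`.
      have e2z := congrArg (z0 2) e2'
      simp only [map_mul, map_add, z0_zVar, z0_C, zero_mul, add_zero, z0_dT, map_natCast,
        map_ofNat, map_pow] at e2z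
      have hδn : z0 2 δ = PowerSeries.coeff n (f' - f) := by
        rw [hδ, zVar, PowerSeries.coeff_X_pow_mul', if_pos le_rfl, Nat.sub_self,
          PowerSeries.coeff_zero_eq_constantCoeff_apply]
        rfl
      have hδ0 : z0 2 δ = 0 := by
        rw [hδn, hcoeff]
        refine aeval_t2_eq_zero (k := m - 4) ?_ ?_
        · exact (Polynomial.natDegree_sub_le _ _).trans (max_le (hp' n) (hp n))
        · rw [← hcoeff, ← hδn, show m - 4 + 1 = m - 3 by omega]
          exact (hPunit.dvd_mul_left).1 (Dvd.intro _ e2z.symm)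
      have hr0 : z0 2 r = 0 := by
        rw [hδ0, mul_zero] at e2z
        have ht : (t2 : SeriesT 2) ^ (m - 3) ≠ 0 := pow_ne_zero _ (by
          intro h0
          have := MvPowerSeries.ext_iff.1 h0 (Finsupp.single 1 1)
          rw [t2, MvPowerSeries.coeff_index_single_self_X, map_zero] at this
          exact one_ne_zero this)
        exact euler_injective (k := m - 2) (by omega)
          ((mul_eq_zero.1 e2z.symm).resolve_left ht)
      have hq0 : z0 2 q = 0 := by
        have e1z := congrArg (z0 2) e1'
        simp only [map_mul, map_add, z0_zVar, zero_mul, add_zero, hr0, map_ofNat] at e1z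
        have h2 : IsUnit (2 : SeriesT 2) := isUnit_of_constantCoeff (by
          rw [map_ofNat]
          exact two_ne_zero)
        exact (h2.mul_right_eq_zero).1 e1z.symm
      obtain ⟨δ', rfl⟩ := exists_eq_zVar_mul hδ0
      obtain ⟨r', rfl⟩ := exists_eq_zVar_mul hr0
      obtain ⟨q', rfl⟩ := exists_eq_zVar_mul hq0
      exact ⟨⟨δ', by rw [hδ]; ring⟩, ⟨r', by rw [hr]; ring⟩, ⟨q', by rw [hq]; ring⟩⟩
  refine sub_eq_zero.1 (PowerSeries.ext fun n => ?_)
  rw [map_zero]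
  exact PowerSeries.X_pow_dvd_iff.1 (key (n + 1)).1 n (Nat.lt_succ_self n)

/-- Every formal normal form is gauge isomorphic to a reduced one. -/
theorem exists_isReduced {m : ℕ} (hm : 3 ≤ m) {f : SeriesTZ 2} (hf : f ∈ formalTZ 2)
    (hf0 : dT 0 f = 0) :
    ∃ f', IsReduced m f' ∧ f' ∈ formalTZ 2 ∧ dT 0 f' = 0 ∧
      GaugeIso (formalTZ 2) (normalForm m f) (normalForm m f') := by
  obtain ⟨φ, rfl⟩ := exists_eq_zSeries hf0
  obtain ⟨ρ₁, hρ₁, hconv⟩ := id hf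
  lift ρ₁ to ℝ≥0 using hρ₁.le
  have hφ : ∀ n, φ n ∈ onDisc ρ₁ := fun n ρ _ hlt => by
    have := hconv n
    rw [zSeries, PowerSeries.coeff_mk, convergesOn_inT2] at this
    exact ne_top_of_le_ne_top this (rNorm_mono hlt.le _)
  obtain ⟨ρ₀, hρ₀, -, x, hx0, hx⟩ :=
    exists_reduction (k := m - 2) (by omega) (by exact_mod_cast hρ₁) φ hφ
  let P := zSeries fun n => (x n).1
  let R := zSeries fun n => (x n).2.1
  let f' := zSeries fun n => ((x n).2.2 : ℂ⟦X⟧)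
  have hP : P ∈ formalRing 2 := mem_formalRing.2 (zSeries_mem_formalTZ hρ₀ fun n => (hx n).1)
  have hR : R ∈ formalRing 2 := mem_formalRing.2 (zSeries_mem_formalTZ hρ₀ fun n => (hx n).2.1)
  have hC2 : (PowerSeries.C (inT2 2) : SeriesTZ 2) = 2 := by
    rw [map_ofNat, map_ofNat]
  have hcol : IsGaugeColumn m (zSeries φ) f' P R := by
    constructor
    · have h := congrArg zSeries (funext fun n => (hx n).2.2.2.1)
      rw [zSeries_cauchy, zSeries_sub, zSeries_add, zSeries_mul_left, zSeries_prev, hC2,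
        ← dT_one_zSeries, ← dT_one_zSeries, ← dT_one_zSeries] at h
      exact h
    · have h := congrArg zSeries (funext fun n => (hx n).2.2.2.2)
      rw [zSeries_cauchy, zSeries_sub, zSeries_add, zSeries_mul_left, zSeries_prev, zSeries_add,
        zSeries_add, zSeries_add, zSeries_mul_left, zSeries_mul_left, zSeries_mul_left,
        zSeries_mul_left, zSeries_cauchy, zSeries_cauchy, hC2,
        ← dT_one_zSeries, ← dT_one_zSeries, ← dT_one_zSeries, ← dT_one_zSeries, map_pow,
        inT2_X, show m - 2 - 1 = m - 3 by omega, map_natCast, map_natCast] at h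
      exact h
  have hadm := isAdmissible_formalRing 2
  have hff : zSeries φ ∈ formalRing 2 := mem_formalRing.2 hf
  refine ⟨f', ⟨fun h3 => ?_, fun h4 => ?_⟩, ?_, dT_zero_zSeries _, gaugeIso_iff.2 ⟨_, ?_, ?_,
    hcol.isGauge hm hf0 (dT_zero_zSeries _) (dT_zero_zSeries _)⟩⟩
  · ext1 n
    have : (x n).2.2 = 0 := Polynomial.ext fun j => by
      rw [(hx n).2.2.1 j (by omega), Polynomial.coeff_zero]
    simp [f', zSeries, this]
  · refine ⟨fun n => (x n).2.2, fun n => ?_, ?_⟩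
    · exact Polynomial.natDegree_le_iff_coeff_eq_zero.2 fun j hj => (hx n).2.2.1 j (by omega)
    · simp only [f', zSeries, inT2_coe]
  · exact zSeries_mem_formalTZ one_pos fun n => coe_mem_onDisc _
  · intro a b
    have h := hadm.dT_mem
    have hz := hadm.zVar_mem
    rw [← mem_formalRing]
    fin_cases a <;> fin_cases b
    · exact hP
    · refine Subring.add_mem _ (Subring.mul_mem _ (Subring.add_mem _ ?_
        (Subring.mul_mem _ hz hff)) hR) (Subring.mul_mem _ hz (h _ _ hP))
      rw [map_pow]
      exact Subring.pow_mem _ (hadm.var_mem 1) _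
    · exact hR
    · exact Subring.add_mem _ hP (Subring.mul_mem _ hz (h _ _ hR))
  · rw [ev0_det_column hm]
    have : ev0 2 P = 1 := by
      rw [ev0_eq, ← hx0]
      have hz : z0 2 P = inT2 (x 0).1 := by
        simp only [P, zSeries]
        rw [z0, ← PowerSeries.coeff_zero_eq_constantCoeff_apply, PowerSeries.coeff_mk]
      rw [hz, ← MvPowerSeries.coeff_zero_eq_constantCoeff_apply, coeff_inT2]
      simp
    rw [this]
    norm_num

lemma coe_convRing (d : ℕ) : (convRing d : Set (SeriesTZ d)) = convTZ d :=
  Set.ext fun _ => mem_convRing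

lemma coe_formalRing (d : ℕ) : (formalRing d : Set (SeriesTZ d)) = formalTZ d :=
  Set.ext fun _ => mem_formalRing

end TStr
end

theorem theorem4p1 (m : ℕ) (hm : 3 ≤ m) :
    (∀ (r : ℕ) (A : Fin 2 → Matrix (Fin r) (Fin r) (TStr.SeriesTZ 2)),
      TStr.IsTStructureOverI2 (TStr.convTZ 2) m A →
        ∃ f ∈ TStr.convTZ 2,
          TStr.IsTStructureOverI2 (TStr.convTZ 2) m (TStr.normalForm m f) ∧
          TStr.GaugeIso (TStr.convTZ 2) A (TStr.normalForm m f)) ∧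
    (∀ (r : ℕ) (A : Fin 2 → Matrix (Fin r) (Fin r) (TStr.SeriesTZ 2)),
      TStr.IsTStructureOverI2 (TStr.formalTZ 2) m A →
        ∃ f ∈ TStr.formalTZ 2,
          TStr.IsTStructureOverI2 (TStr.formalTZ 2) m (TStr.normalForm m f) ∧
          TStr.GaugeIso (TStr.formalTZ 2) A (TStr.normalForm m f)) ∧
    (∀ (r : ℕ) (A : Fin 2 → Matrix (Fin r) (Fin r) (TStr.SeriesTZ 2)),
      TStr.IsTStructureOverI2 (TStr.convTZ 2) m A ∨
          TStr.IsTStructureOverI2 (TStr.formalTZ 2) m A →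
        ∃ f, TStr.IsReduced m f ∧
          TStr.IsTStructureOverI2 (TStr.formalTZ 2) m (TStr.normalForm m f) ∧
          TStr.GaugeIso (TStr.formalTZ 2) A (TStr.normalForm m f) ∧
          ∀ g, TStr.IsReduced m g →
            TStr.GaugeIso (TStr.formalTZ 2) A (TStr.normalForm m g) → g = f) := by
  open TStr in
  refine ⟨fun r A hA => ?_, fun r A hA => ?_, fun r A hA => ?_⟩
  · rw [← coe_convRing] at hA ⊢
    obtain ⟨f, hf, hf0, hg⟩ := (isAdmissible_convRing 2).exists_normalForm hA
    exact ⟨f, hf, isTStructureOverI2_normalForm (isAdmissible_convRing 2) m hf hf0, hg⟩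
  · rw [← coe_formalRing] at hA ⊢
    obtain ⟨f, hf, hf0, hg⟩ := (isAdmissible_formalRing 2).exists_normalForm hA
    exact ⟨f, hf, isTStructureOverI2_normalForm (isAdmissible_formalRing 2) m hf hf0, hg⟩
  · have hA' : IsTStructureOverI2 (formalTZ 2) m A := by
      rcases hA with hA | hA
      · exact ⟨⟨fun i a b => convTZ_subset_formalTZ 2 (hA.1.1 i a b), hA.1.2⟩, hA.2⟩
      · exact hA
    obtain rfl : r = 2 := by
      obtain ⟨ζ, hζ, -⟩ := hA'.2
      exact hζ.rank_eq
    rw [← coe_formalRing] at hA'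
    obtain ⟨f₀, hf₀, hf₀0, hg₀⟩ := (isAdmissible_formalRing 2).exists_normalForm hA'
    obtain ⟨f, hred, hf, hf0, hg⟩ := exists_isReduced hm (mem_formalRing.1 hf₀) hf₀0
    rw [← coe_formalRing] at hg ⊢
    have hAf := hg₀.trans hg
    refine ⟨f, hred, isTStructureOverI2_normalForm (isAdmissible_formalRing 2) m
      (mem_formalRing.2 hf) hf0, hAf, fun g hgred hAg => ?_⟩
    -- The two gauge isomorphisms with `A` compose to one between the two reduced forms.
    obtain ⟨T, hT, hTdet, hTg⟩ := gaugeIso_iff.1 hAf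
    obtain ⟨S, -, hSdet, hSg⟩ := gaugeIso_iff.1 hAg
    obtain ⟨T', -, hTT', -⟩ := (isAdmissible_formalRing 2).exists_matrix_inv hT hTdet
    have hdet : ev0 2 (T' * S).det ≠ 0 := by
      rw [Matrix.det_mul, map_mul]
      refine mul_ne_zero (fun h0 => ?_) hSdet
      have := congrArg (fun M => ev0 2 M.det) hTT'
      simp [h0] at this
    obtain ⟨hcol, h01, h11⟩ := ((hTg.inv hTT').mul hSg).isGaugeColumn hm
    refine hcol.eq_of_isReduced hm (fun h0 => hdet ?_) hred hgred
    have heta := Matrix.eta_fin_two (T' * S)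
    rw [h01, h11] at heta
    rw [heta, ev0_det_column hm, h0, zero_mul]
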